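/- A map is a cellular embedding of a finite connected graph in a closed surface. Let $X$ be a finite group. A rotary pair of $X$ is a pair $(x,y)$ with $X=\langle x,y\rangle$ and $|y|=2$. Write $\operatorname{Map}(X,x,y)$ for the corresponding bi-rotary map: $X$ acts regularly on its arcs, $x$ generates the stabilizer of a vertex and rotates around it, and the involution $y$ reverses an edge at that vertex while fixing the two faces at that edge. A map has type $(k,m)$ if all vertices have valency $k$ and all faces have length $m$; its Euler characteristic is that of its surface. $\operatorname{O}_p(X)$ is the largest normal $p$-subgroup of $X$, and $A{:}B$ denotes a semidirect product with normal factor $A$. **Theorem.** (1) Let $\mathcal M=\operatorname{Map}(X,x,y)$ be a bi-rotary map of Euler characteristic $-p^n$, where $p$ is a prime and $n\ge 1$, let $G=X/\operatorname{O}_p(X)$, and let $\rho,\tau$ be the images of $x,y$ in $G$. Suppose that $G$ is non-abelian and solvable. Then $(\rho,\tau)$ is a rotary pair of $G$, and there are $a,b\in G$ and a Hall $\{2,3\}$-subgroup $H$ of $G$ with $$G=\langle a\rangle{:}(\langle b\rangle\times H),\qquad |a|,\ |b|,\ |H|\ \text{pairwise coprime},$$ such that, with $k_2=|b|$, $m_2=|a|$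 and suitable integers $e,f\ge1$, the group $H$, the pair $(\rho,\tau)$ and the type $(\bar k,\bar m)$ of the quotient map $\operatorname{Map}(G,\rho,\tau)$ are as in one of the following seven rows. In rows 1, 2, 3, 5, 6 one puts $m_2'=|C_{\langle a\rangle}(\langle\kappa\rangle)|$ with the $\kappa$ given there. 1. $H=\langle\rho_0\rangle\cong Z_{k_1}$ with $k_1$ even; $(\rho,\tau)=(ab\rho_0,\rho_0^{k_1/2})$; $(\bar k,\bar m)=(k_1k_2m_2',\,2m_2)$, $\kappa=b\rho_0$. 2. $H=\langle\rho_0\rangle\times\langle\tau_0\rangle\cong Z_{k_1}\times Z_2$; $(\rho,\tau)=(ab\rho_0,\tau_0)$; $(\bar k,\bar m)=(k_1k_2m_2',\,2m_2)$, $\kappa=b\rho_0$; $p=2$. 3. $H=\langle c\rangle{:}\langle d\rangle\cong D_{2\cdot3^e}$ (the dihedral group of order $2\cdot 3^e$, with $|c|=3^e$ and $|d|=2$); $(\rho,\tau)=(abc,d)$; $(\bar k,\bar m)=(3^ek_2m_2',\,2\cdot3^em_2)$, $\kappa=bc$; $p=2$. 4. $H=\langle c\rangle{:}\langle d\rangle\cong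 D_{2\cdot3^e}$ as in row 3; $(\rho,\tau)=(abcd,d)$; $(\bar k,\bar m)=(2k_2,\,2\cdot3^em_2)$; $p\ne3$. 5. $H=\langle d_1\rangle\times(\langle c\rangle{:}\langle d_2\rangle)\cong Z_{2^f}\times D_{2\cdot3^e}$; $(\rho,\tau)=(abcd_1,d_2)$; $(\bar k,\bar m)=(2^f3^ek_2m_2',\,2\cdot3^em_2)$, $\kappa=bcd_1$; $p=2$. 6. $H=\langle d_1\rangle\times(\langle c\rangle{:}\langle d_2\rangle)\cong Z_{2^f}\times D_{2\cdot3^e}$; $(\rho,\tau)=(abcd_1d_2,d_2)$; $(\bar k,\bar m)=(2^fk_2m_2',\,2\cdot3^em_2)$, $\kappa=bcd_1d_2$; $p=2$. 7. $H=(\langle d_1\rangle\times\langle d_2\rangle){:}\langle c\rangle\cong Z_2^2{:}Z_{3^e}$, where $c$ permutes $d_1,d_2,d_1d_2$ cyclically; $(\rho,\tau)=(bc,d_1)$; $(\bar k,\bar m)=(3^ek_2,\,4)$; $p\ne2$ and $a=1$. (2) Each row occurs infinitely often: for each of the seven rows there is a prime $p$ such that for infinitely many $n\ge1$ there is a bi-rotary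 map $\operatorname{Map}(X,x,y)$ of Euler characteristic $-p^n$ for which $X/\operatorname{O}_p(X)$ is non-abelian and solvable and is as in that row. -/

import Mathlib

universe u

/-- A map (cellular embedding of a finite connected graph in a closed surface), given
combinatorially by its flags: `r0`, `r1`, `r2` change the vertex, the edge and the face of a flag,
respectively.  The vertices, edges and faces are the orbits of `⟨r1, r2⟩`, `⟨r0, r2⟩` and
`⟨r0, r1⟩` on the flags. -/
structure CombMap where
  Flag : Type u
  finite : Finite Flag
  nonempty : Nonempty Flag
  r0 : Equiv.Perm Flag
  r1 : Equiv.Perm Flag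
  r2 : Equiv.Perm Flag
  r0_invol : ∀ z, r0 (r0 z) = z
  r1_invol : ∀ z, r1 (r1 z) = z
  r2_invol : ∀ z, r2 (r2 z) = z
  r0_ne : ∀ z, r0 z ≠ z
  r1_ne : ∀ z, r1 z ≠ z
  r2_ne : ∀ z, r2 z ≠ z
  r0_r2_comm : ∀ z, r0 (r2 z) = r2 (r0 z)
  r0_r2_ne : ∀ z, r0 (r2 z) ≠ z
  connected : MulAction.IsPretransitive (Subgroup.closure {r0, r1, r2}) Flag

namespace CombMap

variable (M : CombMap.{u})

def Vertex : Type u :=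
  MulAction.orbitRel.Quotient (Subgroup.closure {M.r1, M.r2}) M.Flag

def Edge : Type u :=
  MulAction.orbitRel.Quotient (Subgroup.closure {M.r0, M.r2}) M.Flag

def Face : Type u :=
  MulAction.orbitRel.Quotient (Subgroup.closure {M.r0, M.r1}) M.Flag

/-- The Euler characteristic of the supporting surface. -/
noncomputable def eulerChar : ℤ :=
  (Nat.card M.Vertex : ℤ) - Nat.card M.Edge + Nat.card M.Face

/-- `M` has type `(k, m)`: every vertex has valency `k` and every face has length `m`.
A vertex of valency `k` lies on `2 * k` flags, a face of length `m` lies on `2 * m` flags. -/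
def HasType (k m : ℕ) : Prop :=
  ∀ z : M.Flag,
    Nat.card (MulAction.orbit (Subgroup.closure {M.r1, M.r2}) z) = 2 * k ∧
    Nat.card (MulAction.orbit (Subgroup.closure {M.r0, M.r1}) z) = 2 * m

end CombMap

/-- `(x, y)` is a rotary pair of the group `X`. -/
structure IsRotaryPair {X : Type u} [Group X] (x y : X) : Prop where
  orderOf_eq : orderOf y = 2
  closure_eq : Subgroup.closure {x, y} = ⊤

theorem IsRotaryPair.mul_self {X : Type u} [Group X] {x y : X} (h : IsRotaryPair x y) :
    y * y = 1 := by
  have := pow_orderOf_eq_one y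
  rwa [h.orderOf_eq, pow_two] at this

theorem IsRotaryPair.ne_one {X : Type u} [Group X] {x y : X} (h : IsRotaryPair x y) :
    y ≠ 1 := by
  intro hy
  have := h.orderOf_eq
  simp [hy] at this

section BiRotaryMap

variable {X : Type u} [Group X]

/-- The flags of `Map(X, x, y)` are the pairs `(g, s)`, where `g` stands for the arc obtained from
the base arc by `g` and `s` for one of the two sides of that arc.  The group `X` acts by left
multiplication: it is regular on arcs and preserves sides; `x` rotates around the base vertex, and
`y` reverses the base edge and keeps its two sides, i.e. fixes the two faces at that edge. -/
def biRotaryR0 (x y : X) (h : IsRotaryPair x y) : Equiv.Perm (X × Bool) where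
  toFun z := (z.1 * y, z.2)
  invFun z := (z.1 * y, z.2)
  left_inv z := by simp [mul_assoc, h.mul_self]
  right_inv z := by simp [mul_assoc, h.mul_self]

/-- Pass to the neighbouring arc at the same vertex, across the corner at the given side. -/
def biRotaryR1 (x : X) : Equiv.Perm (X × Bool) where
  toFun z := (if z.2 then z.1 * x else z.1 * x⁻¹, !z.2)
  invFun z := (if z.2 then z.1 * x else z.1 * x⁻¹, !z.2)
  left_inv := by rintro ⟨g, s⟩; cases s <;> simp
  right_inv := by rintro ⟨g, s⟩; cases s <;> simp

def biRotaryR2 : Equiv.Perm (X × Bool) where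
  toFun z := (z.1, !z.2)
  invFun z := (z.1, !z.2)
  left_inv z := by simp
  right_inv z := by simp

theorem biRotary_connected (x y : X) (h : IsRotaryPair x y) :
    MulAction.IsPretransitive
      (Subgroup.closure {biRotaryR0 x y h, biRotaryR1 x, biRotaryR2}) (X × Bool) := by
  set S : Subgroup (Equiv.Perm (X × Bool)) :=
    Subgroup.closure {biRotaryR0 x y h, biRotaryR1 x, biRotaryR2} with hS
  have h0 : biRotaryR0 x y h ∈ S := Subgroup.subset_closure (by simp)
  have h1 : biRotaryR1 x ∈ S := Subgroup.subset_closure (by simp)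
  have h2 : biRotaryR2 ∈ S := Subgroup.subset_closure (by simp)
  have key : ∀ g : X, ∀ k : X, ∃ σ ∈ S, σ (k, true) = (k * g, true) := by
    intro g
    have hg : g ∈ Subgroup.closure {x, y} := by rw [h.closure_eq]; trivial
    induction hg using Subgroup.closure_induction with
    | mem g hg =>
      intro k
      rcases hg with rfl | rfl
      · exact ⟨biRotaryR2 * biRotaryR1 g, S.mul_mem h2 h1, by simp [biRotaryR1, biRotaryR2]⟩
      · exact ⟨biRotaryR0 x g h, h0, by simp [biRotaryR0]⟩
    | one => exact fun k => ⟨1, S.one_mem, by simp⟩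
    | mul a b _ _ ha hb =>
      intro k
      obtain ⟨σ, hσ, e1⟩ := ha k
      obtain ⟨π, hπ, e2⟩ := hb (k * a)
      exact ⟨π * σ, S.mul_mem hπ hσ, by rw [Equiv.Perm.mul_apply, e1, e2, mul_assoc]⟩
    | inv a _ ha =>
      intro k
      obtain ⟨σ, hσ, e⟩ := ha (k * a⁻¹)
      refine ⟨σ⁻¹, S.inv_mem hσ, ?_⟩
      rw [Equiv.Perm.inv_eq_iff_eq, e]
      simp
  have base : ∀ z : X × Bool, ∃ σ ∈ S, σ (1, true) = z := by
    rintro ⟨g, s⟩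
    obtain ⟨σ, hσ, e⟩ := key g 1
    cases s
    · exact ⟨biRotaryR2 * σ, S.mul_mem h2 hσ, by
        rw [Equiv.Perm.mul_apply, e]; simp [biRotaryR2]⟩
    · exact ⟨σ, hσ, by simpa using e⟩
  refine ⟨fun z w => ?_⟩
  obtain ⟨σ, hσ, e1⟩ := base z
  obtain ⟨π, hπ, e2⟩ := base w
  refine ⟨⟨π * σ⁻¹, S.mul_mem hπ (S.inv_mem hσ)⟩, ?_⟩
  change (π * σ⁻¹) z = w
  rw [← e1, ← e2]
  simp

/-- The bi-rotary map `Map(X, x, y)`. -/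
def biRotaryMap [Finite X] (x y : X) (h : IsRotaryPair x y) : CombMap.{u} where
  Flag := X × Bool
  finite := inferInstance
  nonempty := inferInstance
  r0 := biRotaryR0 x y h
  r1 := biRotaryR1 x
  r2 := biRotaryR2
  r0_invol := (biRotaryR0 x y h).left_inv
  r1_invol := (biRotaryR1 x).left_inv
  r2_invol := biRotaryR2.left_inv
  r0_ne z hz := h.ne_one (by simpa [biRotaryR0] using congrArg Prod.fst hz)
  r1_ne z hz := by simpa [biRotaryR1] using congrArg Prod.snd hz
  r2_ne z hz := by simpa [biRotaryR2] using congrArg Prod.snd hz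
  r0_r2_comm z := rfl
  r0_r2_ne z hz := by simpa [biRotaryR0, biRotaryR2] using congrArg Prod.snd hz
  connected := biRotary_connected x y h

end BiRotaryMap

/-- `O_p(X)`: the subgroup generated by all normal `p`-subgroups (for finite `X` this is the
largest normal `p`-subgroup). -/
def pCore (p : ℕ) (X : Type u) [Group X] : Subgroup X :=
  sSup {N : Subgroup X | N.Normal ∧ IsPGroup p N}

instance pCore_normal (p : ℕ) (X : Type u) [Group X] : (pCore p X).Normal :=
  Subgroup.sSup_normal _ fun _ hN => hN.1

section Structure

variable {G : Type u} [Group G]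

/-- `L = N : K`, an internal semidirect product with normal factor `N`. -/
def IsInternalSemidirect (N K L : Subgroup G) : Prop :=
  N ⊔ K = L ∧ Disjoint N K ∧ ∀ k ∈ K, ∀ n ∈ N, k * n * k⁻¹ ∈ N

/-- `L = A × B`, an internal direct product. -/
def IsInternalDirect (A B L : Subgroup G) : Prop :=
  A ⊔ B = L ∧ Disjoint A B ∧ ∀ s ∈ A, ∀ t ∈ B, s * t = t * s

/-- `H` is a Hall `{2, 3}`-subgroup of the finite group `G`. -/
def IsHallTwoThree (H : Subgroup G) : Prop :=
  (∀ q : ℕ, q.Prime → q ∣ Nat.card H → q = 2 ∨ q = 3) ∧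
  (∀ q : ℕ, q.Prime → q ∣ H.index → q ≠ 2 ∧ q ≠ 3)

/-- `G = ⟨a⟩ : (⟨b⟩ × H)`, where `H` is a Hall `{2, 3}`-subgroup of `G` and the orders of
`a`, `b`, `H` are pairwise coprime. -/
def HasHallDecomposition (a b : G) (H : Subgroup G) : Prop :=
  IsHallTwoThree H ∧
  IsInternalDirect (Subgroup.zpowers b) H (Subgroup.zpowers b ⊔ H) ∧
  IsInternalSemidirect (Subgroup.zpowers a) (Subgroup.zpowers b ⊔ H) ⊤ ∧
  (orderOf a).Coprime (orderOf b) ∧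
  (orderOf a).Coprime (Nat.card H) ∧
  (orderOf b).Coprime (Nat.card H)

/-- `D = ⟨c⟩ : ⟨d⟩` is dihedral of order `2 * 3 ^ e`. -/
def IsDihedralThree (e : ℕ) (c d : G) (D : Subgroup G) : Prop :=
  IsInternalSemidirect (Subgroup.zpowers c) (Subgroup.zpowers d) D ∧
  orderOf c = 3 ^ e ∧ orderOf d = 2 ∧ d * c * d⁻¹ = c⁻¹

/-- The order of the centralizer of `⟨κ⟩` in `⟨a⟩`. -/
noncomputable def centOrder (a κ : G) : ℕ :=
  Nat.card (Subgroup.zpowers a ⊓ Subgroup.centralizer (Subgroup.zpowers κ : Set G) : Subgroup G)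

/-- The rows of the table of solvable cases. -/
inductive SolvableRow
  /-- `H = Z_{k₁}`. -/
  | cyclic
  /-- `H = Z_{k₁} × Z_2`. -/
  | cyclicTimesTwo
  /-- `H = D_{2·3^e}`, with `ρ₀` a rotation. -/
  | dihedralRotation
  /-- `H = D_{2·3^e}`, with `ρ₀` a reflection. -/
  | dihedralReflection
  /-- `H = Z_{2^f} × D_{2·3^e}`, with `ρ₀ = c d₁`. -/
  | cyclicTimesDihedralRotation
  /-- `H = Z_{2^f} × D_{2·3^e}`, with `ρ₀ = c d₁ d₂`. -/
  | cyclicTimesDihedralReflection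
  /-- `H = Z_2² : Z_{3^e}`. -/
  | kleinByCyclic

/-- The entries of a row: the structure of `H`, the type `(k, m)`, the standard rotary pair
`(ρ, τ)` and the restrictions on `p` and `a`. -/
def SolvableRow.Holds (p : ℕ) (a b : G) (H : Subgroup G) (ρ τ : G) (k m : ℕ) :
    SolvableRow → Prop
  | cyclic => ∃ ρ₀ : G,
      Subgroup.zpowers ρ₀ = H ∧ Even (orderOf ρ₀) ∧
      ρ = a * b * ρ₀ ∧ τ = ρ₀ ^ (orderOf ρ₀ / 2) ∧
      k = orderOf ρ₀ * orderOf b * centOrder a (b * ρ₀) ∧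
      m = 2 * orderOf a
  | cyclicTimesTwo => ∃ ρ₀ τ₀ : G,
      IsInternalDirect (Subgroup.zpowers ρ₀) (Subgroup.zpowers τ₀) H ∧ orderOf τ₀ = 2 ∧
      ρ = a * b * ρ₀ ∧ τ = τ₀ ∧
      k = orderOf ρ₀ * orderOf b * centOrder a (b * ρ₀) ∧
      m = 2 * orderOf a ∧
      p = 2
  | dihedralRotation => ∃ (e : ℕ) (c d : G),
      0 < e ∧ IsDihedralThree e c d H ∧
      ρ = a * b * c ∧ τ = d ∧
      k = 3 ^ e * orderOf b * centOrder a (b * c) ∧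
      m = 2 * 3 ^ e * orderOf a ∧
      p = 2
  | dihedralReflection => ∃ (e : ℕ) (c d : G),
      0 < e ∧ IsDihedralThree e c d H ∧
      ρ = a * b * c * d ∧ τ = d ∧
      k = 2 * orderOf b ∧
      m = 2 * 3 ^ e * orderOf a ∧
      p ≠ 3
  | cyclicTimesDihedralRotation => ∃ (e f : ℕ) (c d₁ d₂ : G) (D : Subgroup G),
      0 < e ∧ 0 < f ∧ IsDihedralThree e c d₂ D ∧ orderOf d₁ = 2 ^ f ∧
      IsInternalDirect (Subgroup.zpowers d₁) D H ∧
      ρ = a * b * c * d₁ ∧ τ = d₂ ∧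
      k = 2 ^ f * 3 ^ e * orderOf b * centOrder a (b * c * d₁) ∧
      m = 2 * 3 ^ e * orderOf a ∧
      p = 2
  | cyclicTimesDihedralReflection => ∃ (e f : ℕ) (c d₁ d₂ : G) (D : Subgroup G),
      0 < e ∧ 0 < f ∧ IsDihedralThree e c d₂ D ∧ orderOf d₁ = 2 ^ f ∧
      IsInternalDirect (Subgroup.zpowers d₁) D H ∧
      ρ = a * b * c * d₁ * d₂ ∧ τ = d₂ ∧
      k = 2 ^ f * orderOf b * centOrder a (b * c * d₁ * d₂) ∧
      m = 2 * 3 ^ e * orderOf a ∧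
      p = 2
  | kleinByCyclic => ∃ (e : ℕ) (c d₁ d₂ : G) (V : Subgroup G),
      0 < e ∧ orderOf d₁ = 2 ∧ orderOf d₂ = 2 ∧
      IsInternalDirect (Subgroup.zpowers d₁) (Subgroup.zpowers d₂) V ∧
      orderOf c = 3 ^ e ∧ IsInternalSemidirect V (Subgroup.zpowers c) H ∧
      c * d₁ * c⁻¹ = d₂ ∧ c * d₂ * c⁻¹ = d₁ * d₂ ∧
      ρ = b * c ∧ τ = d₁ ∧
      k = 3 ^ e * orderOf b ∧
      m = 4 ∧
      p ≠ 2 ∧ a = 1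

end Structure

/-- `Map(X, x, y)` has Euler characteristic `-p ^ n` for the prime `p` and some `n ≥ 1`, and
`X / O_p(X)` is non-abelian and solvable. -/
def IsSolvableCase (p n : ℕ) {X : Type u} [Group X] [Finite X] (x y : X)
    (h : IsRotaryPair x y) : Prop :=
  p.Prime ∧ 0 < n ∧ (biRotaryMap x y h).eulerChar = -(p : ℤ) ^ n ∧
  (¬ ∀ s t : X ⧸ pCore p X, s * t = t * s) ∧ Group.IsSolvable (X ⧸ pCore p X)

/-- The quotient map `Map(G, ρ, τ)`, where `G = X / O_p(X)` and `ρ`, `τ` are the images of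
`x`, `y`, is a bi-rotary map, `G = ⟨a⟩ : (⟨b⟩ × H)` as in `HasHallDecomposition`, and
`H`, `(ρ, τ)` and the type of `Map(G, ρ, τ)` are as in the given row of the table. -/
def QuotientInRow (p : ℕ) {X : Type u} [Group X] [Finite X] (x y : X) (row : SolvableRow) : Prop :=
  ∃ (h' : IsRotaryPair (x : X ⧸ pCore p X) (y : X ⧸ pCore p X))
    (a b : X ⧸ pCore p X) (H : Subgroup (X ⧸ pCore p X)) (k m : ℕ),
    HasHallDecomposition a b H ∧
    (biRotaryMap (x : X ⧸ pCore p X) (y : X ⧸ pCore p X) h').HasType k m ∧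
    row.Holds p a b H (x : X ⧸ pCore p X) (y : X ⧸ pCore p X) k m

/-!
A bi-rotary map `Map(X, x, y)` has valency `|x|` and face length `2|w|`, where
`w = y (x y x⁻¹)` is `faceRotation x y`; so the numbers of vertices, edges and faces are
`V = |X|/|x|`, `E = |X|/2` and `F = |X|/(2|w|)`.

**The classification.** If `V - E + F = -p^n`, then no prime `r ≠ p` divides all of `V`, `E`, `F`.
Hence a Sylow `r`-subgroup of `G = X / O_p(X)` is accounted for by `⟨ρ⟩` or by the dihedral group
`⟨w, τ⟩`, where `(ρ, τ)` is the image of `(x, y)` and `w` now denotes its face rotation; in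
particular it is cyclic for `r ≠ 2, p`. Also `G` has no nontrivial normal `p`-subgroup. The rest is
about `G` alone (`exists_fitsRow`).

If `p` is odd and some normal `2`-subgroup is not cyclic, it is the Klein four-group `⟨w, τ⟩`, and
`ρ` permutes its involutions: this is the last row. Otherwise all normal subgroups of prime power
order are cyclic, so `G`, being solvable, has a cyclic commutator subgroup
(`isCyclic_commutator_of_normal_isPGroup_isCyclic`). All subgroups of `⟨w⟩` are then normal, and `p`
does not divide `|w|`. The key point is that `|w|` is odd. If it were even, then `p ≠ 2` and a Sylow
`2`-subgroup would either be cyclic while containing a Klein four-group, or lie in the normal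
subgroup `⟨w, τ⟩`, which would then have odd index and contain an odd power of `ρ`. But conjugation
by `ρ` exchanges the two classes of reflections `τ⟨w²⟩` and `τw⟨w²⟩` of this dihedral group
(`not_pow_mem_dihedral`). As `|w|` is odd, `w` has a square root `v` in `⟨w⟩`, and `λ = v ρ`
centralizes `τ`; so `ρ = v⁻¹ λ`, where `τ` inverts `v`, and `|v|`, `|λ|` turn out to be coprime.
Splitting `v⁻¹` into its `3'`-part `a` and `3`-part `c`, and `λ` into its `{2, 3}'`-part `b` and
`{2, 3}`-part `l`, gives a `RotaryFrame`, and the first six rows are the possible actions of `l` and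
`τ` on `⟨c⟩`. The valency is computed by `orderOf_mul_of_conj_mem`, a norm map argument.

**Infinitely many maps.** If `V + F < E` then the space of functions `X → 𝔽_p` whose sums around
vertices and faces vanish is larger than the space of those coming from functions on edges. A
function of the first kind that is not of the second defines a proper unramified covering by a
bi-rotary map, with a `p`-group as covering group, inside `𝔽_p ≀ X` (`exists_unramified_covering`);
it multiplies the Euler characteristic by a power of `p`. So one map of Euler characteristic minus a
power of `p` over a given `G` yields infinitely many (`infinite_rowExponents`). For each row such a
map is found over a group built from dihedral groups, small cyclic groups and the alternating group
of degree `4`. For some rows with `p = 2` it is ramified over `Map(G, ρ, τ)`, and is obtained in a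
subgroup of the product of `G` with a group of order `2` or `8`.
-/

/-! ### Counting orbits -/

section Orbits

/-- If all orbits have the same size `c`, their number times `c` is the size of the set. -/
theorem MulAction.card_orbits_mul_eq {G α : Type*} [Group G] [MulAction G α] [Finite α] {c : ℕ}
    (h : ∀ z : α, Nat.card (MulAction.orbit G z) = c) :
    Nat.card (MulAction.orbitRel.Quotient G α) * c = Nat.card α := by
  classical
  have : Finite (MulAction.orbitRel.Quotient G α) := Quotient.finite _
  have := Fintype.ofFinite (MulAction.orbitRel.Quotient G α)
  rw [Nat.card_congr (MulAction.selfEquivSigmaOrbits G α), Nat.card_sigma,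
    Finset.sum_congr rfl fun _ _ => h _]
  simp

/-- To compute the orbit of `z` under the group generated by a set `S` of permutations of a finite
set, it suffices to exhibit a set containing `z`, stable under `S`, and contained in the orbit. -/
theorem Subgroup.orbit_closure_eq {α : Type*} [Finite α] {S : Set (Equiv.Perm α)} {z : α}
    {T : Set α} (hz : z ∈ T) (hS : ∀ σ ∈ S, ∀ t ∈ T, σ t ∈ T)
    (hT : T ⊆ MulAction.orbit (Subgroup.closure S) z) :
    MulAction.orbit (Subgroup.closure S) z = T := by
  refine Set.Subset.antisymm ?_ hT
  have key : ∀ σ ∈ Subgroup.closure S, ∀ t, σ t ∈ T ↔ t ∈ T := by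
    intro σ hσ
    induction hσ using Subgroup.closure_induction with
    | mem σ h =>
      intro t
      refine ⟨fun ht => ?_, hS σ h t⟩
      have himage : σ '' T = T := Set.eq_of_subset_of_ncard_le
        (Set.image_subset_iff.2 (hS σ h)) (Set.ncard_image_of_injective T σ.injective).ge
      rw [← himage] at ht
      obtain ⟨s, hs, e⟩ := ht
      rwa [← σ.injective e]
    | one => simp
    | mul a b _ _ ha hb => intro t; rw [Equiv.Perm.mul_apply, ha, hb]
    | inv a _ ha => intro t; rw [← ha (a⁻¹ t)]; simp
  rintro _ ⟨⟨σ, hσ⟩, rfl⟩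
  exact (key σ hσ z).2 hz

theorem Subgroup.apply_mem_orbit_closure {α : Type*} {S : Set (Equiv.Perm α)} {z t : α}
    {σ : Equiv.Perm α} (hσ : σ ∈ S) (ht : t ∈ MulAction.orbit (Subgroup.closure S) z) :
    σ t ∈ MulAction.orbit (Subgroup.closure S) z :=
  MulAction.mem_orbit_of_mem_orbit (⟨σ, Subgroup.subset_closure hσ⟩ : Subgroup.closure S) ht

end Orbits

/-! ### Vertices, edges and faces of a bi-rotary map -/

section MapCombinatorics

variable {X : Type u} [Group X]

/-- The product of the involution `y` with its conjugate under `x`; it generates the rotations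
in the stabilizer of the base face. -/
def faceRotation (x y : X) : X := y * (x * y * x⁻¹)

theorem conj_faceRotation {x y : X} (hy : y * y = 1) :
    y * faceRotation x y * y⁻¹ = (faceRotation x y)⁻¹ := by
  have hi : y⁻¹ = y := inv_eq_of_mul_eq_one_left hy
  simp only [faceRotation, mul_inv_rev, hi, inv_inv]
  simp only [← mul_assoc, hy, one_mul]

theorem mul_faceRotation_zpow {x y : X} (hy : y * y = 1) (i : ℤ) :
    y * faceRotation x y ^ i = (faceRotation x y) ^ (-i) * y := by
  rw [zpow_neg, ← inv_zpow, ← conj_faceRotation hy, conj_zpow]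
  group

theorem notMem_zpowers_faceRotation {x y : X} (hy : y * y = 1) (h1 : y ≠ 1) :
    y ∉ Subgroup.zpowers (faceRotation x y) := by
  rintro ⟨i, hi⟩
  have hi : faceRotation x y ^ i = y := hi
  -- a power of the rotation commutes with it, and `y` inverts it
  have h2 : Commute (faceRotation x y ^ i) (faceRotation x y) :=
    (Commute.refl (faceRotation x y)).zpow_left i
  rw [hi] at h2
  replace h2 : y * faceRotation x y = faceRotation x y * y := h2
  have h3 : y * faceRotation x y = (faceRotation x y)⁻¹ * y := by
    simpa using mul_faceRotation_zpow (x := x) hy 1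
  have h4 : faceRotation x y * faceRotation x y = 1 := by
    have := mul_right_cancel (h2.symm.trans h3)
    nth_rewrite 1 [this]; simp
  have h5 : faceRotation x y = 1 ∨ faceRotation x y = y := by
    rcases Int.even_or_odd' i with ⟨j, hj | hj⟩
    · exfalso
      apply h1
      rw [← hi, hj, zpow_mul, zpow_two, h4, one_zpow]
    · right
      rw [hj, zpow_add, zpow_mul, zpow_two, h4, one_zpow, one_mul, zpow_one] at hi
      exact hi
  rcases h5 with h5 | h5
  · apply h1; rw [← hi, h5, one_zpow]
  · have : x * y * x⁻¹ = 1 := by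
      have : y * (x * y * x⁻¹) = y * 1 := by rw [mul_one]; exact h5
      exact mul_left_cancel this
    exact h1 (by simpa using this)

variable [Finite X] {x y : X}

theorem card_vertex_orbit (z : X × Bool) :
    Nat.card (MulAction.orbit (Subgroup.closure {biRotaryR1 x, biRotaryR2}) z) =
      2 * orderOf x := by
  obtain ⟨g, s⟩ := z
  let f : Subgroup.zpowers x × Bool → X × Bool := fun a => (g * a.1, a.2)
  have hf : Function.Injective f := by
    rintro ⟨a, s⟩ ⟨b, t⟩ e
    simp only [f, Prod.mk.injEq, mul_right_inj] at e
    exact Prod.ext (Subtype.ext e.1) e.2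
  set S : Set (Equiv.Perm (X × Bool)) := {biRotaryR1 x, biRotaryR2} with hS
  have h1 : biRotaryR1 x ∈ S := by simp [hS]
  have h2 : (biRotaryR2 : Equiv.Perm (X × Bool)) ∈ S := by simp [hS]
  have e : MulAction.orbit (Subgroup.closure S) (g, s) = Set.range f := by
    apply Subgroup.orbit_closure_eq
    · exact ⟨(1, s), by simp [f]⟩
    · rintro σ (rfl | rfl) _ ⟨⟨⟨a, ha⟩, t⟩, rfl⟩
      · cases t
        · exact ⟨(⟨a * x⁻¹, mul_mem ha (inv_mem (Subgroup.mem_zpowers x))⟩, true), by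
            simp [f, biRotaryR1, mul_assoc]⟩
        · exact ⟨(⟨a * x, mul_mem ha (Subgroup.mem_zpowers x)⟩, false), by
            simp [f, biRotaryR1, mul_assoc]⟩
      · exact ⟨(⟨a, ha⟩, !t), by simp [f, biRotaryR2]⟩
    · have flip : ∀ k t, (k, t) ∈ MulAction.orbit (Subgroup.closure S) (g, s) →
          ∀ t', (k, t') ∈ MulAction.orbit (Subgroup.closure S) (g, s) := by
        intro k t hk t'
        by_cases htt : t' = t
        · rwa [htt]
        · have := Subgroup.apply_mem_orbit_closure h2 hk
          have e : (biRotaryR2 (k, t) : X × Bool) = (k, t') := by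
            cases t <;> cases t' <;> simp_all [biRotaryR2]
          rwa [e] at this
      have step : ∀ n : ℕ, (g * x ^ n, true) ∈ MulAction.orbit (Subgroup.closure S) (g, s) := by
        intro n
        induction n with
        | zero =>
          have := flip g s (MulAction.mem_orbit_self _) true
          simpa using this
        | succ n ih =>
          have := flip _ _ (Subgroup.apply_mem_orbit_closure h1 ih) true
          simpa [biRotaryR1, pow_succ, mul_assoc] using this
      rintro _ ⟨⟨⟨a, ha⟩, t⟩, rfl⟩
      rw [← mem_powers_iff_mem_zpowers] at ha
      obtain ⟨n, rfl⟩ := ha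
      exact flip _ _ (step n) t
  rw [e, Nat.card_range_of_injective hf, Nat.card_prod, Nat.card_zpowers]
  simp [mul_comm]

variable (h : IsRotaryPair x y)

theorem card_edge_orbit (z : X × Bool) :
    Nat.card (MulAction.orbit (Subgroup.closure {biRotaryR0 x y h, biRotaryR2}) z) = 4 := by
  obtain ⟨g, s⟩ := z
  let f : Bool × Bool → X × Bool := fun a => (if a.1 then g * y else g, a.2)
  have hy1 := h.ne_one
  have hf : Function.Injective f := by
    rintro ⟨a, s⟩ ⟨b, t⟩ e
    cases a <;> cases b <;> simp_all [f]
  set S : Set (Equiv.Perm (X × Bool)) := {biRotaryR0 x y h, biRotaryR2} with hS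
  have h1 : biRotaryR0 x y h ∈ S := by simp [hS]
  have h2 : (biRotaryR2 : Equiv.Perm (X × Bool)) ∈ S := by simp [hS]
  have e : MulAction.orbit (Subgroup.closure S) (g, s) = Set.range f := by
    apply Subgroup.orbit_closure_eq
    · exact ⟨(false, s), by simp [f]⟩
    · rintro σ (rfl | rfl) _ ⟨⟨a, t⟩, rfl⟩
      · exact ⟨(!a, t), by cases a <;> simp [f, biRotaryR0, mul_assoc, h.mul_self]⟩
      · exact ⟨(a, !t), by simp [f, biRotaryR2]⟩
    · have flip : ∀ k t, (k, t) ∈ MulAction.orbit (Subgroup.closure S) (g, s) →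
          ∀ t', (k, t') ∈ MulAction.orbit (Subgroup.closure S) (g, s) := by
        intro k t hk t'
        by_cases htt : t' = t
        · rwa [htt]
        · have := Subgroup.apply_mem_orbit_closure h2 hk
          have e : (biRotaryR2 (k, t) : X × Bool) = (k, t') := by
            cases t <;> cases t' <;> simp_all [biRotaryR2]
          rwa [e] at this
      have h0 : (g, s) ∈ MulAction.orbit (Subgroup.closure S) (g, s) := MulAction.mem_orbit_self _
      rintro _ ⟨⟨a, t⟩, rfl⟩
      cases a
      · exact flip _ _ h0 t
      · exact flip _ _ (Subgroup.apply_mem_orbit_closure h1 h0) t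
  rw [e, Nat.card_range_of_injective hf, Nat.card_prod]
  simp

theorem card_face_orbit (z : X × Bool) :
    Nat.card (MulAction.orbit (Subgroup.closure {biRotaryR0 x y h, biRotaryR1 x}) z) =
      2 * (2 * orderOf (faceRotation x y)) := by
  set S : Set (Equiv.Perm (X × Bool)) := {biRotaryR0 x y h, biRotaryR1 x} with hS
  have h0 : biRotaryR0 x y h ∈ S := by simp [hS]
  have h1 : biRotaryR1 x ∈ S := by simp [hS]
  have hyy := h.mul_self
  -- every orbit meets the positive side
  suffices H : ∀ g : X, Nat.card (MulAction.orbit (Subgroup.closure S) (g, true)) =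
      2 * (2 * orderOf (faceRotation x y)) by
    obtain ⟨g, s⟩ := z
    cases s
    · have e : MulAction.orbit (Subgroup.closure S) (g, false) =
          MulAction.orbit (Subgroup.closure S) (g * x⁻¹, true) := by
        refine (MulAction.orbit_eq_iff.2 ?_).symm
        have := Subgroup.apply_mem_orbit_closure h1
          (MulAction.mem_orbit_self (M := Subgroup.closure S) (g, false))
        simpa [biRotaryR1] using this
      rw [e]; exact H _
    · exact H g
  intro g
  set w := faceRotation x y with hw
  have hwy : ∀ i : ℤ, y * w ^ i = w ^ (-i) * y := mul_faceRotation_zpow hyy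
  have hyw : y ∉ Subgroup.zpowers w := notMem_zpowers_faceRotation hyy h.ne_one
  have hxy : x * y = y * w * x := by
    simp only [hw, faceRotation]
    simp only [← mul_assoc, hyy]
    simp
  have hyxy : y * (x * y) = w * x := by rw [hxy, ← mul_assoc, ← mul_assoc, hyy, one_mul]
  have hxy2 : x * y = w⁻¹ * (y * x) := by
    rw [hxy]
    have := hwy 1
    simp only [zpow_one, zpow_neg] at this
    rw [this, mul_assoc]
  let f : Subgroup.zpowers w × Bool × Bool → X × Bool := fun a =>
    (g * a.1 * (if a.2.1 then y else 1) * (if a.2.2 then 1 else x), a.2.2)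
  have hf : Function.Injective f := by
    rintro ⟨⟨a, ha⟩, s, s'⟩ ⟨⟨b, hb⟩, t, t'⟩ e
    simp only [f, Prod.mk.injEq] at e
    obtain ⟨e, rfl⟩ := e
    have e := mul_right_cancel e
    rw [mul_assoc, mul_assoc, mul_right_inj] at e
    cases s <;> cases t
    · simp at e; simp [e]
    · exfalso
      apply hyw
      have : y = b⁻¹ * a := by simp at e; rw [e]; simp
      rw [this]; exact mul_mem (inv_mem hb) ha
    · exfalso
      apply hyw
      have : y = a⁻¹ * b := by simp at e; rw [← e]; simp
      rw [this]; exact mul_mem (inv_mem ha) hb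
    · simp at e; simp [e]
  have e : MulAction.orbit (Subgroup.closure S) (g, true) = Set.range f := by
    apply Subgroup.orbit_closure_eq
    · exact ⟨(1, false, true), by simp [f]⟩
    · rintro σ (rfl | rfl) _ ⟨⟨⟨a, i, rfl⟩, s, t⟩, rfl⟩
      · cases t
        · cases s
          · refine ⟨(⟨w ^ (i - 1), _, rfl⟩, true, false), ?_⟩
            simp only [f, biRotaryR0, Equiv.coe_fn_mk]
            simp [mul_assoc, hxy2, zpow_sub]
          · refine ⟨(⟨w ^ (i + 1), _, rfl⟩, false, false), ?_⟩
            simp only [f, biRotaryR0, Equiv.coe_fn_mk]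
            simp [mul_assoc, hyxy, zpow_add]
        · refine ⟨(⟨w ^ i, _, rfl⟩, !s, true), ?_⟩
          cases s <;> simp [f, biRotaryR0, mul_assoc, hyy]
      · refine ⟨(⟨w ^ i, _, rfl⟩, s, !t), ?_⟩
        cases t <;> simp [f, biRotaryR1]
    · have flip : ∀ k, (k, true) ∈ MulAction.orbit (Subgroup.closure S) (g, true) →
          (k * y, true) ∈ MulAction.orbit (Subgroup.closure S) (g, true) := fun k hk => by
        simpa [biRotaryR0] using Subgroup.apply_mem_orbit_closure h0 hk
      have cross : ∀ k, (k, true) ∈ MulAction.orbit (Subgroup.closure S) (g, true) →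
          (k * x, false) ∈ MulAction.orbit (Subgroup.closure S) (g, true) := fun k hk => by
        simpa [biRotaryR1] using Subgroup.apply_mem_orbit_closure h1 hk
      have step : ∀ n : ℕ,
          (g * w ^ n, true) ∈ MulAction.orbit (Subgroup.closure S) (g, true) := by
        intro n
        induction n with
        | zero => simp
        | succ n ih =>
          have := Subgroup.apply_mem_orbit_closure h1
            (Subgroup.apply_mem_orbit_closure h0 (cross _ (flip _ ih)))
          simpa [biRotaryR1, biRotaryR0, pow_succ, mul_assoc, hw, faceRotation] using this
      rintro _ ⟨⟨⟨a, ha⟩, s, t⟩, rfl⟩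
      rw [← mem_powers_iff_mem_zpowers] at ha
      obtain ⟨n, rfl⟩ := ha
      have hs : (g * w ^ n * (if s then y else 1), true) ∈
          MulAction.orbit (Subgroup.closure S) (g, true) := by
        cases s
        · simpa using step n
        · simpa using flip _ (step n)
      cases t
      · simpa [f] using cross _ hs
      · simpa [f] using hs
  rw [e, Nat.card_range_of_injective hf, Nat.card_prod, Nat.card_prod, Nat.card_zpowers]
  simp; ring

/-- `Map(X, x, y)` has valency `|x|` and face length `2 |y y^x|`. -/
theorem biRotaryMap_hasType :
    (biRotaryMap x y h).HasType (orderOf x) (2 * orderOf (faceRotation x y)) :=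
  fun z => ⟨card_vertex_orbit z, card_face_orbit h z⟩

/-- The numbers of vertices, edges and faces of `Map(X, x, y)`, by orbit counting. -/
theorem exists_eulerChar_eq : ∃ V E F : ℕ,
    V * orderOf x = Nat.card X ∧ E * 2 = Nat.card X ∧
    F * (2 * orderOf (faceRotation x y)) = Nat.card X ∧
    (biRotaryMap x y h).eulerChar = (V : ℤ) - E + F := by
  have hc : Nat.card (X × Bool) = Nat.card X * 2 := by simp [Nat.card_prod]
  refine ⟨Nat.card (biRotaryMap x y h).Vertex, Nat.card (biRotaryMap x y h).Edge,
    Nat.card (biRotaryMap x y h).Face, ?_, ?_, ?_, rfl⟩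
  · have := MulAction.card_orbits_mul_eq (card_vertex_orbit (x := x))
    rw [hc] at this
    have e : Nat.card (biRotaryMap x y h).Vertex * (2 * orderOf x) = Nat.card X * 2 := this
    linarith
  · have := MulAction.card_orbits_mul_eq (card_edge_orbit h)
    rw [hc] at this
    have e : Nat.card (biRotaryMap x y h).Edge * 4 = Nat.card X * 2 := this
    linarith
  · have := MulAction.card_orbits_mul_eq (card_face_orbit h)
    rw [hc] at this
    have e : Nat.card (biRotaryMap x y h).Face * (2 * (2 * orderOf (faceRotation x y))) =
      Nat.card X * 2 := this
    linarith

end MapCombinatorics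

/-! ### Orders of products of subgroups and of elements -/

section GroupLemmas

open Subgroup

variable {G : Type u} [Group G]

theorem Subgroup.card_sup_eq_mul_relIndex {A K : Subgroup G}
    (h : K ≤ normalizer (A : Set G)) :
    Nat.card (A ⊔ K : Subgroup G) = Nat.card A * A.relIndex K := by
  have hle : A ⊔ K ≤ normalizer (A : Set G) := sup_le le_normalizer h
  have : (A.subgroupOf (A ⊔ K)).Normal := (normal_subgroupOf_iff_le_normalizer le_sup_left).2 hle
  have e := relIndex_sup_left (K.subgroupOf (A ⊔ K)) (A.subgroupOf (A ⊔ K))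
  rw [← subgroupOf_sup le_sup_left le_sup_right, relIndex_subgroupOf le_rfl,
    relIndex_subgroupOf le_sup_right] at e
  rw [← e]
  have := relIndex_mul_relIndex ⊥ A (A ⊔ K) bot_le le_sup_left
  rw [relIndex_bot_left, relIndex_bot_left] at this
  exact this.symm

theorem Subgroup.card_sup_dvd_of_le_normalizer {A K : Subgroup G}
    (h : K ≤ normalizer (A : Set G)) : Nat.card (A ⊔ K : Subgroup G) ∣ Nat.card A * Nat.card K := by
  rw [card_sup_eq_mul_relIndex h]
  exact Nat.mul_dvd_mul_left _ (relIndex_dvd_card A K)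

theorem Subgroup.card_sup_of_le_normalizer {A K : Subgroup G}
    (h : K ≤ normalizer (A : Set G)) (hd : Disjoint A K) :
    Nat.card (A ⊔ K : Subgroup G) = Nat.card A * Nat.card K := by
  rw [card_sup_eq_mul_relIndex h, ← inf_relIndex_right, disjoint_iff.1 hd, relIndex_bot_left]

theorem Subgroup.zpowers_le_normalizer_zpowers [Finite G] {g l : G}
    (h : l * g * l⁻¹ ∈ zpowers g) : zpowers l ≤ normalizer (zpowers g : Set G) := by
  rw [zpowers_le]
  refine mem_normalizer_fintype ?_
  rintro _ ⟨i, rfl⟩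
  simp only [← conj_zpow]
  exact zpow_mem h i

/-- If `⟨g⟩` is normal then so is each of its subgroups. -/
theorem Subgroup.conj_mem_zpowers_of_mem {g h x : G} (hh : h ∈ zpowers g)
    (hx : x * g * x⁻¹ ∈ zpowers g) : x * h * x⁻¹ ∈ zpowers h := by
  obtain ⟨i, rfl⟩ := hh
  obtain ⟨j, hj⟩ := hx
  have hj : g ^ j = x * g * x⁻¹ := hj
  refine ⟨j, ?_⟩
  change (g ^ i) ^ j = x * g ^ i * x⁻¹
  rw [← conj_zpow, ← hj, ← zpow_mul, ← zpow_mul, mul_comm]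

theorem Subgroup.normal_of_conj_mem {A : Subgroup G} {S : Set G} (hS : closure S = ⊤) [Finite G]
    (h : ∀ s ∈ S, ∀ t ∈ A, s * t * s⁻¹ ∈ A) : A.Normal := by
  rw [← normalizer_eq_top_iff, eq_top_iff, ← hS, closure_le]
  intro s hs
  exact mem_normalizer_fintype (h s hs)

theorem Subgroup.zpowers_normal_of_conj_mem {g : G} {S : Set G} (hS : closure S = ⊤) [Finite G]
    (h : ∀ s ∈ S, s * g * s⁻¹ ∈ zpowers g) : (zpowers g).Normal := by
  refine normal_of_conj_mem hS ?_
  rintro s hs _ ⟨i, rfl⟩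
  simp only [← conj_zpow]
  exact zpow_mem (h s hs) i

/-- A finite cyclic group has only one subgroup of each order. -/
theorem IsCyclic.mem_zpowers_of_orderOf_eq [Finite G] [IsCyclic G] {u v : G}
    (h : orderOf v = orderOf u) : v ∈ zpowers u := by
  classical
  have := Fintype.ofFinite G
  have h1 := IsCyclic.card_pow_eq_one_le (α := G) (orderOf_pos u)
  have hsub : ((zpowers u : Set G).toFinset) ⊆ ({a : G | a ^ orderOf u = 1} : Finset G) := by
    intro a ha
    simp only [Set.mem_toFinset, SetLike.mem_coe] at ha
    obtain ⟨i, rfl⟩ := ha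
    simp only [Finset.mem_filter, Finset.mem_univ, true_and]
    rw [← zpow_natCast, ← zpow_mul, mul_comm, zpow_mul, zpow_natCast, pow_orderOf_eq_one, one_zpow]
  have hcard : ((zpowers u : Set G).toFinset).card = orderOf u := by
    rw [Set.toFinset_card, ← Nat.card_eq_fintype_card, ← Nat.card_zpowers]; rfl
  have e := Finset.eq_of_subset_of_card_le hsub (by rw [hcard]; exact h1)
  have hv : v ∈ ({a : G | a ^ orderOf u = 1} : Finset G) := by
    simp [← h, pow_orderOf_eq_one]
  rw [← e] at hv
  simpa using hv

theorem mul_pow_eq_pow_sum_mul_pow {g l : G} {c : ℕ} (h : l * g * l⁻¹ = g ^ c) (t : ℕ) :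
    (g * l) ^ t = g ^ (∑ j ∈ Finset.range t, c ^ j) * l ^ t := by
  have hc : ∀ j : ℕ, l ^ j * g = g ^ (c ^ j) * l ^ j := by
    intro j
    induction j with
    | zero => simp
    | succ j ih =>
      have : l * g ^ (c ^ j) = (g ^ (c ^ j)) ^ c * l := by
        rw [← pow_mul, mul_comm (c ^ j) c, pow_mul, ← h, conj_pow]; group
      rw [pow_succ' l, mul_assoc, ih, ← mul_assoc, this, ← pow_mul, ← pow_succ, mul_assoc]
  induction t with
  | zero => simp
  | succ t ih =>
    rw [pow_succ, ih, Finset.sum_range_succ, pow_add, pow_succ, mul_assoc, ← mul_assoc (l ^ t),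
      hc t]
    simp only [mul_assoc]

/-- If `l` normalizes `⟨g⟩` and has order coprime to that of `g`, then `(g * l) ^ |l|` is the image
of `g` under the norm map from `⟨g⟩` onto the centralizer of `l` in `⟨g⟩`. -/
theorem orderOf_mul_of_conj_mem [Finite G] {g l : G} (h : l * g * l⁻¹ ∈ zpowers g)
    (hco : (orderOf g).Coprime (orderOf l)) :
    orderOf (g * l) = orderOf l * centOrder g l := by
  rw [← mem_powers_iff_mem_zpowers] at h
  obtain ⟨c, hc⟩ := h
  have hc : l * g * l⁻¹ = g ^ c := hc.symm
  set n := orderOf l with hn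
  set s := ∑ j ∈ Finset.range n, c ^ j with hs
  have hdis : Disjoint (zpowers g) (zpowers l) := by
    apply Subgroup.disjoint_of_coprime_natCard
    rwa [Nat.card_zpowers, Nat.card_zpowers]
  have hpow : (g * l) ^ n = g ^ s := by
    rw [mul_pow_eq_pow_sum_mul_pow hc, hn, pow_orderOf_eq_one, mul_one]
  have hdvd : n ∣ orderOf (g * l) := by
    have h1 := pow_orderOf_eq_one (g * l)
    rw [mul_pow_eq_pow_sum_mul_pow hc] at h1
    rw [hn, orderOf_dvd_iff_pow_eq_one]
    refine (Subgroup.disjoint_def.1 hdis) ?_ (Subgroup.npow_mem_zpowers l _)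
    rw [eq_inv_of_mul_eq_one_right h1]
    exact inv_mem (Subgroup.npow_mem_zpowers g _)
  have hn0 : n ≠ 0 := (orderOf_pos l).ne'
  have key : (zpowers g ⊓ centralizer (zpowers l : Set G) : Subgroup G) = zpowers (g ^ s) := by
    apply le_antisymm
    · rintro z hz
      obtain ⟨hz1, hz2⟩ := mem_inf.1 hz
      have hzl : l * z = z * l := mem_centralizer_iff.1 hz2 l (mem_zpowers l)
      have hzg := hz1
      rw [← mem_powers_iff_mem_zpowers] at hz1
      obtain ⟨i, hi⟩ := hz1
      have hi : g ^ i = z := hi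
      have hzc : z ^ c = z := by
        rw [← hi, ← pow_mul, mul_comm, pow_mul, ← hc, conj_pow, hi, hzl]; simp
      have hzcj : ∀ j : ℕ, z ^ (c ^ j) = z := by
        intro j
        induction j with
        | zero => simp
        | succ j ih => rw [pow_succ, pow_mul, ih, hzc]
      have hzs : z ^ s = z ^ n := by
        have hsum : ∀ t : ℕ, z ^ (∑ j ∈ Finset.range t, c ^ j) = z ^ t := by
          intro t
          induction t with
          | zero => simp
          | succ t ih => rw [Finset.sum_range_succ, pow_add, ih, hzcj, pow_succ]
        exact hsum n
      have hzn : z ^ n ∈ zpowers (g ^ s) := by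
        rw [← hzs, ← hi, ← pow_mul, mul_comm, pow_mul]
        exact npow_mem_zpowers _ _
      have : z ∈ zpowers (z ^ n) := by
        rw [mem_zpowers_pow_iff]
        exact Nat.Coprime.coprime_dvd_right (orderOf_dvd_of_mem_zpowers hzg) hco.symm
      exact (zpowers_le.2 hzn) this
    · rw [zpowers_le]
      refine mem_inf.2 ⟨npow_mem_zpowers _ _, ?_⟩
      -- the power `(g * l) ^ n` commutes with `g * l` and, lying in `⟨g⟩`, with `g`
      have c1 : Commute (g ^ s) (g * l) := by
        rw [← hpow]; exact (Commute.refl _).pow_left n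
      have c2 : Commute (g ^ s) g := (Commute.refl g).pow_left s
      have c3 : Commute (g ^ s) l := by
        have := c2.inv_right.mul_right c1
        rwa [inv_mul_cancel_left] at this
      rw [mem_centralizer_iff]
      rintro _ ⟨i, rfl⟩
      exact (c3.zpow_right i).eq.symm
  rw [centOrder, key, Nat.card_zpowers, ← hpow, orderOf_pow_of_dvd hn0 hdvd,
    Nat.mul_div_cancel' hdvd]

theorem exists_mul_of_orderOf_eq_mul {g : G} {s t : ℕ} (hg : orderOf g = s * t) (h0 : s * t ≠ 0)
    (hco : s.Coprime t) : ∃ v₁ ∈ zpowers g, ∃ v₂ ∈ zpowers g,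
      v₁ * v₂ = g ∧ orderOf v₁ = s ∧ orderOf v₂ = t := by
  have hb := Nat.gcd_eq_gcd_ab s t
  rw [hco] at hb
  set α := s.gcdA t
  set β := s.gcdB t
  have h1 : (g ^ ((t : ℤ) * β)) * g ^ ((s : ℤ) * α) = g := by
    rw [← zpow_add, add_comm, ← hb]; simp
  have d1 : orderOf (g ^ ((t : ℤ) * β)) ∣ s := by
    rw [orderOf_dvd_iff_pow_eq_one, ← zpow_natCast, ← zpow_mul]
    rw [show (t : ℤ) * β * s = (orderOf g : ℤ) * β by rw [hg]; push_cast; ring, zpow_mul]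
    simp [pow_orderOf_eq_one]
  have d2 : orderOf (g ^ ((s : ℤ) * α)) ∣ t := by
    rw [orderOf_dvd_iff_pow_eq_one, ← zpow_natCast, ← zpow_mul]
    rw [show (s : ℤ) * α * t = (orderOf g : ℤ) * α by rw [hg]; push_cast; ring, zpow_mul]
    simp [pow_orderOf_eq_one]
  have hcm : Commute (g ^ ((t : ℤ) * β)) (g ^ ((s : ℤ) * α)) :=
    ((Commute.refl g).zpow_left _).zpow_right _
  have h2 := hcm.orderOf_mul_dvd_mul_orderOf
  rw [h1, hg] at h2
  refine ⟨_, zpow_mem (mem_zpowers g) _, _, zpow_mem (mem_zpowers g) _, h1, ?_, ?_⟩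
  · obtain ⟨hs, ht⟩ := mul_ne_zero_iff.1 h0
    exact Nat.dvd_antisymm d1 (Nat.dvd_of_mul_dvd_mul_right (Nat.pos_of_ne_zero ht)
      (h2.trans (Nat.mul_dvd_mul_left _ d2)))
  · obtain ⟨hs, ht⟩ := mul_ne_zero_iff.1 h0
    exact Nat.dvd_antisymm d2 (Nat.dvd_of_mul_dvd_mul_left (Nat.pos_of_ne_zero hs)
      (h2.trans (Nat.mul_dvd_mul_right d1 _)))

end GroupLemmas

/-! ### The largest normal `p`-subgroup -/

section PCore

open Subgroup

variable {X : Type u} [Group X]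

theorem le_pCore {p : ℕ} {N : Subgroup X} (hN : N.Normal) (hp : IsPGroup p N) : N ≤ pCore p X :=
  le_sSup ⟨hN, hp⟩

theorem isPGroup_pCore [Finite X] (p : ℕ) : IsPGroup p (pCore p X) := by
  obtain ⟨N, hN⟩ := (Set.toFinite {N : Subgroup X | N.Normal ∧ IsPGroup p N}).exists_maximal
    ⟨⊥, inferInstance, IsPGroup.of_bot⟩
  have := hN.prop.1
  have e : pCore p X = N := by
    refine le_antisymm (sSup_le ?_) (le_pCore hN.prop.1 hN.prop.2)
    rintro M ⟨hM1, hM2⟩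
    have := hN.le_of_ge (y := N ⊔ M)
      ⟨inferInstance, hN.prop.2.to_sup_of_normal_left hM2⟩ le_sup_left
    exact le_sup_right.trans this
  rw [e]; exact hN.prop.2

/-- `O_p(X / O_p(X)) = 1`. -/
theorem eq_bot_of_isPGroup_quotient_pCore [Finite X] {p : ℕ} (N : Subgroup (X ⧸ pCore p X))
    (hN : N.Normal) (hp : IsPGroup p N) : N = ⊥ := by
  have hker : (QuotientGroup.mk' (pCore p X)).ker = pCore p X := QuotientGroup.ker_mk' _
  have h1 : IsPGroup p (N.comap (QuotientGroup.mk' (pCore p X))) :=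
    hp.comap_of_ker_isPGroup _ (by rw [hker]; exact isPGroup_pCore p)
  have h2 := le_pCore (hN.comap _) h1
  rw [eq_bot_iff]
  intro z hz
  obtain ⟨z, rfl⟩ := QuotientGroup.mk'_surjective _ z
  rw [mem_bot]
  exact (QuotientGroup.eq_one_iff z).2 (h2 hz)

end PCore

/-! ### Solvable groups with cyclic normal subgroups of prime power order -/

section CyclicCommutator

open Subgroup commutatorElement

variable {G : Type u} [Group G] [Finite G]

theorem Subgroup.isCyclic_of_isNilpotent_of_normal
    (h : ∀ r : ℕ, r.Prime → ∀ N : Subgroup G, N.Normal → IsPGroup r N → IsCyclic N)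
    (N : Subgroup G) [N.Normal] [Group.IsNilpotent N] : IsCyclic N := by
  have : IsZGroup N := by
    refine ⟨fun r hr P => ?_⟩
    have : Fact r.Prime := ⟨hr⟩
    have hn : (P : Subgroup N).Normal :=
      (((Group.isNilpotent_of_finite_tfae (G := N)).out 0 3 :) :
        Group.IsNilpotent N ↔ ∀ (p : ℕ) (_ : Fact p.Prime) (P : Sylow p N),
          (P : Subgroup N).Normal).1 inferInstance r ⟨hr⟩ P
    have hc : (P : Subgroup N).Characteristic := Sylow.characteristic_of_normal P hn
    have hcyc := h r hr (map N.subtype P) inferInstance (P.2.map N.subtype)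
    exact isCyclic_of_surjective
      ((P : Subgroup N).equivMapOfInjective N.subtype N.subtype_injective).symm
      (MulEquiv.surjective _)
  infer_instance

/-- A group with abelian quotient by a central subgroup is nilpotent. -/
theorem Group.isNilpotent_of_commutator_le_center {H : Type*} [Group H]
    (h : ∀ s t : H, ⁅s, t⁆ ∈ center H) : Group.IsNilpotent H := by
  apply Group.of_quotient_center_nilpotent
  have hc : ∀ a b : H ⧸ center H, a * b = b * a := by
    rintro ⟨a⟩ ⟨b⟩
    change ((a * b : H) : H ⧸ center H) = ((b * a : H) : H ⧸ center H)
    rw [QuotientGroup.eq_iff_div_mem]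
    have := h a b
    rwa [commutatorElement_def, mul_assoc, ← mul_inv_rev, ← div_eq_mul_inv] at this
  let _ : CommGroup (H ⧸ center H) := { (inferInstance : Group (H ⧸ center H)) with mul_comm := hc }
  exact CommGroup.isNilpotent

/-- In a finite solvable group whose normal subgroups of prime power order are cyclic, a maximal
cyclic normal subgroup is self-centralizing, as for the Fitting subgroup. -/
theorem Subgroup.centralizer_le_of_isCyclic_maximal [Group.IsSolvable G]
    (h : ∀ r : ℕ, r.Prime → ∀ N : Subgroup G, N.Normal → IsPGroup r N → IsCyclic N)
    {F : Subgroup G} [hFn : F.Normal] [hFc : IsCyclic F]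
    (hmax : ∀ N : Subgroup G, N.Normal → IsCyclic N → F ≤ N → N ≤ F) :
    centralizer (F : Set G) ≤ F := by
  have hFC : F ≤ centralizer (F : Set G) := by
    have := IsCyclic.isMulCommutative (α := F)
    exact le_centralizer F
  have hcn : (centralizer (F : Set G)).Normal := inferInstance
  have step : ∀ D : Subgroup G, D.Normal → D ≤ centralizer (F : Set G) → ⁅D, D⁆ ≤ F → D ≤ F := by
    intro D hD hDC hDF
    have hN : D ⊔ F ≤ centralizer (F : Set G) := sup_le hDC hFC
    have hcen : ∀ z ∈ F, ∀ s ∈ D ⊔ F, z * s = s * z := fun z hz s hs =>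
      mem_centralizer_iff.1 (hN hs) z hz
    have hcomm : ⁅D ⊔ F, D ⊔ F⁆ ≤ F := by
      rw [commutator_le]
      intro s hs t ht
      obtain ⟨d, hd, z, hz, rfl⟩ := mem_sup_of_normal_right.1 hs
      obtain ⟨d', hd', z', hz', rfl⟩ := mem_sup_of_normal_right.1 ht
      have := hDF (commutator_mem_commutator hd hd')
      have e1 : z * d' = d' * z := hcen z hz d' (le_sup_left (b := F) hd')
      have e2 : z' * d = d * z' := hcen z' hz' d (le_sup_left (b := F) hd)
      have e3 : z * z' = z' * z := hcen z hz z' (le_sup_right (a := D) hz')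
      have e : ⁅d * z, d' * z'⁆ = ⁅d, d'⁆ := by
        rw [commutatorElement_def, commutatorElement_def]
        have : d * z * (d' * z') = d * d' * (z * z') := by
          rw [mul_assoc, ← mul_assoc z, e1]; group
        rw [this]
        have : (d * z)⁻¹ * (d' * z')⁻¹ = (z * z')⁻¹ * (d⁻¹ * d'⁻¹) := by
          rw [← mul_inv_rev, ← mul_inv_rev, ← mul_inv_rev]
          congr 1
          rw [mul_assoc, ← mul_assoc z', e2, e3]; group
        rw [mul_assoc _ (d * z)⁻¹, this]; group
      rw [e]; exact this
    have : Group.IsNilpotent (D ⊔ F : Subgroup G) := by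
      apply Group.isNilpotent_of_commutator_le_center
      intro s t
      rw [mem_center_iff]
      intro v
      have := hcomm (commutator_mem_commutator s.2 t.2)
      exact Subtype.ext (hcen _ this v v.2).symm
    have hcyc := isCyclic_of_isNilpotent_of_normal h (D ⊔ F)
    exact le_sup_left.trans (hmax _ inferInstance hcyc le_sup_right)
  obtain ⟨n, hn⟩ := Group.IsSolvable.solvable (G := G)
  have down : ∀ m ≤ n, derivedSeries G (n - m) ⊓ centralizer (F : Set G) ≤ F := by
    intro m
    induction m with
    | zero => intro _; simp [hn]
    | succ m ih =>
      intro hm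
      refine step _ inferInstance inf_le_right (le_trans ?_ (ih (by omega)))
      refine le_inf ?_ ?_
      · rw [show n - m = n - (m + 1) + 1 by omega, derivedSeries_succ]
        exact commutator_mono inf_le_left inf_le_left
      · exact (commutator_mono inf_le_right inf_le_right).trans (commutator_le_left _ _)
  simpa using down n le_rfl

/-- A maximal cyclic normal subgroup is self-centralizing here, and automorphism groups of cyclic
groups are abelian; so commutators lie in it. -/
theorem isCyclic_commutator_of_normal_isPGroup_isCyclic [Group.IsSolvable G]
    (h : ∀ r : ℕ, r.Prime → ∀ N : Subgroup G, N.Normal → IsPGroup r N → IsCyclic N) :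
    IsCyclic (commutator G) := by
  obtain ⟨F, hF⟩ := (Set.toFinite {N : Subgroup G | N.Normal ∧ IsCyclic N}).exists_maximal
    ⟨⊥, inferInstance, inferInstance⟩
  have hFn := hF.prop.1
  have hFc := hF.prop.2
  have hC := centralizer_le_of_isCyclic_maximal h (F := F)
    fun N h1 h2 h3 => hF.le_of_ge (y := N) ⟨h1, h2⟩ h3
  obtain ⟨f, hf⟩ := (isCyclic_iff_exists_zpowers_eq_top (α := F)).1 hFc
  have hgen : ∀ z ∈ F, ∃ i : ℤ, (f : G) ^ i = z := by
    intro z hz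
    have : (⟨z, hz⟩ : F) ∈ zpowers f := by rw [hf]; trivial
    obtain ⟨i, hi⟩ := this
    exact ⟨i, by simpa using congrArg Subtype.val hi⟩
  have hle : commutator G ≤ F := by
    refine le_trans ?_ hC
    rw [commutator_def, commutator_le]
    intro s _ t _
    obtain ⟨i, hi⟩ := hgen (s⁻¹ * f * s⁻¹⁻¹) (hFn.conj_mem f f.2 s⁻¹)
    obtain ⟨j, hj⟩ := hgen (t⁻¹ * f * t⁻¹⁻¹) (hFn.conj_mem f f.2 t⁻¹)
    have e : s⁻¹ * (t⁻¹ * f * t⁻¹⁻¹) * s⁻¹⁻¹ = t⁻¹ * (s⁻¹ * f * s⁻¹⁻¹) * t⁻¹⁻¹ := by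
      rw [← hi, ← hj, ← conj_zpow, ← conj_zpow, ← hi, ← hj, ← zpow_mul, ← zpow_mul, mul_comm]
    have hcomm : Commute ⁅s, t⁆ (f : G) := by
      rw [Commute, SemiconjBy, commutatorElement_def]
      calc s * t * s⁻¹ * t⁻¹ * f = s * t * (s⁻¹ * (t⁻¹ * f * t⁻¹⁻¹) * s⁻¹⁻¹) * s⁻¹ * t⁻¹ := by group
        _ = f * (s * t * s⁻¹ * t⁻¹) := by rw [e]; group
    rw [mem_centralizer_iff]
    intro z hz
    obtain ⟨i, rfl⟩ := hgen z hz
    exact ((hcomm.zpow_right i).eq).symm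
  exact Subgroup.isCyclic_of_le hle

end CyclicCommutator

/-! ### Cyclic Sylow subgroups -/

section Sylow

open Subgroup

variable {G : Type u} [Group G] [Finite G]

/-- If some element has order divisible by the full `r`-part of `|G|`, then all `r`-subgroups
are cyclic. -/
theorem IsPGroup.isCyclic_of_dvd_orderOf {r : ℕ} (hr : r.Prime) {v : G}
    (hv : r ^ (Nat.card G).factorization r ∣ orderOf v) {N : Subgroup G} (hN : IsPGroup r N) :
    IsCyclic N := by
  have : Fact r.Prime := ⟨hr⟩
  obtain ⟨m, hm⟩ := hv
  have hv0 : orderOf v ≠ 0 := (orderOf_pos v).ne'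
  have hm0 : m ≠ 0 := by rintro rfl; simp at hm; exact hm (isOfFinOrder_of_finite v)
  have ho : orderOf (v ^ m) = r ^ (Nat.card G).factorization r := by
    rw [orderOf_pow_of_dvd hm0 (Dvd.intro_left _ hm.symm), hm, Nat.mul_div_cancel _
      (Nat.pos_of_ne_zero hm0)]
  let Q : Sylow r G := Sylow.ofCard (zpowers (v ^ m)) (by rw [Nat.card_zpowers, ho])
  obtain ⟨P, hP⟩ := hN.exists_le_sylow
  have hQ : IsCyclic Q := inferInstanceAs (IsCyclic (zpowers (v ^ m)))
  have hPc : IsCyclic P := isCyclic_of_surjective (Sylow.equiv Q P) (MulEquiv.surjective _)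
  have : IsCyclic (P : Subgroup G) := hPc
  exact Subgroup.isCyclic_of_le hP

end Sylow

/-! ### Centralizers in cyclic groups, and Hall decompositions -/

section Rows

open Subgroup

variable {G : Type u} [Group G]

theorem mem_inf_centralizer_zpowers {a κ z : G} :
    z ∈ (zpowers a ⊓ centralizer (zpowers κ : Set G) : Subgroup G) ↔
      z ∈ zpowers a ∧ Commute z κ := by
  rw [mem_inf, mem_centralizer_iff]
  refine and_congr_right fun _ => ⟨fun h => (h κ (mem_zpowers κ)).symm, ?_⟩
  rintro h _ ⟨i, rfl⟩
  exact (h.zpow_right i).symm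

theorem centOrder_congr {a κ κ' : G} (h : ∀ z ∈ zpowers a, Commute z κ ↔ Commute z κ') :
    centOrder a κ = centOrder a κ' := by
  rw [centOrder, centOrder]
  congr 2
  ext z
  rw [mem_inf_centralizer_zpowers, mem_inf_centralizer_zpowers]
  exact and_congr_right (h z)

theorem centOrder_of_commute {a κ : G} (h : Commute a κ) : centOrder a κ = orderOf a := by
  rw [centOrder, ← Nat.card_zpowers]
  congr 2
  ext z
  rw [mem_inf_centralizer_zpowers, and_iff_left_iff_imp]
  rintro ⟨i, rfl⟩
  exact h.zpow_left i

theorem centOrder_of_conj_eq_inv [Finite G] {a κ : G} (h : κ * a * κ⁻¹ = a⁻¹)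
    (ho : Odd (orderOf a)) : centOrder a κ = 1 := by
  rw [centOrder, Subgroup.card_eq_one, eq_bot_iff]
  intro z hz
  obtain ⟨hz, hc⟩ := mem_inf_centralizer_zpowers.1 hz
  have hodd : Odd (orderOf z) := ho.of_dvd_nat (orderOf_dvd_of_mem_zpowers hz)
  obtain ⟨i, rfl⟩ := hz
  have h1 : (a ^ i)⁻¹ = a ^ i := by
    rw [← inv_zpow, ← h, conj_zpow]
    have := hc.eq
    simp only at this
    rw [← this, mul_inv_cancel_right]
  have h2 : (a ^ i) ^ 2 = 1 := by
    rw [pow_two]; nth_rewrite 1 [← h1]; simp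
  have h3 := orderOf_dvd_of_pow_eq_one h2
  rw [mem_bot, ← orderOf_eq_one_iff]
  exact (Nat.Coprime.eq_one_of_dvd (Nat.coprime_two_right.2 hodd) h3)

theorem Commute.mem_zpowers_mul_left [Finite G] {a c : G} (h : Commute a c)
    (hco : (orderOf a).Coprime (orderOf c)) : a ∈ zpowers (a * c) := by
  have h1 : (a * c) ^ orderOf c = a ^ orderOf c := by
    rw [h.mul_pow, pow_orderOf_eq_one, mul_one]
  have h2 : a ∈ zpowers (a ^ orderOf c) := by
    rw [mem_zpowers_pow_iff]; exact hco.symm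
  rw [← h1] at h2
  exact (zpowers_le.2 (npow_mem_zpowers _ _)) h2

theorem centOrder_mul [Finite G] {a c κ : G} (h : Commute a c)
    (hco : (orderOf a).Coprime (orderOf c)) :
    centOrder (a * c) κ = centOrder a κ * centOrder c κ := by
  have ha : a ∈ zpowers (a * c) := h.mem_zpowers_mul_left hco
  have hc : c ∈ zpowers (a * c) := by
    rw [h.eq]; exact h.symm.mem_zpowers_mul_left hco.symm
  have hdis : Disjoint (zpowers a) (zpowers c) := by
    apply Subgroup.disjoint_of_coprime_natCard
    rwa [Nat.card_zpowers, Nat.card_zpowers]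
  rw [centOrder, centOrder, centOrder, ← card_sup_of_le_normalizer]
  · congr 2
    apply le_antisymm
    · intro z hz
      obtain ⟨⟨i, rfl⟩, hz⟩ := mem_inf_centralizer_zpowers.1 hz
      simp only at hz ⊢
      rw [h.mul_zpow] at hz ⊢
      have hi : Commute (a ^ i) (c ^ i) := (h.zpow_left i).zpow_right i
      have hcoi : (orderOf (a ^ i)).Coprime (orderOf (c ^ i)) :=
        Nat.Coprime.coprime_dvd_left (orderOf_dvd_of_mem_zpowers (zpow_mem (mem_zpowers a) i))
          (Nat.Coprime.coprime_dvd_right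
            (orderOf_dvd_of_mem_zpowers (zpow_mem (mem_zpowers c) i)) hco)
      have key : ∀ v ∈ zpowers (a ^ i * c ^ i), Commute v κ := by
        rintro _ ⟨j, rfl⟩
        exact hz.zpow_left j
      refine mul_mem (mem_sup_left (mem_inf_centralizer_zpowers.2
        ⟨zpow_mem (mem_zpowers a) i, key _ (hi.mem_zpowers_mul_left hcoi)⟩))
        (mem_sup_right (mem_inf_centralizer_zpowers.2
        ⟨zpow_mem (mem_zpowers c) i, key _ ?_⟩))
      rw [hi.eq]
      exact hi.symm.mem_zpowers_mul_left hcoi.symm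
    · refine sup_le (inf_le_inf_right _ (zpowers_le.2 ha)) (inf_le_inf_right _ (zpowers_le.2 hc))
  · intro v hv
    obtain ⟨⟨i, rfl⟩, -⟩ := mem_inf_centralizer_zpowers.1 hv
    refine mem_normalizer_fintype ?_
    intro z hz
    have hz' := hz
    obtain ⟨⟨j, rfl⟩, -⟩ := mem_inf_centralizer_zpowers.1 hz
    have : Commute (c ^ i) (a ^ j) := (h.symm.zpow_left i).zpow_right j
    simp only
    rw [this.eq, mul_inv_cancel_right]
    exact hz'
  · exact hdis.mono inf_le_left inf_le_left

theorem Subgroup.disjoint_zpowers_of_orderOf_prime {K : Subgroup G} {t : G}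
    (ht : (orderOf t).Prime) (h : t ∉ K) : Disjoint K (zpowers t) := by
  rw [Subgroup.disjoint_def]
  rintro _ hx ⟨i, rfl⟩
  by_contra hne
  apply h
  have hco : IsCoprime (orderOf t : ℤ) i := by
    rw [(Nat.prime_iff_prime_int.1 ht).irreducible.coprime_iff_not_dvd]
    intro hd
    exact hne (orderOf_dvd_iff_zpow_eq_one.1 hd)
  obtain ⟨α, β, hb⟩ := hco
  have : t = (t ^ i) ^ β := by
    have h1 : t ^ (α * orderOf t + β * i) = t := by rw [hb, zpow_one]
    rw [zpow_add, mul_comm α, zpow_mul, zpow_natCast, pow_orderOf_eq_one, one_zpow, one_mul,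
      mul_comm, zpow_mul] at h1
    exact h1.symm
  rw [this]
  exact zpow_mem hx β

theorem hasHallDecomposition_of_coprime [Finite G] {a b : G} {H : Subgroup G}
    (ha : (zpowers a).Normal) (hb : ∀ t ∈ H, Commute b t)
    (hab : (orderOf a).Coprime (orderOf b)) (ha6 : (orderOf a).Coprime 6)
    (hb6 : (orderOf b).Coprime 6)
    (hH : ∀ q : ℕ, q.Prime → q ∣ Nat.card H → q = 2 ∨ q = 3)
    (htop : zpowers a ⊔ (zpowers b ⊔ H) = ⊤) : HasHallDecomposition a b H := by
  have hco : ∀ n : ℕ, n.Coprime 6 → n.Coprime (Nat.card H) := by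
    intro n hn
    refine Nat.Coprime.symm (Nat.coprime_of_dvd fun q hq h1 h2 => ?_)
    have h6 : q ∣ 6 := by rcases hH q hq h1 with rfl | rfl <;> decide
    exact hq.one_lt.ne' (Nat.eq_one_of_dvd_coprimes hn h2 h6)
  have hbH : H ≤ normalizer (zpowers b : Set G) := by
    intro t ht
    refine mem_normalizer_fintype ?_
    rintro _ ⟨i, rfl⟩
    have : Commute t (b ^ i) := (hb t ht).symm.zpow_right i
    simp only
    rw [this.eq, mul_inv_cancel_right]
    exact zpow_mem (mem_zpowers b) i
  have hd1 : Disjoint (zpowers b) H := by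
    apply Subgroup.disjoint_of_coprime_natCard
    rw [Nat.card_zpowers]
    exact hco _ hb6
  have hc1 := card_sup_of_le_normalizer hbH hd1
  rw [Nat.card_zpowers] at hc1
  have hd2 : Disjoint (zpowers a) (zpowers b ⊔ H) := by
    apply Subgroup.disjoint_of_coprime_natCard
    rw [Nat.card_zpowers, hc1]
    exact Nat.Coprime.mul_right hab (hco _ ha6)
  have hc2 := card_sup_of_le_normalizer (by rw [normalizer_eq_top]; exact le_top) hd2
  rw [htop, Nat.card_zpowers, hc1, card_top] at hc2
  have hidx : H.index = orderOf a * orderOf b := by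
    have h1 := H.card_mul_index
    rw [hc2] at h1
    have h0 : 0 < Nat.card H := Nat.card_pos
    exact Nat.eq_of_mul_eq_mul_left h0 (by rw [h1]; ring)
  refine ⟨⟨hH, fun q hq hdvd => ?_⟩, ⟨rfl, hd1, ?_⟩,
    ⟨htop, hd2, fun k _ n hn => ha.conj_mem n hn k⟩, hab, hco _ ha6, hco _ hb6⟩
  · have h6 : (orderOf a * orderOf b).Coprime 6 := Nat.Coprime.mul_left ha6 hb6
    rw [hidx] at hdvd
    have hq6 : ¬ q ∣ 6 := fun h => hq.one_lt.ne' (Nat.eq_one_of_dvd_coprimes h6 hdvd h)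
    constructor <;> (rintro rfl; exact hq6 (by decide))
  · rintro _ ⟨i, rfl⟩ t ht
    exact ((hb t ht).zpow_left i).eq

end Rows

/-! ### The first six rows -/

section Frames

open Subgroup

variable {G : Type u} [Group G]

/-- The common shape of the first six rows of the table: the rotary pair is `(a * c * b * l, t)`,
where `t` inverts the cyclic normal subgroup `⟨a⟩ × ⟨c⟩` (`a` is its `3'`-part, `c` its `3`-part)
and `b`, `l`, `t` generate an abelian complement (`b` is of order prime to `6`, `l` is a
`{2, 3}`-element). -/
structure RotaryFrame (a c b l t : G) : Prop where
  closure_eq : closure {a * c * b * l, t} = ⊤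
  orderOf_t : orderOf t = 2
  t_conj_a : t * a * t⁻¹ = a⁻¹
  t_conj_c : t * c * t⁻¹ = c⁻¹
  comm_ac : Commute a c
  comm_bl : Commute b l
  comm_bt : Commute b t
  comm_lt : Commute l t
  comm_bc : Commute b c
  b_conj_a : b * a * b⁻¹ ∈ zpowers a
  l_conj_a : l * a * l⁻¹ ∈ zpowers a
  l_conj_c : l * c * l⁻¹ ∈ zpowers c
  orderOf_c : ∃ e, orderOf c = 3 ^ e
  coprime_a_six : (orderOf a).Coprime 6
  coprime_b_six : (orderOf b).Coprime 6
  coprime_ab : (orderOf a).Coprime (orderOf b)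
  prime_dvd_l : ∀ q : ℕ, q.Prime → q ∣ orderOf l → q = 2 ∨ q = 3
  coprime_cl : (orderOf c).Coprime (orderOf l)

/-- The pair `(ρ, τ)` fits the given row of the table, with the valency and the face length
of the map it defines. -/
def FitsRow (p : ℕ) (ρ τ : G) (row : SolvableRow) : Prop :=
  ∃ (a b : G) (H : Subgroup G), HasHallDecomposition a b H ∧
    row.Holds p a b H ρ τ (orderOf ρ) (2 * orderOf (faceRotation ρ τ))

theorem Subgroup.conj_mem_zpowers_mul {g x y : G} (hx : x * g * x⁻¹ ∈ zpowers g)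
    (hy : y * g * y⁻¹ ∈ zpowers g) : (x * y) * g * (x * y)⁻¹ ∈ zpowers g := by
  obtain ⟨i, hi⟩ := hy
  have e : (x * y) * g * (x * y)⁻¹ = (x * g * x⁻¹) ^ i := by
    rw [conj_zpow, show g ^ i = y * g * y⁻¹ from hi]; group
  rw [e]
  exact zpow_mem hx i

theorem Subgroup.conj_mem_zpowers_of_commute {g x : G} (hx : Commute x g) :
    x * g * x⁻¹ ∈ zpowers g := by
  rw [hx.eq, mul_inv_cancel_right]; exact mem_zpowers g

theorem Nat.Coprime.of_forall_two_or_three {n m : ℕ} (hn : n.Coprime 6)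
    (hm : ∀ q : ℕ, q.Prime → q ∣ m → q = 2 ∨ q = 3) : n.Coprime m := by
  refine Nat.Coprime.symm (Nat.coprime_of_dvd fun q hq h1 h2 => ?_)
  have h6 : q ∣ 6 := by rcases hm q hq h1 with rfl | rfl <;> decide
  exact hq.one_lt.ne' (Nat.eq_one_of_dvd_coprimes hn h2 h6)

namespace RotaryFrame

variable {a c b l t : G}

theorem odd_a (h : RotaryFrame a c b l t) : Odd (orderOf a) :=
  Nat.coprime_two_right.1 (Nat.Coprime.coprime_dvd_right (by decide) h.coprime_a_six)

theorem odd_c (h : RotaryFrame a c b l t) : Odd (orderOf c) := by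
  obtain ⟨e, he⟩ := h.orderOf_c
  rw [he]; exact Odd.pow (by decide)

theorem coprime_ac (h : RotaryFrame a c b l t) : (orderOf a).Coprime (orderOf c) := by
  obtain ⟨e, he⟩ := h.orderOf_c
  rw [he]
  exact Nat.Coprime.pow_right _ (Nat.Coprime.coprime_dvd_right (by decide) h.coprime_a_six)

theorem coprime_bc (h : RotaryFrame a c b l t) : (orderOf b).Coprime (orderOf c) := by
  obtain ⟨e, he⟩ := h.orderOf_c
  rw [he]
  exact Nat.Coprime.pow_right _ (Nat.Coprime.coprime_dvd_right (by decide) h.coprime_b_six)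

theorem orderOf_ac (h : RotaryFrame a c b l t) : orderOf (a * c) = orderOf a * orderOf c :=
  h.comm_ac.orderOf_mul_eq_mul_orderOf_of_coprime h.coprime_ac

theorem orderOf_bl (h : RotaryFrame a c b l t) : orderOf (b * l) = orderOf b * orderOf l :=
  h.comm_bl.orderOf_mul_eq_mul_orderOf_of_coprime
    (h.coprime_b_six.of_forall_two_or_three h.prime_dvd_l)

theorem t_mul_self (h : RotaryFrame a c b l t) : t * t = 1 := by
  rw [← pow_two, ← h.orderOf_t, pow_orderOf_eq_one]

theorem t_inv (h : RotaryFrame a c b l t) : t⁻¹ = t := inv_eq_of_mul_eq_one_left h.t_mul_self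

theorem orderOf_faceRotation (h : RotaryFrame a c b l t) :
    orderOf (faceRotation (a * c * b * l) t) = orderOf a * orderOf c := by
  have h1 : t * (a * c) * t⁻¹ = (a * c)⁻¹ := by
    rw [← conj_mul, h.t_conj_a, h.t_conj_c, h.comm_ac.eq, mul_inv_rev]
  have hbl : Commute (b * l) t := h.comm_bt.mul_left h.comm_lt
  have h2 : (a * c * b * l) * t * (a * c * b * l)⁻¹ = (a * c) * t * (a * c)⁻¹ := by
    rw [mul_assoc (a * c) b l, mul_assoc (a * c), hbl.eq]; group
  have h3 : faceRotation (a * c * b * l) t = ((a * c) ^ 2)⁻¹ := by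
    rw [faceRotation, h2]
    calc t * (a * c * t * (a * c)⁻¹) = (t * (a * c) * t⁻¹) * (t * t) * (a * c)⁻¹ := by group
      _ = ((a * c) ^ 2)⁻¹ := by rw [h1, h.t_mul_self, mul_one, pow_two, mul_inv_rev (a * c)]
  rw [h3, orderOf_inv, Nat.Coprime.orderOf_pow, h.orderOf_ac]
  rw [h.orderOf_ac]
  exact (Nat.coprime_two_right.2 (h.odd_a.mul h.odd_c))

theorem b_conj_c (h : RotaryFrame a c b l t) : b * c * b⁻¹ ∈ zpowers c :=
  conj_mem_zpowers_of_commute h.comm_bc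

theorem orderOf_mul [Finite G] (h : RotaryFrame a c b l t) : orderOf (a * c * b * l) =
    orderOf b * orderOf l * (centOrder a (b * l) * centOrder c (b * l)) := by
  have hbl := h.orderOf_bl
  have hga : a ∈ zpowers (a * c) := h.comm_ac.mem_zpowers_mul_left h.coprime_ac
  have hgc : c ∈ zpowers (a * c) := by
    rw [h.comm_ac.eq]; exact h.comm_ac.symm.mem_zpowers_mul_left h.coprime_ac.symm
  have hconj : (b * l) * (a * c) * (b * l)⁻¹ ∈ zpowers (a * c) := by
    rw [← conj_mul]
    refine mul_mem (zpowers_le.2 hga ?_) (zpowers_le.2 hgc ?_)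
    · exact Subgroup.conj_mem_zpowers_mul h.b_conj_a h.l_conj_a
    · exact Subgroup.conj_mem_zpowers_mul h.b_conj_c h.l_conj_c
  rw [mul_assoc, orderOf_mul_of_conj_mem hconj, hbl, centOrder_mul h.comm_ac h.coprime_ac]
  rw [h.orderOf_ac, hbl]
  refine Nat.Coprime.mul_left (Nat.Coprime.mul_right h.coprime_ab ?_)
    (Nat.Coprime.mul_right h.coprime_bc.symm h.coprime_cl)
  exact h.coprime_a_six.of_forall_two_or_three h.prime_dvd_l

theorem normal_zpowers_a [Finite G] (h : RotaryFrame a c b l t) : (zpowers a).Normal := by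
  refine zpowers_normal_of_conj_mem h.closure_eq ?_
  rintro s (rfl | rfl)
  · exact conj_mem_zpowers_mul (conj_mem_zpowers_mul (conj_mem_zpowers_mul
      (conj_mem_zpowers_of_commute (Commute.refl a))
      (conj_mem_zpowers_of_commute h.comm_ac.symm)) h.b_conj_a) h.l_conj_a
  · rw [h.t_conj_a]; exact inv_mem (mem_zpowers a)

theorem normal_zpowers_c [Finite G] (h : RotaryFrame a c b l t) : (zpowers c).Normal := by
  refine zpowers_normal_of_conj_mem h.closure_eq ?_
  rintro s (rfl | rfl)
  · exact conj_mem_zpowers_mul (conj_mem_zpowers_mul (conj_mem_zpowers_mul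
      (conj_mem_zpowers_of_commute h.comm_ac)
      (conj_mem_zpowers_of_commute (Commute.refl c))) h.b_conj_c) h.l_conj_c
  · rw [h.t_conj_c]; exact inv_mem (mem_zpowers c)

theorem card_abelian_dvd (h : RotaryFrame a c b l t) :
    Nat.card (zpowers l ⊔ zpowers t : Subgroup G) ∣ orderOf l * 2 := by
  have hn : zpowers t ≤ normalizer (zpowers l : Set G) := by
    rw [zpowers_le, mem_normalizer_iff]
    intro z
    constructor
    · rintro ⟨i, rfl⟩
      rw [← (h.comm_lt.zpow_left i).eq, mul_inv_cancel_right]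
      exact zpow_mem (mem_zpowers l) i
    · rintro ⟨i, hi⟩
      have hi : l ^ i = t * z * t⁻¹ := hi
      have e : z = t⁻¹ * l ^ i * t := by rw [hi]; group
      rw [e, mul_assoc, (h.comm_lt.zpow_left i).eq, inv_mul_cancel_left]
      exact zpow_mem (mem_zpowers l) i
  have := card_sup_dvd_of_le_normalizer hn
  rwa [Nat.card_zpowers, Nat.card_zpowers, h.orderOf_t] at this

/-- The Hall `{2, 3}`-subgroup is generated by `c`, `l` and `t`. -/
theorem hasHallDecomposition [Finite G] (h : RotaryFrame a c b l t) :
    HasHallDecomposition a b (zpowers c ⊔ (zpowers l ⊔ zpowers t)) := by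
  have hcH : c ∈ zpowers c ⊔ (zpowers l ⊔ zpowers t) := mem_sup_left (mem_zpowers c)
  have hlH : l ∈ zpowers c ⊔ (zpowers l ⊔ zpowers t) :=
    mem_sup_right (mem_sup_left (mem_zpowers l))
  have htH : t ∈ zpowers c ⊔ (zpowers l ⊔ zpowers t) :=
    mem_sup_right (mem_sup_right (mem_zpowers t))
  refine hasHallDecomposition_of_coprime h.normal_zpowers_a ?_ h.coprime_ab h.coprime_a_six
    h.coprime_b_six ?_ ?_
  · have hle : zpowers c ⊔ (zpowers l ⊔ zpowers t) ≤ centralizer {b} := by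
      refine sup_le ?_ (sup_le ?_ ?_) <;> rw [zpowers_le, mem_centralizer_iff]
      · rintro _ rfl; exact h.comm_bc
      · rintro _ rfl; exact h.comm_bl
      · rintro _ rfl; exact h.comm_bt
    exact fun s hs => mem_centralizer_iff.1 (hle hs) b rfl
  · intro q hq hdvd
    have hn : zpowers l ⊔ zpowers t ≤ normalizer (zpowers c : Set G) := by
      have := h.normal_zpowers_c
      rw [normalizer_eq_top]; exact le_top
    have h1 := hdvd.trans (card_sup_dvd_of_le_normalizer hn)
    rcases hq.dvd_mul.1 h1 with h2 | h2
    · obtain ⟨e, he⟩ := h.orderOf_c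
      rw [Nat.card_zpowers, he] at h2
      right
      exact (Nat.prime_dvd_prime_iff_eq hq Nat.prime_three).1 (hq.dvd_of_dvd_pow h2)
    · rcases hq.dvd_mul.1 (h2.trans h.card_abelian_dvd) with h3 | h3
      · exact h.prime_dvd_l q hq h3
      · left; exact (Nat.prime_dvd_prime_iff_eq hq Nat.prime_two).1 h3
  · rw [eq_top_iff, ← h.closure_eq, closure_le]
    rintro s (rfl | rfl)
    · exact mul_mem (mul_mem (mul_mem (mem_sup_left (mem_zpowers a))
        (mem_sup_right (mem_sup_right hcH)))
        (mem_sup_right (mem_sup_left (mem_zpowers b)))) (mem_sup_right (mem_sup_right hlH))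
    · exact mem_sup_right (mem_sup_right htH)

theorem centOrder_c_mul (h : RotaryFrame a c b l t) :
    centOrder a (b * c * l) = centOrder a (b * l) := by
  refine centOrder_congr ?_
  rintro _ ⟨i, rfl⟩
  have hc : Commute (a ^ i) c := h.comm_ac.zpow_left i
  have e : b * c * l = c * (b * l) := by rw [h.comm_bc.eq, mul_assoc]
  simp only [e]
  refine ⟨fun h' => ?_, fun h' => hc.mul_right h'⟩
  have := hc.inv_right.mul_right h'
  rwa [inv_mul_cancel_left] at this

theorem mul_eq (h : RotaryFrame a c b l t) : a * c * b * l = a * b * c * l := by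
  rw [mul_assoc a, ← h.comm_bc.eq, ← mul_assoc]

theorem fitsRow_cyclic [Finite G] (h : RotaryFrame a 1 b l t) (p : ℕ) (hl : t ∈ zpowers l) :
    FitsRow p (a * 1 * b * l) t .cyclic := by
  refine ⟨a, b, _, h.hasHallDecomposition, l, ?_, ?_, ?_, ?_, ?_, ?_⟩
  · simp only [zpowers_one_eq_bot, bot_sup_eq]
    exact (sup_eq_left.2 (zpowers_le.2 hl)).symm
  · rw [even_iff_two_dvd, ← h.orderOf_t]; exact orderOf_dvd_of_mem_zpowers hl
  · rw [mul_one]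
  · classical
    rw [← mem_powers_iff_mem_zpowers, mem_powers_iff_mem_range_orderOf] at hl
    obtain ⟨i, hi, rfl⟩ := Finset.mem_image.1 hl
    rw [Finset.mem_range] at hi
    have h1 : orderOf l ∣ i + i := by
      rw [orderOf_dvd_iff_pow_eq_one, pow_add]; exact h.t_mul_self
    have h0 : i ≠ 0 := by
      rintro rfl
      have := h.orderOf_t
      simp at this
    congr 1
    obtain ⟨m, hm⟩ := h1
    have : m = 1 := by
      rcases m with _ | _ | m
      · omega
      · rfl
      · nlinarith
    subst this
    omega
  · have := centOrder_of_commute (Commute.one_left (b * l))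
    rw [h.orderOf_mul, this, orderOf_one, mul_one, mul_comm (orderOf b)]
  · rw [h.orderOf_faceRotation, orderOf_one, mul_one]

theorem fitsRow_cyclicTimesTwo [Finite G] (h : RotaryFrame a 1 b l t) (hl : t ∉ zpowers l) :
    FitsRow 2 (a * 1 * b * l) t .cyclicTimesTwo := by
  refine ⟨a, b, _, h.hasHallDecomposition, l, t, ⟨?_, ?_, ?_⟩, h.orderOf_t, ?_, rfl, ?_, ?_, rfl⟩
  · simp only [zpowers_one_eq_bot, bot_sup_eq]
  · exact disjoint_zpowers_of_orderOf_prime (by rw [h.orderOf_t]; exact Nat.prime_two) hl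
  · rintro _ ⟨i, rfl⟩ _ ⟨j, rfl⟩
    exact ((h.comm_lt.zpow_left i).zpow_right j).eq
  · rw [mul_one]
  · have := centOrder_of_commute (Commute.one_left (b * l))
    rw [h.orderOf_mul, this, orderOf_one, mul_one, mul_comm (orderOf b)]
  · rw [h.orderOf_faceRotation, orderOf_one, mul_one]

theorem isDihedralThree [Finite G] (h : RotaryFrame a c b l t) {e : ℕ} (he : orderOf c = 3 ^ e) :
    IsDihedralThree e c t (zpowers c ⊔ zpowers t) := by
  refine ⟨⟨rfl, ?_, fun k _ n hn => h.normal_zpowers_c.conj_mem n hn k⟩, he, h.orderOf_t,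
    h.t_conj_c⟩
  apply Subgroup.disjoint_of_coprime_natCard
  rw [Nat.card_zpowers, Nat.card_zpowers, h.orderOf_t]
  exact Nat.coprime_two_right.2 h.odd_c

theorem fitsRow_dihedralRotation [Finite G] (h : RotaryFrame a c b 1 t) (hc : c ≠ 1) :
    FitsRow 2 (a * c * b * 1) t .dihedralRotation := by
  obtain ⟨e, he⟩ := h.orderOf_c
  have he0 : 0 < e := by
    rw [Nat.pos_iff_ne_zero]; rintro rfl; exact hc (orderOf_eq_one_iff.1 (by simpa using he))
  refine ⟨a, b, _, h.hasHallDecomposition, e, c, t, he0, ?_, ?_, rfl, ?_, ?_, rfl⟩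
  · simp only [zpowers_one_eq_bot, bot_sup_eq]
    exact h.isDihedralThree he
  · rw [h.mul_eq, mul_one]
  · have h1 := h.centOrder_c_mul
    have h2 : centOrder c (b * 1) = orderOf c :=
      centOrder_of_commute (by simpa using h.comm_bc.symm)
    simp only [mul_one] at h1 h2
    rw [h.orderOf_mul, orderOf_one, mul_one, mul_one, h2, h1, he]; ring
  · rw [h.orderOf_faceRotation, he]; ring

theorem fitsRow_dihedralReflection [Finite G] (h : RotaryFrame a c b t t) (hc : c ≠ 1) {p : ℕ}
    (hp : p ≠ 3) : FitsRow p (a * c * b * t) t .dihedralReflection := by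
  obtain ⟨e, he⟩ := h.orderOf_c
  have he0 : 0 < e := by
    rw [Nat.pos_iff_ne_zero]; rintro rfl; exact hc (orderOf_eq_one_iff.1 (by simpa using he))
  refine ⟨a, b, _, h.hasHallDecomposition, e, c, t, he0, ?_, h.mul_eq, rfl, ?_, ?_, hp⟩
  · rw [sup_idem]
    exact h.isDihedralThree he
  · -- `t` is a power of `b * t`, so `b * t` has no fixed points in `⟨a⟩` and `⟨c⟩`
    have key : ∀ {s : G}, t * s * t⁻¹ = s⁻¹ → Odd (orderOf s) → centOrder s (b * t) = 1 := by
      intro s hs ho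
      have ht : t ∈ zpowers (b * t) := by
        rw [h.comm_bt.eq]
        exact h.comm_bt.symm.mem_zpowers_mul_left
          (h.coprime_b_six.of_forall_two_or_three h.prime_dvd_l).symm
      have h1 := centOrder_of_conj_eq_inv hs ho
      rw [centOrder, Subgroup.card_eq_one] at h1 ⊢
      rw [eq_bot_iff, ← h1]
      exact inf_le_inf_left _ (centralizer_le (zpowers_le.2 ht))
    rw [h.orderOf_mul, key h.t_conj_a h.odd_a, key h.t_conj_c h.odd_c, h.orderOf_t]; ring
  · rw [h.orderOf_faceRotation, he]; ring

theorem isInternalDirect_dihedral [Finite G] (h : RotaryFrame a c b l t) {d : G}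
    (hdc : Commute d c) (hdt : Commute d t) (hd : d ∈ zpowers l ⊔ zpowers t)
    (ht : t ∉ zpowers d) :
    IsInternalDirect (zpowers d) (zpowers c ⊔ zpowers t)
      (zpowers d ⊔ (zpowers c ⊔ zpowers t)) := by
  refine ⟨rfl, ?_, ?_⟩
  · have h1 : Disjoint (zpowers c) (zpowers l ⊔ zpowers t) := by
      apply Subgroup.disjoint_of_coprime_natCard
      rw [Nat.card_zpowers]
      exact Nat.Coprime.coprime_dvd_right h.card_abelian_dvd
        (Nat.Coprime.mul_right h.coprime_cl (Nat.coprime_two_right.2 h.odd_c))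
    have h2 : Disjoint (zpowers d) (zpowers t) :=
      disjoint_zpowers_of_orderOf_prime (by rw [h.orderOf_t]; exact Nat.prime_two) ht
    rw [Subgroup.disjoint_def]
    intro z hz1 hz2
    have := h.normal_zpowers_c
    obtain ⟨u, hu, v, hv, rfl⟩ := mem_sup_of_normal_left.1 hz2
    have hu1 : u = 1 := by
      refine Subgroup.disjoint_def.1 h1 hu ?_
      have e : u = (u * v) * v⁻¹ := by group
      rw [e]
      exact mul_mem ((zpowers_le.2 hd) hz1) (inv_mem (mem_sup_right hv))
    subst hu1
    rw [one_mul] at hz1 ⊢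
    exact Subgroup.disjoint_def.1 h2 hz1 hv
  · have hle : zpowers c ⊔ zpowers t ≤ centralizer {d} := by
      refine sup_le ?_ ?_ <;> rw [zpowers_le, mem_centralizer_iff]
      · rintro _ rfl; exact hdc
      · rintro _ rfl; exact hdt
    rintro _ ⟨i, rfl⟩ s hs
    have : Commute d s := mem_centralizer_iff.1 (hle hs) d rfl
    exact (this.zpow_left i).eq

theorem fitsRow_cyclicTimesDihedralRotation [Finite G] (h : RotaryFrame a c b l t) (hc : c ≠ 1)
    {f : ℕ} (hf : 0 < f) (hl : orderOf l = 2 ^ f) (htl : t ∉ zpowers l) (hlc : Commute l c) :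
    FitsRow 2 (a * c * b * l) t .cyclicTimesDihedralRotation := by
  obtain ⟨e, he⟩ := h.orderOf_c
  have he0 : 0 < e := by
    rw [Nat.pos_iff_ne_zero]; rintro rfl; exact hc (orderOf_eq_one_iff.1 (by simpa using he))
  refine ⟨a, b, _, h.hasHallDecomposition, e, f, c, l, t, _, he0, hf, h.isDihedralThree he, hl,
    ?_, h.mul_eq, rfl, ?_, ?_, rfl⟩
  · rw [sup_left_comm]
    exact h.isInternalDirect_dihedral hlc h.comm_lt (mem_sup_left (mem_zpowers l)) htl
  · rw [h.orderOf_mul, centOrder_of_commute (h.comm_bc.symm.mul_right hlc.symm),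
      h.centOrder_c_mul, he, hl]; ring
  · rw [h.orderOf_faceRotation, he]; ring

theorem fitsRow_cyclicTimesDihedralReflection [Finite G] (h : RotaryFrame a c b l t) (hc : c ≠ 1)
    {f : ℕ} (hf : 0 < f) (hl : orderOf l = 2 ^ f) (htl : t ∉ zpowers l)
    (hlc : l * c * l⁻¹ = c⁻¹) :
    FitsRow 2 (a * c * b * l) t .cyclicTimesDihedralReflection := by
  obtain ⟨e, he⟩ := h.orderOf_c
  have he0 : 0 < e := by
    rw [Nat.pos_iff_ne_zero]; rintro rfl; exact hc (orderOf_eq_one_iff.1 (by simpa using he))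
  have htt := h.t_mul_self
  have hltt : l * t * t = l := by rw [mul_assoc, htt, mul_one]
  have hev : 2 ∣ 2 ^ f := dvd_pow_self 2 hf.ne'
  have ht2 : ∀ m : ℕ, 2 ∣ m → t ^ m = 1 := fun m hm => by
    rw [← orderOf_dvd_iff_pow_eq_one, h.orderOf_t]; exact hm
  -- `l * t` centralizes `c`, and has the same order as `l`
  have hdc : Commute (l * t) c := by
    have : (l * t) * c * (l * t)⁻¹ = c := by
      calc (l * t) * c * (l * t)⁻¹ = l * (t * c * t⁻¹) * l⁻¹ := by group
        _ = (l * c * l⁻¹)⁻¹ := by rw [h.t_conj_c]; group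
        _ = c := by rw [hlc, inv_inv]
    rwa [mul_inv_eq_iff_eq_mul] at this
  have hdt : Commute (l * t) t := h.comm_lt.mul_left (Commute.refl t)
  have htd : t ∉ zpowers (l * t) := by
    rw [← mem_powers_iff_mem_zpowers]
    rintro ⟨j, hj⟩
    have hj : (l * t) ^ j = t := hj
    rw [h.comm_lt.mul_pow] at hj
    rcases Nat.even_or_odd j with hj2 | hj2
    · rw [ht2 j hj2.two_dvd, mul_one] at hj
      exact htl (hj ▸ npow_mem_zpowers l j)
    · obtain ⟨i, rfl⟩ := hj2
      rw [pow_succ t, ht2 _ (Dvd.intro _ rfl), one_mul, mul_eq_right] at hj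
      have := orderOf_dvd_of_pow_eq_one hj
      rw [hl] at this
      have := hev.trans this
      omega
  have hd : orderOf (l * t) = 2 ^ f := by
    obtain ⟨i, hi, hd⟩ := (Nat.dvd_prime_pow Nat.prime_two).1 (orderOf_dvd_of_pow_eq_one
      (show (l * t) ^ 2 ^ f = 1 by
        rw [h.comm_lt.mul_pow, ht2 _ hev, ← hl, pow_orderOf_eq_one, one_mul]))
    rcases Nat.eq_zero_or_pos i with rfl | hi0
    · exfalso
      apply htl
      rw [pow_zero, orderOf_eq_one_iff] at hd
      rw [← h.t_inv, ← eq_inv_of_mul_eq_one_left hd]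
      exact mem_zpowers l
    · have h1 : l ^ 2 ^ i = 1 := by
        have := pow_orderOf_eq_one (l * t)
        rwa [hd, h.comm_lt.mul_pow, ht2 _ (dvd_pow_self 2 hi0.ne'), mul_one] at this
      have h2 := orderOf_dvd_of_pow_eq_one h1
      rw [hl, Nat.pow_dvd_pow_iff_le_right (by norm_num)] at h2
      rw [hd, le_antisymm hi h2]
  have hH : zpowers c ⊔ (zpowers l ⊔ zpowers t) = zpowers (l * t) ⊔ (zpowers c ⊔ zpowers t) := by
    rw [sup_left_comm (zpowers (l * t))]
    congr 1
    apply le_antisymm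
    · refine sup_le (zpowers_le.2 ?_) le_sup_right
      have h1 : l * t ∈ zpowers (l * t) ⊔ zpowers t := mem_sup_left (mem_zpowers _)
      have h2 := mul_mem h1 (mem_sup_right (mem_zpowers t))
      rwa [hltt] at h2
    · refine sup_le (zpowers_le.2 ?_) le_sup_right
      exact mul_mem (mem_sup_left (mem_zpowers _)) (mem_sup_right (mem_zpowers _))
  refine ⟨a, b, _, h.hasHallDecomposition, e, f, c, l * t, t, _, he0, hf, h.isDihedralThree he, hd,
    ?_, ?_, rfl, ?_, ?_, rfl⟩
  · rw [hH]
    exact h.isInternalDirect_dihedral hdc hdt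
      (mul_mem (mem_sup_left (mem_zpowers _)) (mem_sup_right (mem_zpowers _))) htd
  · rw [h.mul_eq, mul_assoc _ (l * t), hltt]
  · have h1 : centOrder c (b * l) = 1 := by
      refine centOrder_of_conj_eq_inv ?_ h.odd_c
      calc b * l * c * (b * l)⁻¹ = b * (l * c * l⁻¹) * b⁻¹ := by group
        _ = c⁻¹ := by rw [hlc, h.comm_bc.inv_right.eq, mul_inv_cancel_right]
    have h2 : b * c * (l * t) * t = b * c * l := by rw [mul_assoc _ (l * t), hltt]
    rw [h.orderOf_mul, h1, h2, h.centOrder_c_mul, hl]; ring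
  · rw [h.orderOf_faceRotation, he]; ring

end RotaryFrame

end Frames

/-! ### The last row -/

section Klein

open Subgroup

variable {G : Type u} [Group G]

theorem eq_one_or_eq_of_mem_zpowers {t z : G} (ht : t * t = 1) (hz : z ∈ zpowers t) :
    z = 1 ∨ z = t := by
  obtain ⟨i, rfl⟩ := hz
  rcases Int.even_or_odd' i with ⟨j, rfl | rfl⟩
  · left; simp only [zpow_mul, zpow_two, ht, one_zpow]
  · right; simp only [zpow_add, zpow_mul, zpow_two, ht, one_zpow, one_mul, zpow_one]

/-- If the conjugates of `t` under `x` are the involutions of a Klein four-group, the pair `(x, t)`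
belongs to the last row. -/
theorem fitsRow_kleinByCyclic [Finite G] {x t : G} (hgen : closure {x, t} = ⊤)
    (ht : orderOf t = 2) (hx : Odd (orderOf x)) (hne : x * t * x⁻¹ ≠ t)
    (hcomm : Commute t (x * t * x⁻¹))
    (hconj : x * (x * t * x⁻¹) * x⁻¹ = t * (x * t * x⁻¹)) {p : ℕ} (hp : p ≠ 2) :
    FitsRow p x t .kleinByCyclic := by
  set t' := x * t * x⁻¹ with ht'
  have htt : t * t = 1 := by rw [← pow_two, ← ht, pow_orderOf_eq_one]
  have htt' : t' * t' = 1 := by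
    rw [ht', conj_mul, htt, mul_one, mul_inv_cancel]
  have ho' : orderOf t' = 2 := by
    refine orderOf_eq_prime (by rw [pow_two, htt']) ?_
    intro h
    have : t = 1 := by
      have e : t = x⁻¹ * t' * x := by rw [ht']; group
      rw [e, h]; group
    rw [this] at ht; simp at ht
  have h3 : Commute (x ^ 3) t := by
    have : x ^ 3 * t * (x ^ 3)⁻¹ = t := by
      calc x ^ 3 * t * (x ^ 3)⁻¹ = x * (x * t' * x⁻¹) * x⁻¹ := by
            rw [ht']; simp only [pow_succ, pow_zero, one_mul, mul_inv_rev, mul_assoc]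
        _ = t' * (t * t') := by rw [hconj, ← conj_mul, ← ht', hconj]
        _ = t := by rw [← mul_assoc, ← hcomm.eq, mul_assoc, htt', mul_one]
    rwa [mul_inv_eq_iff_eq_mul] at this
  obtain ⟨e, n, hn3, hxo⟩ := Nat.exists_eq_pow_mul_and_not_dvd (orderOf_pos x).ne' 3 (by norm_num)
  have hcop : (3 ^ e).Coprime n :=
    Nat.Coprime.pow_left _ ((Nat.Prime.coprime_iff_not_dvd Nat.prime_three).2 hn3)
  obtain ⟨c, hc, b, hb, hcb, hco, hbo⟩ := exists_mul_of_orderOf_eq_mul hxo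
    (by rw [← hxo]; exact (orderOf_pos x).ne') hcop
  have hbc : Commute c b := by
    obtain ⟨i, rfl⟩ := hc
    obtain ⟨j, rfl⟩ := hb
    exact ((Commute.refl x).zpow_left i).zpow_right j
  have hbx : Commute b x := by
    obtain ⟨j, rfl⟩ := hb
    exact (Commute.refl x).zpow_left j
  have hbt : Commute b t := by
    have h1 : b ∈ zpowers (b ^ 3) := by
      rw [mem_zpowers_pow_iff, hbo]
      exact (Nat.Prime.coprime_iff_not_dvd Nat.prime_three).2 hn3
    obtain ⟨j, hj⟩ := h1
    obtain ⟨i, hi⟩ := hb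
    have e : b = (x ^ 3) ^ (i * j) := by
      rw [← hj]
      simp only [← hi]
      simp only [← zpow_natCast, ← zpow_mul]
      congr 1; push_cast; ring
    rw [e]
    exact h3.zpow_left _
  have hcx : c = x * b⁻¹ := eq_mul_inv_of_mul_eq hcb
  have hbt' : Commute b t' := (hbx.mul_right hbt).mul_right hbx.inv_right
  have hconjc : ∀ z, Commute b z → c * z * c⁻¹ = x * z * x⁻¹ := by
    intro z hz
    rw [hcx]
    calc x * b⁻¹ * z * (x * b⁻¹)⁻¹ = x * (b⁻¹ * z * b) * x⁻¹ := by group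
      _ = x * z * x⁻¹ := by rw [mul_assoc b⁻¹, ← hz.eq, inv_mul_cancel_left]
  have hct : c * t * c⁻¹ = t' := hconjc t hbt
  have hct' : c * t' * c⁻¹ = t * t' := by rw [hconjc t' hbt', hconj]
  have he : 0 < e := by
    rw [Nat.pos_iff_ne_zero]; rintro rfl
    apply hne
    rw [pow_zero, orderOf_eq_one_iff] at hco
    rw [hco] at hct
    simpa using hct.symm
  set V := zpowers t ⊔ zpowers t' with hV
  have htV : t ∈ V := mem_sup_left (mem_zpowers t)
  have htV' : t' ∈ V := mem_sup_right (mem_zpowers t')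
  have hVn : V.Normal := by
    refine normal_of_conj_mem hgen ?_
    intro s hs
    have : V ≤ V.comap (MulAut.conj s).toMonoidHom := by
      refine sup_le ?_ ?_ <;> rw [zpowers_le, mem_comap]
      · rcases hs with rfl | rfl
        · exact htV'
        · simpa using htV
      · rcases hs with rfl | rfl
        · change s * t' * s⁻¹ ∈ V
          rw [hconj]
          exact mul_mem htV htV'
        · change s * t' * s⁻¹ ∈ V
          rw [hcomm.eq, mul_inv_cancel_right]; exact htV'
    exact fun z hz => this hz
  have hVcard : Nat.card V ∣ 4 := by
    have h1 : zpowers t' ≤ normalizer (zpowers t : Set G) :=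
      zpowers_le_normalizer_zpowers (conj_mem_zpowers_of_commute hcomm.symm)
    have := card_sup_dvd_of_le_normalizer h1
    rwa [Nat.card_zpowers, Nat.card_zpowers, ht, ho'] at this
  have hcn : zpowers c ≤ normalizer (V : Set G) := by rw [normalizer_eq_top]; exact le_top
  have hb6 : (orderOf b).Coprime 6 := by
    have h2 : (orderOf b).Coprime 2 :=
      Nat.coprime_two_right.2 (hx.of_dvd_nat (orderOf_dvd_of_mem_zpowers hb))
    have h3 : (orderOf b).Coprime 3 := by
      rw [hbo]; exact ((Nat.Prime.coprime_iff_not_dvd Nat.prime_three).2 hn3).symm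
    exact Nat.Coprime.mul_right h2 h3
  have hw : faceRotation x t = t * t' := rfl
  refine ⟨1, b, V ⊔ zpowers c, ?_, e, c, t, t', V, he, ht, ho', ⟨rfl, ?_, ?_⟩, hco,
    ⟨rfl, ?_, ?_⟩, hct, hct', ?_, rfl, ?_, ?_, hp, rfl⟩
  · refine hasHallDecomposition_of_coprime ?_ ?_ (by simp) (by simp) hb6 ?_ ?_
    · rw [zpowers_one_eq_bot]; infer_instance
    · have hle : V ⊔ zpowers c ≤ centralizer {b} := by
        refine sup_le (sup_le ?_ ?_) ?_ <;> rw [zpowers_le, mem_centralizer_iff]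
        · rintro _ rfl; exact hbt
        · rintro _ rfl; exact hbt'
        · rintro _ rfl; exact hbc.symm
      exact fun s hs => mem_centralizer_iff.1 (hle hs) b rfl
    · intro q hq hdvd
      rcases hq.dvd_mul.1 (hdvd.trans (card_sup_dvd_of_le_normalizer hcn)) with h1 | h1
      · left
        have h4 : q ∣ 2 ^ 2 := h1.trans hVcard
        exact (Nat.prime_dvd_prime_iff_eq hq Nat.prime_two).1 (hq.dvd_of_dvd_pow h4)
      · right
        rw [Nat.card_zpowers, hco] at h1
        exact (Nat.prime_dvd_prime_iff_eq hq Nat.prime_three).1 (hq.dvd_of_dvd_pow h1)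
    · rw [eq_top_iff, ← hgen, closure_le]
      rintro s (rfl | rfl)
      · rw [← hcb]
        exact mul_mem (mem_sup_right (mem_sup_right (mem_sup_right (mem_zpowers c))))
          (mem_sup_right (mem_sup_left (mem_zpowers b)))
      · exact mem_sup_right (mem_sup_right (mem_sup_left htV))
  · refine disjoint_zpowers_of_orderOf_prime (by rw [ho']; exact Nat.prime_two) ?_
    intro h
    rcases eq_one_or_eq_of_mem_zpowers htt h with h | h
    · rw [h] at ho'; simp at ho'
    · exact hne h
  · rintro _ ⟨i, rfl⟩ _ ⟨j, rfl⟩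
    exact ((hcomm.zpow_left i).zpow_right j).eq
  · apply Subgroup.disjoint_of_coprime_natCard
    rw [Nat.card_zpowers, hco]
    exact Nat.Coprime.coprime_dvd_left hVcard (Nat.Coprime.pow_right _ (by decide))
  · exact fun k _ n hn => hVn.conj_mem n hn k
  · rw [← hcb]; exact hbc.eq
  · rw [hxo, hbo]
  · have : orderOf (t * t') = 2 := by
      refine orderOf_eq_prime (by rw [hcomm.mul_pow, pow_two, pow_two, htt, htt', one_mul]) ?_
      intro h
      apply hne
      rw [← mul_right_inj t, htt]; exact h
    rw [hw, this]

end Klein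

/-! ### The dihedral group generated by an involution and its conjugate -/

section DihedralParity

open Subgroup

variable {G : Type u} [Group G]

theorem conj_eq_mul_faceRotation {x t : G} (ht : t * t = 1) :
    x * t * x⁻¹ = t * faceRotation x t := by
  rw [faceRotation, ← mul_assoc, ht, one_mul]

theorem conj_eq_inv_of_mem_zpowers_faceRotation {x t z : G} (ht : t * t = 1)
    (hz : z ∈ zpowers (faceRotation x t)) : t * z * t⁻¹ = z⁻¹ := by
  obtain ⟨i, rfl⟩ := hz
  simp only
  rw [← conj_zpow, conj_faceRotation ht, inv_zpow]

theorem zpowers_le_normalizer_faceRotation [Finite G] {x t : G} (ht : t * t = 1) :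
    zpowers t ≤ normalizer (zpowers (faceRotation x t) : Set G) := by
  apply zpowers_le_normalizer_zpowers
  rw [conj_faceRotation ht]
  exact inv_mem (mem_zpowers _)

theorem card_dihedral [Finite G] {x t : G} (ht : orderOf t = 2) :
    Nat.card (zpowers (faceRotation x t) ⊔ zpowers t : Subgroup G) =
      2 * orderOf (faceRotation x t) := by
  have htt : t * t = 1 := by rw [← pow_two, ← ht, pow_orderOf_eq_one]
  rw [card_sup_of_le_normalizer (zpowers_le_normalizer_faceRotation htt), Nat.card_zpowers,
    Nat.card_zpowers, ht, mul_comm]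
  refine disjoint_zpowers_of_orderOf_prime (by rw [ht]; exact Nat.prime_two) ?_
  refine notMem_zpowers_faceRotation htt ?_
  rintro rfl
  simp at ht

theorem exists_of_mem_dihedral [Finite G] {x t z : G} (ht : t * t = 1)
    (hz : z ∈ zpowers (faceRotation x t) ⊔ zpowers t) :
    ∃ i : ℤ, z = faceRotation x t ^ i ∨ z = faceRotation x t ^ i * t := by
  rw [← SetLike.mem_coe,
    coe_mul_of_right_le_normalizer_left _ _ (zpowers_le_normalizer_faceRotation ht)] at hz
  obtain ⟨_, ⟨i, rfl⟩, v, hv, rfl⟩ := hz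
  rcases eq_one_or_eq_of_mem_zpowers ht hv with rfl | rfl
  · exact ⟨i, Or.inl (by simp)⟩
  · exact ⟨i, Or.inr rfl⟩

/-- Conjugation by `x` maps the coset `t⟨w²⟩` to `tw⟨w²⟩` and conversely, where `w` is the face
rotation, while the dihedral group `⟨w, t⟩` fixes `t⟨w²⟩`. -/
theorem not_pow_mem_dihedral [Finite G] {x t : G} (ht : t * t = 1)
    (hx : x * faceRotation x t * x⁻¹ ∈ zpowers (faceRotation x t))
    (heven : Even (orderOf (faceRotation x t))) {s : ℕ} (hs : Odd s) :
    x ^ s ∉ zpowers (faceRotation x t) ⊔ zpowers t := by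
  set w := faceRotation x t with hw
  have hxt : x * t * x⁻¹ = t * w := conj_eq_mul_faceRotation ht
  obtain ⟨j, hj⟩ := hx
  have hj : w ^ j = x * w * x⁻¹ := hj
  have hjodd : Odd j := by
    rw [← Int.not_even_iff_odd]
    rintro ⟨m, rfl⟩
    obtain ⟨n, hn⟩ := heven
    have h1 : (x * w * x⁻¹) ^ n = 1 := by
      rw [← hj, ← zpow_natCast, ← zpow_mul,
        show (m + m) * (n : ℤ) = (orderOf w : ℤ) * m by rw [hn]; push_cast; ring, zpow_mul,
        zpow_natCast, pow_orderOf_eq_one, one_zpow]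
    rw [conj_pow, mul_inv_eq_one, mul_eq_left] at h1
    have h2 := Nat.le_of_dvd ?_ (orderOf_dvd_of_pow_eq_one h1)
    · have := orderOf_pos w; omega
    · have := orderOf_pos w; omega
  have hpow : ∀ n : ℕ, ∃ i : ℤ, x ^ n * t * (x ^ n)⁻¹ = t * w ^ i ∧ (Even i ↔ Even n) := by
    intro n
    induction n with
    | zero => exact ⟨0, by simp, by simp⟩
    | succ n ih =>
      obtain ⟨i, hi, hpar⟩ := ih
      refine ⟨1 + j * i, ?_, ?_⟩
      · calc x ^ (n + 1) * t * (x ^ (n + 1))⁻¹ = x * (x ^ n * t * (x ^ n)⁻¹) * x⁻¹ := by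
              rw [pow_succ']; group
          _ = (x * t * x⁻¹) * (x * w * x⁻¹) ^ i := by rw [hi, ← conj_mul, conj_zpow]
          _ = t * w ^ (1 + j * i) := by
              rw [hxt, ← hj, ← zpow_mul, zpow_add, zpow_one, mul_assoc]
      · rw [Int.even_add, Int.even_mul, Nat.even_add, hpar]
        have : ¬ Even j := Int.not_even_iff_odd.2 hjodd
        simp [this]
  intro hmem
  obtain ⟨i, hi, hpar⟩ := hpow s
  have hiodd : Odd i := by
    rw [← Int.not_even_iff_odd, hpar, Nat.not_even_iff_odd]; exact hs
  obtain ⟨m, hm⟩ := exists_of_mem_dihedral ht hmem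
  have hm' : x ^ s * t * (x ^ s)⁻¹ = t * w ^ (-2 * m) := by
    have h1 : w ^ m * t * (w ^ m)⁻¹ = t * w ^ (-2 * m) := by
      have := mul_faceRotation_zpow (x := x) ht (-m)
      rw [neg_neg] at this
      rw [← hw] at this
      rw [← this, mul_assoc, ← zpow_neg, ← zpow_add]
      congr 2; ring
    rcases hm with hm | hm
    · rw [hm, h1]
    · rw [hm, ← hw, mul_inv_rev, ← h1]
      group
  rw [hi, mul_right_inj] at hm'
  have h1 : w ^ (i + 2 * m) = 1 := by
    rw [zpow_add, hm', ← zpow_add]; simp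
  have h2 := orderOf_dvd_iff_zpow_eq_one.2 h1
  have h3 : (2 : ℤ) ∣ i + 2 * m := (Int.natCast_dvd_natCast.2 heven.two_dvd).trans h2
  have h4 : (2 : ℤ) ∣ i := by omega
  exact (Int.not_even_iff_odd.2 hiodd) (even_iff_two_dvd.2 h4)

theorem Subgroup.odd_index_of_pow_factorization_dvd_card [Finite G] {D : Subgroup G}
    (h : 2 ^ (Nat.card G).factorization 2 ∣ Nat.card D) : Odd D.index := by
  rw [← Nat.not_even_iff_odd]
  intro he
  have h1 : 2 ^ ((Nat.card G).factorization 2 + 1) ∣ Nat.card G := by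
    rw [pow_succ, ← D.card_mul_index]
    exact mul_dvd_mul (by rwa [D.card_mul_index]) he.two_dvd
  exact Nat.pow_succ_factorization_not_dvd Nat.card_pos.ne' Nat.prime_two h1

/-- A normal `2`-subgroup that is not cyclic forces the last row, when a Sylow `2`-subgroup is
contained in the dihedral group `⟨t, x t x⁻¹⟩`. -/
theorem fitsRow_kleinByCyclic_of_not_isCyclic [Finite G] {x t : G} (hgen : closure {x, t} = ⊤)
    (ht : orderOf t = 2) {p : ℕ} (hp : p ≠ 2) {N : Subgroup G} [hN : N.Normal] (hN2 : IsPGroup 2 N)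
    (hNc : ¬ IsCyclic N)
    (hw2 : 2 ^ (Nat.card G).factorization 2 ∣ 2 * orderOf (faceRotation x t)) :
    FitsRow p x t .kleinByCyclic := by
  have htt : t * t = 1 := by rw [← pow_two, ← ht, pow_orderOf_eq_one]
  have ht1 : t ≠ 1 := by rintro rfl; simp at ht
  have hcard := card_dihedral (x := x) ht
  have hmem := fun z => exists_of_mem_dihedral (x := x) (t := t) (z := z) htt
  have hxt : x * t * x⁻¹ = t * faceRotation x t := conj_eq_mul_faceRotation htt
  have htw : t ∉ zpowers (faceRotation x t) := notMem_zpowers_faceRotation htt ht1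
  have hpar := not_pow_mem_dihedral (x := x) htt
  have hinv := conj_faceRotation (x := x) htt
  have hinvz := mul_faceRotation_zpow (x := x) htt
  set w := faceRotation x t with hw
  set D := zpowers w ⊔ zpowers t with hD
  have hti : t⁻¹ = t := inv_eq_of_mul_eq_one_left htt
  -- `N` lies in every Sylow `2`-subgroup, one of which is contained in `D`
  have hND : N ≤ D := by
    obtain ⟨Q, hQ⟩ := Sylow.exists_subgroup_card_pow_prime (G := D) 2 (hcard ▸ hw2)
    have hQc : Nat.card (Q.map D.subtype) = 2 ^ (Nat.card G).factorization 2 := by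
      rw [← hQ]
      exact (Nat.card_congr (Q.equivMapOfInjective D.subtype D.subtype_injective).toEquiv).symm
    let P : Sylow 2 G := Sylow.ofCard _ hQc
    have hPD : (P : Subgroup G) ≤ D := by
      change Q.map D.subtype ≤ D
      exact map_subtype_le Q
    have h1 : IsPGroup 2 (N ⊔ P : Subgroup G) := hN2.to_sup_of_normal_left P.2
    have h2 := P.3 h1 le_sup_right
    exact (le_sup_left.trans h2.le).trans hPD
  obtain ⟨n, hnN, hnw⟩ : ∃ n ∈ N, n ∉ zpowers w := by
    by_contra! hcon
    exact hNc (isCyclic_of_le (show N ≤ zpowers w from hcon))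
  obtain ⟨i, hi⟩ := hmem n (hND hnN)
  replace hi : n = w ^ i * t := hi.resolve_left fun h => hnw (h ▸ zpow_mem (mem_zpowers w) i)
  have hw2N : w ^ 2 ∈ N := by
    have h1 := mul_mem (hN.conj_mem n hnN w) (inv_mem hnN)
    have e : w * n * w⁻¹ * n⁻¹ = w ^ 2 := by
      rw [hi]
      have : t * w⁻¹ * t⁻¹ = w := by rw [← conj_inv, hinv, inv_inv]
      calc w * (w ^ i * t) * w⁻¹ * (w ^ i * t)⁻¹ = w * w ^ i * (t * w⁻¹ * t⁻¹) * (w ^ i)⁻¹ := by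
            group
        _ = w ^ 2 := by rw [this]; group
    rwa [e] at h1
  have htN : t ∈ N := by
    have heven : ∀ m : ℤ, w ^ (2 * m) ∈ N := fun m => by
      rw [zpow_mul]; exact zpow_mem (by exact_mod_cast hw2N) m
    rcases Int.even_or_odd' i with ⟨m, hm | hm⟩
    · have h1 := mul_mem (inv_mem (heven m)) hnN
      rwa [hi, hm, inv_mul_cancel_left] at h1
    · -- here `x * t * x⁻¹ = t * w` lies in `N`
      have h1 := mul_mem (mul_mem (inv_mem (heven m)) hnN) hw2N
      have e : (w ^ (2 * m))⁻¹ * n * w ^ 2 = x * t * x⁻¹ := by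
        rw [hxt, hi, hm]
        have := hinvz (-1)
        rw [neg_neg, zpow_one, zpow_neg, zpow_one] at this
        rw [zpow_add, zpow_one, mul_assoc (w ^ (2 * m)), inv_mul_cancel_left, ← this]
        group
      rw [e] at h1
      have h2 := hN.conj_mem _ h1 x⁻¹
      have e2 : x⁻¹ * (x * t * x⁻¹) * x⁻¹⁻¹ = t := by group
      rwa [e2] at h2
  have hwN : w ∈ N := mul_mem htN (hN.conj_mem t htN x)
  have hDN : N = D := le_antisymm hND (sup_le (zpowers_le.2 hwN) (zpowers_le.2 htN))
  have hxN : x ^ N.index ∈ D := hDN ▸ N.pow_index_mem x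
  have hodd : Odd N.index := odd_index_of_pow_factorization_dvd_card (by rw [hDN, hcard]; exact hw2)
  have hw1 : w ≠ 1 := by
    intro h
    apply hNc
    rw [hDN, hD, h, zpowers_one_eq_bot, bot_sup_eq]
    infer_instance
  have hweven : Even (orderOf w) := by
    have : Fact (Nat.Prime 2) := ⟨Nat.prime_two⟩
    obtain ⟨m, hm⟩ := IsPGroup.iff_orderOf.1 hN2 ⟨w, hwN⟩
    rw [Subgroup.orderOf_mk] at hm
    rw [hm, Nat.even_pow]
    refine ⟨even_two, ?_⟩
    rintro rfl
    exact hw1 (orderOf_eq_one_iff.1 (by simpa using hm))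
  have hxw : x * w * x⁻¹ ∉ zpowers w := fun h => hpar h hweven hodd hxN
  -- hence `w` is conjugate to a reflection, and so it is an involution
  obtain ⟨j, hj⟩ := hmem _ (show x * w * x⁻¹ ∈ D from hDN ▸ hN.conj_mem w hwN x)
  replace hj : x * w * x⁻¹ = w ^ j * t :=
    hj.resolve_left fun h => hxw (h ▸ zpow_mem (mem_zpowers w) j)
  have hww : w * w = 1 := by
    have h1 : (x * w * x⁻¹) * (x * w * x⁻¹) = 1 := by
      rw [hj]
      calc w ^ j * t * (w ^ j * t) = w ^ j * (t * w ^ j) * t := by group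
        _ = 1 := by rw [hinvz, ← mul_assoc, ← zpow_add, mul_assoc, htt]; simp
    rwa [conj_mul, mul_inv_eq_one, mul_eq_left] at h1
  have hct : Commute t w := by
    have : w⁻¹ = w := inv_eq_of_mul_eq_one_left hww
    rw [this, mul_inv_eq_iff_eq_mul] at hinv
    exact hinv
  have hwt : w ≠ t := fun h => htw (h ▸ mem_zpowers w)
  have hj' : x * w * x⁻¹ = t := by
    rcases eq_one_or_eq_of_mem_zpowers hww (zpow_mem (mem_zpowers w) j) with h | h
    · rw [hj, h, one_mul]
    · exfalso
      rw [h, ← hct.eq, ← hxt] at hj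
      exact hwt (by simpa using hj)
  have hne : x * t * x⁻¹ ≠ t := by rw [hxt]; simpa using hw1
  have hconj : x * (x * t * x⁻¹) * x⁻¹ = t * (x * t * x⁻¹) := by
    nth_rewrite 1 [hxt]
    rw [← conj_mul, hj', hxt, mul_assoc, ← hct.eq]
  refine fitsRow_kleinByCyclic hgen ht ?_ hne ?_ hconj hp
  · -- an odd power of `x` lies in `N`, where `x` centralizes only the identity
    have hx1 : x ^ N.index = 1 := by
      have hcx : x * x ^ N.index * x⁻¹ = x ^ N.index := by
        rw [← pow_succ', pow_succ, mul_inv_cancel_right]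
      obtain ⟨m, hm⟩ := hmem _ hxN
      have hwm := eq_one_or_eq_of_mem_zpowers hww (zpow_mem (mem_zpowers w) m)
      rcases hm with hm | hm <;> rcases hwm with hwm | hwm <;> rw [hwm] at hm
      · exact hm
      · rw [hm, hj'] at hcx; exact absurd hcx.symm hwt
      · rw [hm, one_mul] at hcx; exact absurd hcx hne
      · exfalso
        rw [hm, ← hct.eq, ← conj_mul, hj', hxt] at hcx
        exact ht1 (mul_eq_left.1 hcx)
    exact hodd.of_dvd_nat (orderOf_dvd_of_pow_eq_one hx1)
  · rw [hxt]
    exact (Commute.refl t).mul_right hct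

end DihedralParity

/-! ### Normal forms when the commutator subgroup is cyclic -/

section CyclicCase

open Subgroup commutatorElement

variable {G : Type u} [Group G]

theorem exists_mem_zpowers_orderOf_eq [Finite G] {g : G} {r : ℕ} (hr : r ∣ orderOf g) :
    ∃ v ∈ zpowers g, orderOf v = r :=
  ⟨g ^ (orderOf g / r), npow_mem_zpowers g _, orderOf_pow_orderOf_div (orderOf_pos g).ne' hr⟩

/-- A quotient of `⟨x, t⟩` in which the images of `x` and `t` commute is abelian. -/
theorem commutatorElement_mem_of_faceRotation_mem {x t : G} (hgen : closure {x, t} = ⊤)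
    (ht : t * t = 1) {N : Subgroup G} [N.Normal] (hw : faceRotation x t ∈ N) (a b : G) :
    ⁅a, b⁆ ∈ N := by
  let π := QuotientGroup.mk' N
  have hxt : Commute (π x) (π t) := by
    have h1 : π (t * (x * t * x⁻¹)) = 1 := (QuotientGroup.eq_one_iff _).2 hw
    have h2 : π t * π t = 1 := by rw [← map_mul, ht, map_one]
    simp only [map_mul, map_inv] at h1
    have h3 : π x * π t * (π x)⁻¹ = π t := by
      rw [← mul_right_inj (π t), h1, h2]
    rwa [mul_inv_eq_iff_eq_mul] at h3
  have htop : ∀ z ∈ ({x, t} : Set G), ∀ b : G, Commute (π z) (π b) := by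
    intro z hz b
    have hle : closure {x, t} ≤ (centralizer {π z}).comap π := by
      rw [closure_le]
      intro s hs
      rw [SetLike.mem_coe, mem_comap, mem_centralizer_iff]
      rintro _ rfl
      rcases hz with rfl | rfl <;> rcases hs with rfl | rfl
      · rfl
      · exact hxt.eq
      · exact hxt.eq.symm
      · rfl
    rw [hgen] at hle
    exact mem_centralizer_iff.1 (hle (mem_top b)) _ rfl
  have hab : Commute (π a) (π b) := by
    have hle : closure {x, t} ≤ (centralizer {π b}).comap π := by
      rw [closure_le]
      intro s hs
      rw [SetLike.mem_coe, mem_comap, mem_centralizer_iff]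
      rintro _ rfl
      exact (htop s hs b).eq.symm
    rw [hgen] at hle
    exact (mem_centralizer_iff.1 (hle (mem_top a)) _ rfl).symm
  rw [← QuotientGroup.eq_one_iff]
  change π ⁅a, b⁆ = 1
  rw [map_commutatorElement, commutatorElement_eq_one_iff_commute]
  exact hab

theorem Subgroup.normal_of_commutatorElement_mem {A N : Subgroup G}
    (h : ∀ a b : G, ⁅a, b⁆ ∈ A) (hAN : A ≤ N) : N.Normal := by
  refine ⟨fun n hn s => ?_⟩
  have e : s * n * s⁻¹ = ⁅s, n⁆ * n := by rw [commutatorElement_def]; group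
  rw [e]
  exact mul_mem (hAN (h s n)) hn

/-- Automorphisms of order prime to `6` of a cyclic `3`-group are trivial. -/
theorem commute_of_coprime_six [Finite G] {b c : G} [hc : (zpowers c).Normal] {e : ℕ}
    (he : orderOf c = 3 ^ e) (hb : (orderOf b).Coprime 6) : Commute b c := by
  have h1 : orderOf (MulAut.conjNormal (H := zpowers c) b) ∣ orderOf b := orderOf_map_dvd _ _
  have h2 : orderOf (MulAut.conjNormal (H := zpowers c) b) ∣ Nat.card (MulAut (zpowers c)) :=
    orderOf_dvd_natCard _
  rw [IsCyclic.card_mulAut, Nat.card_zpowers, he] at h2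
  have h3 : orderOf (MulAut.conjNormal (H := zpowers c) b) ∣ 6 ^ e := by
    refine h2.trans ?_
    rcases Nat.eq_zero_or_pos e with rfl | h
    · simp
    · rw [Nat.totient_prime_pow Nat.prime_three h, show 6 = 3 * 2 by rfl, mul_pow]
      exact mul_dvd_mul (pow_dvd_pow 3 (Nat.sub_le e 1)) (dvd_pow_self 2 h.ne')
  have h4 := Nat.eq_one_of_dvd_coprimes (Nat.Coprime.pow_right e hb) h1 h3
  rw [orderOf_eq_one_iff] at h4
  have h5 := congrArg (fun f : MulAut (zpowers c) => ((f ⟨c, mem_zpowers c⟩ : zpowers c) : G)) h4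
  simp only [MulAut.conjNormal_apply, MulAut.one_apply] at h5
  rwa [mul_inv_eq_iff_eq_mul] at h5

/-- The automorphisms of `2`-power order of a cyclic `3`-group are the identity and the
inversion. -/
theorem commute_or_conj_eq_inv [Finite G] {l c : G} [hc : (zpowers c).Normal] {e f : ℕ}
    (he : orderOf c = 3 ^ e) (hl : orderOf l = 2 ^ f) : Commute l c ∨ l * c * l⁻¹ = c⁻¹ := by
  have h1 : orderOf (MulAut.conjNormal (H := zpowers c) l) ∣ 2 ^ f :=
    hl ▸ orderOf_map_dvd _ _
  have h2 : orderOf (MulAut.conjNormal (H := zpowers c) l) ∣ Nat.card (MulAut (zpowers c)) :=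
    orderOf_dvd_natCard _
  rw [IsCyclic.card_mulAut, Nat.card_zpowers, he] at h2
  have h3 : orderOf (MulAut.conjNormal (H := zpowers c) l) ∣ 2 := by
    rcases Nat.eq_zero_or_pos e with rfl | h
    · exact h2.trans (by simp)
    · rw [Nat.totient_prime_pow Nat.prime_three h] at h2
      refine Nat.Coprime.dvd_of_dvd_mul_left ?_ h2
      have h3 : (3 ^ (e - 1)).Coprime (2 ^ f) := Nat.Coprime.pow _ _ (by decide)
      exact h3.symm.coprime_dvd_left h1
  have h4 := orderOf_dvd_iff_pow_eq_one.1 h3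
  have h5 := congrArg (fun f : MulAut (zpowers c) => ((f ⟨c, mem_zpowers c⟩ : zpowers c) : G)) h4
  rw [pow_two] at h5
  simp only [MulAut.mul_apply, MulAut.conjNormal_apply, MulAut.one_apply] at h5
  obtain ⟨i, hi⟩ := hc.conj_mem c (mem_zpowers c) l
  have hi : c ^ i = l * c * l⁻¹ := hi
  -- `l` acts as the power `i`, with `i ^ 2 ≡ 1`
  rw [← hi, ← conj_zpow, ← hi, ← zpow_mul] at h5
  have h6 : (3 : ℤ) ^ e ∣ (i - 1) * (i + 1) := by
    have : c ^ ((i - 1) * (i + 1)) = 1 := by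
      rw [show (i - 1) * (i + 1) = i * i - 1 by ring, zpow_sub, h5]; simp
    have := orderOf_dvd_iff_zpow_eq_one.2 this
    rw [he] at this
    exact_mod_cast this
  have hdvd : ∀ k : ℤ, (3 : ℤ) ^ e ∣ k → c ^ k = 1 := by
    intro k hk
    rw [← orderOf_dvd_iff_zpow_eq_one, he]
    exact_mod_cast hk
  by_cases h7 : (3 : ℤ) ∣ i - 1
  · have h8 : ¬ (3 : ℤ) ∣ i + 1 := by omega
    left
    have h9 := hdvd _ (Int.prime_three.pow_dvd_of_dvd_mul_right e h8 h6)
    rw [zpow_sub, zpow_one, mul_inv_eq_one, hi, mul_inv_eq_iff_eq_mul] at h9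
    exact h9
  · right
    have h9 := hdvd _ (Int.prime_three.pow_dvd_of_dvd_mul_left e h7 h6)
    rw [zpow_add, zpow_one, hi] at h9
    exact eq_inv_of_mul_eq_one_left h9

/-- A normal form in one of the first six rows, from a decomposition `x = g * l` of the rotation,
where `⟨g⟩` contains the commutator subgroup and is inverted by `t`, and `l` centralizes `t`. -/
theorem exists_fitsRow_of_mul [Finite G] {g l t : G} (hgen : closure {g * l, t} = ⊤)
    (ht : orderOf t = 2) [hgn : (zpowers g).Normal] (htg : t * g * t⁻¹ = g⁻¹) (hlt : Commute l t)
    (hodd : Odd (orderOf g)) (hco : (orderOf g).Coprime (orderOf l)) {p : ℕ}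
    (hpg : ¬ p ∣ orderOf g) (hpt : p ≠ 2 → t ∈ zpowers l) :
    ∃ row, FitsRow p (g * l) t row := by
  have htt : t * t = 1 := by rw [← pow_two, ← ht, pow_orderOf_eq_one]
  have hinv : ∀ z ∈ zpowers g, t * z * t⁻¹ = z⁻¹ := by
    rintro _ ⟨i, rfl⟩
    simp only
    rw [← conj_zpow, htg, inv_zpow]
  have hconj : ∀ z ∈ zpowers g, ∀ s, s * z * s⁻¹ ∈ zpowers z := fun z hz s =>
    conj_mem_zpowers_of_mem hz (hgn.conj_mem g (mem_zpowers g) s)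
  obtain ⟨e, n, hn3, hgo⟩ := Nat.exists_eq_pow_mul_and_not_dvd (orderOf_pos g).ne' 3 (by norm_num)
  obtain ⟨c, hcg, a, hag, hca, hc, ha⟩ := exists_mul_of_orderOf_eq_mul hgo
    (by rw [← hgo]; exact (orderOf_pos g).ne')
    (Nat.Coprime.pow_left _ ((Nat.Prime.coprime_iff_not_dvd Nat.prime_three).2 hn3))
  obtain ⟨f, m', hm2, hlo'⟩ := Nat.exists_eq_pow_mul_and_not_dvd (orderOf_pos l).ne' 2 (by norm_num)
  obtain ⟨j, m, hm3, rfl⟩ := Nat.exists_eq_pow_mul_and_not_dvd (n := m')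
    (by rintro rfl; simp at hm2) 3 (by norm_num)
  have hlo : orderOf l = (2 ^ f * 3 ^ j) * m := by rw [hlo']; ring
  have hm2' : ¬ 2 ∣ m := fun h => hm2 (h.mul_left _)
  have hm6 : m.Coprime 6 := Nat.Coprime.mul_right
    ((Nat.Prime.coprime_iff_not_dvd Nat.prime_two).2 hm2').symm
    ((Nat.Prime.coprime_iff_not_dvd Nat.prime_three).2 hm3).symm
  obtain ⟨k, hkl, b, hbl, hkb, hk, hb⟩ := exists_mul_of_orderOf_eq_mul hlo
    (by rw [← hlo]; exact (orderOf_pos l).ne')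
    (Nat.Coprime.mul_left
      (Nat.Coprime.pow_left _ (Nat.Coprime.coprime_dvd_right (by decide) hm6).symm)
      (Nat.Coprime.pow_left _ (Nat.Coprime.coprime_dvd_right (by decide) hm6).symm))
  have hcomm : ∀ {s z z' : G}, z ∈ zpowers s → z' ∈ zpowers s → Commute z z' := by
    rintro s _ _ ⟨i, rfl⟩ ⟨i', rfl⟩
    exact ((Commute.refl s).zpow_left i).zpow_right i'
  have hlcomm : ∀ z ∈ zpowers l, Commute z t := by
    rintro _ ⟨i, rfl⟩; exact hlt.zpow_left i
  have hcn : (zpowers c).Normal := ⟨by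
    rintro _ ⟨i, rfl⟩ s
    simp only
    rw [← conj_zpow]; exact zpow_mem (hconj c hcg s) i⟩
  have hb6 : (orderOf b).Coprime 6 := by rw [hb]; exact hm6
  have hx : g * l = a * c * b * k := by
    rw [← hca, ← hkb, (hcomm hcg hag).eq, (hcomm hkl hbl).eq]; simp only [mul_assoc]
  have hframe : RotaryFrame a c b k t := {
    closure_eq := by rw [← hx, hgen]
    orderOf_t := ht
    t_conj_a := hinv a hag
    t_conj_c := hinv c hcg
    comm_ac := hcomm hag hcg
    comm_bl := hcomm hbl hkl
    comm_bt := hlcomm b hbl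
    comm_lt := hlcomm k hkl
    comm_bc := commute_of_coprime_six hc hb6
    b_conj_a := hconj a hag b
    l_conj_a := hconj a hag k
    l_conj_c := hconj c hcg k
    orderOf_c := ⟨e, hc⟩
    coprime_a_six := by
      rw [ha]
      refine Nat.Coprime.mul_right (n := 3) (m := 2) ?_ ?_
      · exact Nat.coprime_two_right.2 (hodd.of_dvd_nat (hgo ▸ Dvd.intro_left _ rfl))
      · exact ((Nat.Prime.coprime_iff_not_dvd Nat.prime_three).2 hn3).symm
    coprime_b_six := hb6
    coprime_ab := (hco.coprime_dvd_left (orderOf_dvd_of_mem_zpowers hag)).coprime_dvd_right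
      (orderOf_dvd_of_mem_zpowers hbl)
    prime_dvd_l := by
      intro q hq hd
      rw [hk] at hd
      rcases hq.dvd_mul.1 hd with h | h
      · exact Or.inl ((Nat.prime_dvd_prime_iff_eq hq Nat.prime_two).1 (hq.dvd_of_dvd_pow h))
      · exact Or.inr ((Nat.prime_dvd_prime_iff_eq hq Nat.prime_three).1 (hq.dvd_of_dvd_pow h))
    coprime_cl := (hco.coprime_dvd_left (orderOf_dvd_of_mem_zpowers hcg)).coprime_dvd_right
      (orderOf_dvd_of_mem_zpowers hkl) }
  -- raising to the odd power `|b|` kills the part of `l` of order prime to `6`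
  have hpt' : p ≠ 2 → t ∈ zpowers k := by
    intro hp
    obtain ⟨i, hi⟩ := hpt hp
    have hi : l ^ i = t := hi
    have h1 : t ^ orderOf b = t := by
      have : Odd (orderOf b) := Nat.coprime_two_right.1 (hb6.coprime_dvd_right (by decide))
      obtain ⟨r, hr⟩ := this
      rw [hr, pow_succ, pow_mul, pow_two, htt, one_pow, one_mul]
    have h2 : t ^ orderOf b = (k ^ i) ^ orderOf b := by
      rw [← hi, ← hkb, (hcomm hkl hbl).mul_zpow,
        (((hcomm hkl hbl).zpow_left i).zpow_right i).mul_pow, ← zpow_natCast (b ^ i), ← zpow_mul,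
        mul_comm i, zpow_mul, zpow_natCast, pow_orderOf_eq_one, one_zpow, mul_one]
    rw [← h1, h2]
    exact pow_mem (zpow_mem (mem_zpowers k) i) _
  rw [hx]
  by_cases hc1 : c = 1
  · subst hc1
    by_cases htk : t ∈ zpowers k
    · exact ⟨_, hframe.fitsRow_cyclic p htk⟩
    · have hp : p = 2 := by by_contra hp; exact htk (hpt' hp)
      subst hp
      exact ⟨_, hframe.fitsRow_cyclicTimesTwo htk⟩
  · have he0 : e ≠ 0 := by
      rintro rfl; exact hc1 (orderOf_eq_one_iff.1 (by simpa using hc))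
    have h3c : 3 ∣ orderOf c := hc ▸ dvd_pow_self 3 he0
    have hj0 : j = 0 := by
      by_contra hj
      have : 3 ∣ orderOf k := hk ▸ (dvd_pow_self 3 hj).mul_left _
      exact absurd (Nat.eq_one_of_dvd_coprimes hframe.coprime_cl h3c this) (by norm_num)
    rw [hj0, pow_zero, mul_one] at hk
    have hp3 : p ≠ 3 := by
      rintro rfl
      exact hpg (h3c.trans (orderOf_dvd_of_mem_zpowers hcg))
    have hact := commute_or_conj_eq_inv hc hk
    by_cases htk : t ∈ zpowers k
    · -- `t` is not a square in `⟨k⟩`, since squares centralize `c`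
      have hkt : k = t := by
        obtain ⟨i, hi⟩ := htk
        have hi : k ^ i = t := hi
        rcases Int.even_or_odd' i with ⟨r, hr | hr⟩
        · exfalso
          have hk2 : Commute (k ^ (2 : ℤ)) c := by
            rcases hact with h | h
            · exact h.zpow_left 2
            · have : k ^ (2 : ℤ) * c * (k ^ (2 : ℤ))⁻¹ = c := by
                calc k ^ (2 : ℤ) * c * (k ^ (2 : ℤ))⁻¹ = k * (k * c * k⁻¹) * k⁻¹ := by
                      rw [zpow_two, mul_inv_rev]; simp only [mul_assoc]
                  _ = c := by rw [h, ← conj_inv, h, inv_inv]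
              rwa [mul_inv_eq_iff_eq_mul] at this
          have htc : Commute c t := by
            rw [← hi, hr, zpow_mul]; exact (hk2.zpow_left r).symm
          have h1 := centOrder_of_conj_eq_inv (hinv c hcg) hframe.odd_c
          rw [centOrder_of_commute htc, orderOf_eq_one_iff] at h1
          exact hc1 h1
        · have h1 : orderOf k ∣ 2 := by
            have h2 : k ^ (2 * i) = 1 := by
              rw [mul_comm, zpow_mul, hi, zpow_two, htt]
            have h3 := orderOf_dvd_iff_zpow_eq_one.2 h2
            rw [hk] at h3 ⊢
            have h4 : IsCoprime ((2 ^ f : ℕ) : ℤ) i := by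
              push_cast
              exact IsCoprime.pow_left
                ((Int.prime_two).irreducible.coprime_iff_not_dvd.2 (by omega))
            exact Int.natCast_dvd_natCast.1 (h4.dvd_of_dvd_mul_right h3)
          have h2 : k * k = 1 := by
            rw [← pow_two]; exact orderOf_dvd_iff_pow_eq_one.1 h1
          rw [hr, zpow_add, zpow_mul, zpow_two, h2, one_zpow, one_mul, zpow_one] at hi
          exact hi
      subst hkt
      exact ⟨_, hframe.fitsRow_dihedralReflection hc1 hp3⟩
    · have hp : p = 2 := by by_contra hp; exact htk (hpt' hp)
      subst hp
      rcases Nat.eq_zero_or_pos f with rfl | hf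
      · rw [pow_zero, orderOf_eq_one_iff] at hk
        subst hk
        exact ⟨_, hframe.fitsRow_dihedralRotation hc1⟩
      · rcases hact with h | h
        · exact ⟨_, hframe.fitsRow_cyclicTimesDihedralRotation hc1 hf hk htk h⟩
        · exact ⟨_, hframe.fitsRow_cyclicTimesDihedralReflection hc1 hf hk htk h⟩

end CyclicCase

/-! ### Classification of the solvable quotients -/

section SolvableClassification

open Subgroup commutatorElement

variable {G : Type u} [Group G] [Finite G]

theorem Subgroup.mem_zpowers_of_orderOf_eq {K : Subgroup G} (hK : IsCyclic K) {u v : G} (hu : u ∈ K)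
    (hv : v ∈ K) (h : orderOf v = orderOf u) : v ∈ zpowers u := by
  have h1 : (⟨v, hv⟩ : K) ∈ zpowers (⟨u, hu⟩ : K) :=
    IsCyclic.mem_zpowers_of_orderOf_eq (by rwa [Subgroup.orderOf_mk, Subgroup.orderOf_mk])
  obtain ⟨i, hi⟩ := h1
  exact ⟨i, by simpa using congrArg Subtype.val hi⟩

/-- The classification, with the hypothesis on the Euler characteristic reduced to its
consequences for `G = X / O_p(X)`: the arithmetic conditions `hsylow` and `hindex`. -/
theorem exists_fitsRow [Group.IsSolvable G] {p : ℕ} (hp : p.Prime) {x t : G}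
    (hgen : closure {x, t} = ⊤) (ht : orderOf t = 2)
    (hcore : ∀ N : Subgroup G, N.Normal → IsPGroup p N → N = ⊥)
    (hsylow : ∀ r : ℕ, r.Prime → r ≠ p → r ^ (Nat.card G).factorization r ∣ orderOf x ∨
      r ^ (Nat.card G).factorization r ∣ 2 * orderOf (faceRotation x t))
    (hindex : p ≠ 2 → Odd (orderOf (faceRotation x t)) → Odd (zpowers x).index) :
    ∃ row, FitsRow p x t row := by
  have htt : t * t = 1 := by rw [← pow_two, ← ht, pow_orderOf_eq_one]
  have hti : t⁻¹ = t := inv_eq_of_mul_eq_one_left htt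
  have ht1 : t ≠ 1 := by rintro rfl; simp at ht
  have hcyc : ∀ r : ℕ, r.Prime → r ≠ p → r ≠ 2 → ∀ N : Subgroup G, IsPGroup r N →
      IsCyclic N := by
    intro r hr hrp hr2 N hN
    rcases hsylow r hr hrp with h | h
    · exact hN.isCyclic_of_dvd_orderOf hr h
    · refine hN.isCyclic_of_dvd_orderOf hr (Nat.Coprime.dvd_of_dvd_mul_left ?_ h)
      exact Nat.Coprime.pow_left _ ((Nat.coprime_primes hr Nat.prime_two).2 hr2)
  by_cases hA : ∃ N : Subgroup G, p ≠ 2 ∧ N.Normal ∧ IsPGroup 2 N ∧ ¬ IsCyclic N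
  · obtain ⟨N, hp2, hN, hN2, hNc⟩ := hA
    rcases hsylow 2 Nat.prime_two hp2.symm with h | h
    · exact absurd (hN2.isCyclic_of_dvd_orderOf Nat.prime_two h) hNc
    · exact ⟨_, fitsRow_kleinByCyclic_of_not_isCyclic hgen ht hp2 hN2 hNc h⟩
  push Not at hA
  have hG : IsCyclic (commutator G) := by
    apply isCyclic_commutator_of_normal_isPGroup_isCyclic
    intro r hr N hN hNr
    by_cases hrp : r = p
    · subst hrp
      rw [hcore N hN hNr]; infer_instance
    · by_cases hr2 : r = 2
      · subst hr2
        exact hA N (Ne.symm hrp) hN hNr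
      · exact hcyc r hr hrp hr2 N hNr
  have hwcomm : faceRotation x t ∈ commutator G := by
    have e : faceRotation x t = ⁅t, x⁆ := by
      rw [commutatorElement_def, hti, faceRotation]; group
    rw [e, commutator_def]
    exact commutator_mem_commutator (mem_top _) (mem_top _)
  have hinvz := fun z => conj_eq_inv_of_mem_zpowers_faceRotation (x := x) (z := z) htt
  have htw : t ∉ zpowers (faceRotation x t) := notMem_zpowers_faceRotation htt ht1
  have hxt := conj_eq_mul_faceRotation (x := x) htt
  have hcard := card_dihedral (x := x) ht
  have hpar := not_pow_mem_dihedral (x := x) htt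
  have hquot : ∀ {N : Subgroup G} [N.Normal], faceRotation x t ∈ N → ∀ a b : G, ⁅a, b⁆ ∈ N :=
    fun hw => commutatorElement_mem_of_faceRotation_mem hgen htt hw
  set w := faceRotation x t with hw
  obtain ⟨k, hk⟩ := (isCyclic_iff_exists_zpowers_eq_top (α := commutator G)).1 hG
  have hnormal : ∀ z ∈ zpowers w, (zpowers z).Normal := by
    intro z hz
    have hkgen : ∀ v ∈ commutator G, v ∈ zpowers (k : G) := by
      intro v hv
      have : (⟨v, hv⟩ : commutator G) ∈ zpowers k := by rw [hk]; trivial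
      obtain ⟨i, hi⟩ := this
      exact ⟨i, by simpa using congrArg Subtype.val hi⟩
    have hzk : z ∈ zpowers (k : G) := hkgen z ((zpowers_le.2 hwcomm) hz)
    refine ⟨?_⟩
    rintro _ ⟨i, rfl⟩ s
    simp only
    rw [← conj_zpow]
    refine zpow_mem (conj_mem_zpowers_of_mem hzk (hkgen _ ?_)) i
    exact (inferInstance : (commutator G).Normal).conj_mem _ k.2 s
  have hwn := hnormal w (mem_zpowers w)
  have hpw : ¬ p ∣ orderOf w := by
    intro h
    obtain ⟨v, hv, hvo⟩ := exists_mem_zpowers_orderOf_eq h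
    have h1 := hcore _ (hnormal v hv) (IsPGroup.of_card (n := 1) (by
      rw [Nat.card_zpowers, hvo, pow_one]))
    rw [zpowers_eq_bot] at h1
    rw [h1, orderOf_one] at hvo
    exact hp.one_lt.ne hvo
  have hodd : Odd (orderOf w) := by
    rw [← Nat.not_even_iff_odd]
    intro heven
    have hp2 : p ≠ 2 := by rintro rfl; exact hpw heven.two_dvd
    rcases hsylow 2 Nat.prime_two hp2.symm with h | h
    · -- a Klein four-group in a cyclic Sylow `2`-subgroup
      obtain ⟨v, hv, hvo⟩ := exists_mem_zpowers_orderOf_eq heven.two_dvd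
      have := hnormal v hv
      have h1 : IsPGroup 2 (zpowers v) := IsPGroup.of_card (n := 1) (by
        rw [Nat.card_zpowers, hvo, pow_one])
      have h2 : IsPGroup 2 (zpowers t) := IsPGroup.of_card (n := 1) (by
        rw [Nat.card_zpowers, ht, pow_one])
      have h3 := (h1.to_sup_of_normal_left h2).isCyclic_of_dvd_orderOf Nat.prime_two h
      have h4 := Subgroup.mem_zpowers_of_orderOf_eq h3 (mem_sup_left (mem_zpowers v))
        (mem_sup_right (mem_zpowers t)) (ht.trans hvo.symm)
      exact htw ((zpowers_le.2 hv) h4)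
    · have hDn : (zpowers w ⊔ zpowers t).Normal :=
        normal_of_commutatorElement_mem (hquot (mem_zpowers w)) le_sup_left
      have hDo := odd_index_of_pow_factorization_dvd_card (hcard ▸ h)
      exact hpar (hwn.conj_mem w (mem_zpowers w) x) heven hDo
        ((zpowers w ⊔ zpowers t).pow_index_mem x)
  -- a square root `v` of `w` in `⟨w⟩` turns `x` into an element centralizing `t`
  obtain ⟨n, hn⟩ := hodd
  set v := w ^ (n + 1) with hv
  have hvw : v * v = w := by
    rw [hv, ← pow_add, show n + 1 + (n + 1) = orderOf w + 1 by omega, pow_succ,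
      pow_orderOf_eq_one, one_mul]
  have hvmem : v ∈ zpowers w := npow_mem_zpowers w _
  have htv : t * v * t⁻¹ = v⁻¹ := hinvz v hvmem
  have hzv : zpowers v⁻¹ = zpowers w := by
    rw [zpowers_inv]
    refine le_antisymm (zpowers_le.2 hvmem) (zpowers_le.2 ?_)
    exact hvw ▸ mul_mem (mem_zpowers v) (mem_zpowers v)
  have hov : orderOf v⁻¹ = orderOf w := by
    rw [← Nat.card_zpowers, hzv, Nat.card_zpowers]
  have hlt : Commute (v * x) t := by
    have : (v * x) * t * (v * x)⁻¹ = t := by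
      calc (v * x) * t * (v * x)⁻¹ = v * (x * t * x⁻¹) * v⁻¹ := by group
        _ = v * (t * v * t⁻¹) * t * v * v⁻¹ := by rw [hxt, ← hvw]; group
        _ = t := by rw [htv]; group
    rwa [mul_inv_eq_iff_eq_mul] at this
  have hxg : x = v⁻¹ * (v * x) := by group
  have hcent : ∀ z ∈ zpowers w, Commute z t → z = 1 := by
    intro z hz hzt
    have h1 := centOrder_of_conj_eq_inv (hinvz z hz) (Odd.of_dvd_nat ⟨n, hn⟩
      (orderOf_dvd_of_mem_zpowers hz))
    rwa [centOrder_of_commute hzt, orderOf_eq_one_iff] at h1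
  have hlcent : ∀ z ∈ zpowers (v * x), Commute z t := by
    rintro _ ⟨i, rfl⟩; exact hlt.zpow_left i
  have hgn : (zpowers v⁻¹).Normal := hzv ▸ hwn
  rw [hxg]
  refine exists_fitsRow_of_mul (by rw [← hxg]; exact hgen) ht ?_ hlt ?_ ?_ (hov ▸ hpw) ?_
  · rw [← conj_inv, htv]
  · rw [hov]; exact ⟨n, hn⟩
  · -- a common prime divisor would give a noncyclic subgroup of order `r ^ 2`
    rw [hov]
    refine Nat.coprime_of_dvd fun r hr h1 h2 => ?_
    obtain ⟨c, hc, hco⟩ := exists_mem_zpowers_orderOf_eq h1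
    obtain ⟨d, hd, hdo⟩ := exists_mem_zpowers_orderOf_eq h2
    have hrp : r ≠ p := by rintro rfl; exact hpw h1
    have hr2 : r ≠ 2 := by
      rintro rfl
      omega
    have := hnormal c hc
    have e1 : IsPGroup r (zpowers c) := IsPGroup.of_card (n := 1) (by
      rw [Nat.card_zpowers, hco, pow_one])
    have e2 : IsPGroup r (zpowers d) := IsPGroup.of_card (n := 1) (by
      rw [Nat.card_zpowers, hdo, pow_one])
    have e3 := hcyc r hr hrp hr2 _ (e1.to_sup_of_normal_left e2)
    have e4 := Subgroup.mem_zpowers_of_orderOf_eq e3 (mem_sup_left (mem_zpowers c))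
      (mem_sup_right (mem_zpowers d)) (hdo.trans hco.symm)
    have e5 := hcent d ((zpowers_le.2 hc) e4) (hlcent d hd)
    rw [e5, orderOf_one] at hdo
    exact hr.one_lt.ne hdo
  · intro hp2
    have hxi := hindex hp2 ⟨n, hn⟩
    have hNn : (zpowers v⁻¹ ⊔ zpowers (v * x)).Normal :=
      normal_of_commutatorElement_mem (A := zpowers w) (hquot (mem_zpowers w)) (hzv ▸ le_sup_left)
    have hxN : zpowers x ≤ zpowers v⁻¹ ⊔ zpowers (v * x) := by
      rw [zpowers_le]
      have := mul_mem (mem_sup_left (T := zpowers (v * x)) (mem_zpowers v⁻¹))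
        (mem_sup_right (S := zpowers v⁻¹) (mem_zpowers (v * x)))
      rwa [← hxg] at this
    obtain ⟨m, hm⟩ := hxi.of_dvd_nat (index_dvd_of_le hxN)
    have htN := (zpowers v⁻¹ ⊔ zpowers (v * x)).pow_index_mem t
    rw [hm, pow_succ, pow_mul, pow_two, htt, one_pow, one_mul] at htN
    obtain ⟨y, hy, z, hz, hyz⟩ := mem_sup_of_normal_left.1 htN
    have hy1 : y = 1 := by
      refine hcent y (hzv ▸ hy) ?_
      have : y = t * z⁻¹ := eq_mul_inv_of_mul_eq hyz
      rw [this]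
      exact (Commute.refl t).mul_left (hlcent z hz).inv_left
    rw [hy1, one_mul] at hyz
    exact hyz ▸ hz

end SolvableClassification

/-! ### From the Euler characteristic to the quotient by `O_p` -/

section Quotient

open Subgroup

variable {X : Type u} [Group X] {x y : X}

theorem IsRotaryPair.map {G : Type*} [Group G] (h : IsRotaryPair x y) (π : X →* G)
    (hπ : Function.Surjective π) (hab : ¬ ∀ s t : G, s * t = t * s) :
    IsRotaryPair (π x) (π y) := by
  have hcl : closure {π x, π y} = ⊤ := by
    rw [← Set.image_pair, ← MonoidHom.map_closure, h.closure_eq, ← MonoidHom.range_eq_map,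
      MonoidHom.range_eq_top.2 hπ]
  refine ⟨orderOf_eq_prime ?_ ?_, hcl⟩
  · rw [pow_two, ← map_mul, h.mul_self, map_one]
  · -- a group generated by the image of `x` alone is abelian
    intro h1
    apply hab
    rw [h1] at hcl
    have hz : ∀ s : G, s ∈ zpowers (π x) := by
      intro s
      have : closure {π x, 1} ≤ zpowers (π x) := by
        rw [closure_le]
        rintro z (rfl | rfl)
        · exact mem_zpowers _
        · exact one_mem _
      exact this (hcl ▸ mem_top s)
    intro s t
    obtain ⟨i, rfl⟩ := hz s
    obtain ⟨j, rfl⟩ := hz t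
    exact ((Commute.refl (π x)).zpow_left i).zpow_right j

theorem orderOf_dvd_mul_card_ker {G : Type*} [Group G] (π : X →* G) (z : X) :
    orderOf z ∣ orderOf (π z) * Nat.card π.ker := by
  rw [orderOf_dvd_iff_pow_eq_one, pow_mul]
  have h1 : z ^ orderOf (π z) ∈ π.ker := by
    rw [MonoidHom.mem_ker, map_pow, pow_orderOf_eq_one]
  exact orderOf_dvd_iff_pow_eq_one.1 (Subgroup.orderOf_dvd_natCard _ h1)

variable [Finite X]

/-- For a prime `r ≠ p`, one of the numbers of vertices, edges and faces is prime to `r`, so that a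
vertex, edge or face stabilizer contains a Sylow `r`-subgroup. -/
theorem pow_dvd_orderOf_of_eulerChar {p n : ℕ} (hp : p.Prime) (h : IsRotaryPair x y)
    (hχ : (biRotaryMap x y h).eulerChar = -(p : ℤ) ^ n) {r a : ℕ} (hr : r.Prime) (hrp : r ≠ p)
    (ha : r ^ a ∣ Nat.card X) :
    r ^ a ∣ orderOf x ∨ r ^ a ∣ 2 * orderOf (faceRotation x y) := by
  obtain ⟨V, E, F, hV, hE, hF, he⟩ := exists_eulerChar_eq h
  have key : ∀ {A k : ℕ}, A * k = Nat.card X → ¬ r ∣ A → r ^ a ∣ k := by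
    intro A k hA hrA
    refine Nat.Coprime.dvd_of_dvd_mul_left ?_ (hA ▸ ha : r ^ a ∣ A * k)
    exact Nat.Coprime.pow_left _ ((Nat.Prime.coprime_iff_not_dvd hr).2 hrA)
  by_cases h1 : r ∣ V
  · by_cases h2 : r ∣ E
    · by_cases h3 : r ∣ F
      · exfalso
        have h4 : (r : ℤ) ∣ -(p : ℤ) ^ n := by
          rw [← hχ, he]
          exact dvd_add (dvd_sub (Int.natCast_dvd_natCast.2 h1) (Int.natCast_dvd_natCast.2 h2))
            (Int.natCast_dvd_natCast.2 h3)
        rw [dvd_neg] at h4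
        have h5 : r ∣ p ^ n := by exact_mod_cast h4
        exact hrp ((Nat.prime_dvd_prime_iff_eq hr hp).1 (hr.dvd_of_dvd_pow h5))
      · exact Or.inr (key hF h3)
    · exact Or.inr ((key hE h2).mul_right _)
  · exact Or.inl (key hV h1)

/-- If `p` and the face length halved are odd then `V = E - F + χ` is odd. -/
theorem odd_index_zpowers_of_eulerChar {p n : ℕ} (hp : Odd p) (h : IsRotaryPair x y)
    (hχ : (biRotaryMap x y h).eulerChar = -(p : ℤ) ^ n)
    (hw : Odd (orderOf (faceRotation x y))) : Odd (zpowers x).index := by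
  obtain ⟨V, E, F, hV, hE, hF, he⟩ := exists_eulerChar_eq h
  have hi : (zpowers x).index = V := by
    have h1 := (zpowers x).card_mul_index
    rw [Nat.card_zpowers, ← hV, mul_comm] at h1
    exact Nat.eq_of_mul_eq_mul_right (orderOf_pos x) h1
  rw [hi]
  obtain ⟨j, hj⟩ := hw
  have hEF : E = F * (2 * j + 1) := by rw [← hj]; nlinarith
  obtain ⟨m, hm⟩ := hp.pow (n := n)
  have hpn : (p : ℤ) ^ n = 2 * m + 1 := by exact_mod_cast hm
  rw [hχ, hEF, hpn] at he
  rw [← Int.odd_coe_nat]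
  refine ⟨F * j - m - 1, ?_⟩
  push_cast at he
  linarith

/-- The Euler characteristic of `Map(X, x, y)` restricts which element orders carry the full
`r`-part of `|X|`; this passes to the quotient by `O_p(X)`, up to powers of `p`. -/
theorem exists_quotientInRow {p n : ℕ} (h : IsRotaryPair x y) (hs : IsSolvableCase p n x y h) :
    ∃ row : SolvableRow, QuotientInRow p x y row := by
  obtain ⟨hp, -, hχ, hab, hsol⟩ := hs
  let π := QuotientGroup.mk' (pCore p X)
  have hπ : Function.Surjective π := QuotientGroup.mk'_surjective _
  have hker : π.ker = pCore p X := QuotientGroup.ker_mk' _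
  have h' : IsRotaryPair (π x) (π y) := h.map π hπ hab
  have : Fact p.Prime := ⟨hp⟩
  obtain ⟨s, hs⟩ := IsPGroup.iff_card.1 (isPGroup_pCore (X := X) p)
  have hcop : ∀ {r a : ℕ}, r.Prime → r ≠ p → (r ^ a).Coprime (p ^ s) := fun hr hrp =>
    Nat.Coprime.pow _ _ ((Nat.coprime_primes hr hp).2 hrp)
  have hdvd : ∀ z : X, orderOf z ∣ orderOf (π z) * p ^ s := fun z => by
    have := orderOf_dvd_mul_card_ker π z
    rwa [hker, hs] at this
  have hw : π (faceRotation x y) = faceRotation (π x) (π y) := by simp [faceRotation]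
  obtain ⟨row, a, b, H, hH, hrow⟩ := exists_fitsRow (G := X ⧸ pCore p X) hp h'.closure_eq
    h'.orderOf_eq eq_bot_of_isPGroup_quotient_pCore (by
      intro r hr hrp
      have h1 : r ^ (Nat.card (X ⧸ pCore p X)).factorization r ∣ Nat.card X :=
        (Nat.ordProj_dvd _ r).trans (Subgroup.card_quotient_dvd_card _)
      rcases pow_dvd_orderOf_of_eulerChar hp h hχ hr hrp h1 with h2 | h2
      · exact Or.inl ((hcop hr hrp).dvd_of_dvd_mul_right (h2.trans (hdvd x)))
      · right
        refine (hcop hr hrp).dvd_of_dvd_mul_right (h2.trans ?_)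
        rw [← hw, mul_assoc]
        exact mul_dvd_mul_left 2 (hdvd _)) (by
      intro hp2 hodd
      have hpo : Odd p := hp.odd_of_ne_two hp2
      have h1 := odd_index_zpowers_of_eulerChar hpo h hχ
        ((hodd.mul (hpo.pow (n := s))).of_dvd_nat (hw ▸ hdvd _))
      refine h1.of_dvd_nat ?_
      have h2 := index_map_dvd (zpowers x) hπ
      rwa [MonoidHom.map_zpowers] at h2)
  exact ⟨row, h', a, b, H, _, _, hH, biRotaryMap_hasType h', hrow⟩

end Quotient

/-! ### Sums over cosets of cyclic groups -/

section CyclicSums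

variable {X M : Type*} [Group X] [AddCommMonoid M]

theorem sum_range_orderOf_mul_pow (f : X → M) (g : X) {w v : X} (hv : v ∈ Subgroup.zpowers w)
    [Finite X] : ∑ j ∈ Finset.range (orderOf w), f (g * v * w ^ j) =
      ∑ j ∈ Finset.range (orderOf w), f (g * w ^ j) := by
  have step : ∀ g : X, ∑ j ∈ Finset.range (orderOf w), f (g * w * w ^ j) =
      ∑ j ∈ Finset.range (orderOf w), f (g * w ^ j) := by
    intro g
    obtain ⟨m, hm⟩ := Nat.exists_eq_succ_of_ne_zero (orderOf_pos w).ne'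
    have hwm : w * w ^ m = 1 := by
      rw [← pow_succ', ← Nat.succ_eq_add_one, ← hm, pow_orderOf_eq_one]
    rw [hm, Nat.succ_eq_add_one, Finset.sum_range_succ, Finset.sum_range_succ']
    simp only [mul_assoc, hwm, pow_zero, mul_one, pow_succ']
  rw [← mem_powers_iff_mem_zpowers] at hv
  obtain ⟨n, rfl⟩ := hv
  simp only
  induction n generalizing g with
  | zero => simp
  | succ n ih => rw [pow_succ, ← mul_assoc, step, ih]

theorem sum_range_orderOf_mul_inv_pow (f : X → M) (g : X) (w : X) [Finite X] :
    ∑ j ∈ Finset.range (orderOf w), f (g * w⁻¹ ^ j) =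
      ∑ j ∈ Finset.range (orderOf w), f (g * w ^ j) := by
  rw [← sum_range_orderOf_mul_pow f g (Subgroup.mem_zpowers w), ← Finset.sum_range_reflect]
  refine Finset.sum_congr rfl fun j hj => ?_
  have hj := Finset.mem_range.1 hj
  have e : w ^ (orderOf w - 1 - j) * (w * w ^ j) = 1 := by
    rw [← pow_succ', ← pow_add, show orderOf w - 1 - j + (j + 1) = orderOf w by omega,
      pow_orderOf_eq_one]
  rw [mul_assoc, inv_pow, inv_eq_of_mul_eq_one_right e]

end CyclicSums

/-! ### Voltage assignments -/

section Voltage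

open Subgroup

variable {X : Type*} [Group X] [Finite X]

/-- The voltage assignments `X → K` on the corners of `Map(X, x, y)` that sum to zero around all
vertices and (with signs for the two directions) around all faces form a space of dimension at least
`|X| - V - F`; those that come from a function on the edges form a space of dimension at most `E`.
As `|X| = 2E`, some assignment of the first kind is not of the second if `V + F < E`. -/
theorem exists_voltage (K : Type*) [Field K] {x y : X} (hy : orderOf y = 2) {V E F : ℕ}
    (hV : V * orderOf x = Nat.card X) (hE : E * 2 = Nat.card X)
    (hF : F * (2 * orderOf (faceRotation x y)) = Nat.card X) (hlt : V + F < E) :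
    ∃ φ : X → K, (∀ g, ∑ j ∈ Finset.range (orderOf x), φ (g * x ^ j) = 0) ∧
      (∀ g, ∑ j ∈ Finset.range (orderOf (faceRotation x y)), φ (g * faceRotation x y ^ j * y) =
        ∑ j ∈ Finset.range (orderOf (faceRotation x y)), φ (g * faceRotation x y ^ j)) ∧
      ¬ ∃ f : X → K, (∀ g, f (g * y) = f g) ∧ ∀ g, f (g * x) - f g = φ g := by
  have hyy : y * y = 1 := by rw [← pow_two, ← hy, pow_orderOf_eq_one]
  have hD := card_dihedral (x := x) hy
  have hmem := fun z => exists_of_mem_dihedral (x := x) (t := y) (z := z) hyy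
  have hwy := mul_faceRotation_zpow (x := x) hyy
  set w := faceRotation x y with hw
  set D := zpowers w ⊔ zpowers y
  have hfin := Fintype.ofFinite X
  have := Fintype.ofFinite (X ⧸ zpowers x)
  have := Fintype.ofFinite (X ⧸ zpowers y)
  have := Fintype.ofFinite (X ⧸ D)
  have hcard : ∀ {H : Subgroup X} {A : ℕ} [Fintype (X ⧸ H)], A * Nat.card H = Nat.card X →
      Module.finrank K (X ⧸ H → K) = A := by
    intro H A _ hA
    rw [Module.finrank_fintype_fun_eq_card, ← Nat.card_eq_fintype_card]
    have h1 := H.index_mul_card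
    rw [← hA] at h1
    exact Nat.eq_of_mul_eq_mul_right Nat.card_pos h1
  have hcx := hcard (H := zpowers x) (A := V) (by rw [Nat.card_zpowers, hV])
  have hcy := hcard (H := zpowers y) (A := E) (by rw [Nat.card_zpowers, hy, hE])
  have hcD := hcard (H := D) (A := F) (by rw [hD, hF])
  let L : (X → K) →ₗ[K] (X ⧸ zpowers x → K) × (X ⧸ D → K) :=
    { toFun := fun φ => (fun c => ∑ j ∈ Finset.range (orderOf x), φ (c.out * x ^ j),
        fun c => ∑ j ∈ Finset.range (orderOf w), φ (c.out * w ^ j * y) -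
          ∑ j ∈ Finset.range (orderOf w), φ (c.out * w ^ j))
      map_add' := fun φ ψ => by
        ext c <;> simp [Finset.sum_add_distrib]
        ring
      map_smul' := fun a φ => by
        ext c <;> simp [Finset.mul_sum, mul_sub] }
  let δ : (X ⧸ zpowers y → K) →ₗ[K] (X → K) :=
    { toFun := fun f g => f (g * x : X) - f (g : X)
      map_add' := fun f f' => by ext g; simp; ring
      map_smul' := fun a f => by ext g; simp [mul_sub] }
  have hker : ¬ LinearMap.ker L ≤ LinearMap.range δ := by
    intro hle
    have h1 := Submodule.finrank_mono hle
    have h2 := LinearMap.finrank_range_add_finrank_ker L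
    have h3 := Submodule.finrank_le (LinearMap.range L)
    have h4 := LinearMap.finrank_range_le δ
    rw [Module.finrank_prod, hcx, hcD] at h3
    rw [hcy] at h4
    rw [Module.finrank_fintype_fun_eq_card, ← Nat.card_eq_fintype_card] at h2
    omega
  obtain ⟨φ, hφ, hφδ⟩ := SetLike.not_le_iff_exists.1 hker
  have hφ := LinearMap.mem_ker.1 hφ
  have hφ1 : ∀ c : X ⧸ zpowers x, ∑ j ∈ Finset.range (orderOf x), φ (c.out * x ^ j) = 0 :=
    fun c => congrFun (congrArg Prod.fst hφ) c
  have hφ2 : ∀ c : X ⧸ D, ∑ j ∈ Finset.range (orderOf w), φ (c.out * w ^ j * y) =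
      ∑ j ∈ Finset.range (orderOf w), φ (c.out * w ^ j) :=
    fun c => sub_eq_zero.1 (congrFun (congrArg Prod.snd hφ) c)
  refine ⟨φ, fun g => ?_, fun g => ?_, ?_⟩
  · have h1 := hφ1 (g : X ⧸ zpowers x)
    obtain ⟨u, hu⟩ := QuotientGroup.mk_out_eq_mul (zpowers x) g
    rw [hu, sum_range_orderOf_mul_pow φ g u.2] at h1
    exact h1
  · have h1 := hφ2 (g : X ⧸ D)
    obtain ⟨⟨u, huD⟩, hu⟩ := QuotientGroup.mk_out_eq_mul D g
    simp only at hu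
    rw [hu] at h1
    obtain ⟨i, rfl | rfl⟩ := hmem u huD
    · rw [sum_range_orderOf_mul_pow (fun z => φ (z * y)) g (zpow_mem (mem_zpowers w) i),
        sum_range_orderOf_mul_pow φ g (zpow_mem (mem_zpowers w) i)] at h1
      exact h1
    · -- moving `y` past the powers of `w` inverts them, and exchanges the two sides
      have hyw : ∀ j : ℕ, y * w ^ j = w⁻¹ ^ j * y := fun j => by
        have := hwy j
        rwa [zpow_natCast, zpow_neg, zpow_natCast, ← inv_pow] at this
      have e1 : ∑ j ∈ Finset.range (orderOf w), φ (g * (w ^ i * y) * w ^ j * y) =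
          ∑ j ∈ Finset.range (orderOf w), φ (g * w ^ j) := by
        rw [← sum_range_orderOf_mul_pow φ g (zpow_mem (mem_zpowers w) i),
          ← sum_range_orderOf_mul_inv_pow]
        refine Finset.sum_congr rfl fun j _ => ?_
        congr 1
        rw [mul_assoc g (w ^ i * y), mul_assoc (w ^ i) y, hyw]
        simp only [mul_assoc, hyy, mul_one]
      have e2 : ∑ j ∈ Finset.range (orderOf w), φ (g * (w ^ i * y) * w ^ j) =
          ∑ j ∈ Finset.range (orderOf w), φ (g * w ^ j * y) := by
        rw [← sum_range_orderOf_mul_pow (fun z => φ (z * y)) g (zpow_mem (mem_zpowers w) i),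
          ← sum_range_orderOf_mul_inv_pow (fun z => φ (z * y))]
        refine Finset.sum_congr rfl fun j _ => ?_
        congr 1
        rw [mul_assoc g (w ^ i * y), mul_assoc (w ^ i) y, hyw]
        simp only [mul_assoc]
      rw [e1, e2] at h1
      exact h1.symm
  · rintro ⟨f, hfy, hfx⟩
    apply hφδ
    have hq : ∀ a b : X, (QuotientGroup.leftRel (zpowers y)) a b → f a = f b := by
      intro a b hab
      have hab := QuotientGroup.leftRel_apply.1 hab
      have e : b = a * (a⁻¹ * b) := by group
      rcases eq_one_or_eq_of_mem_zpowers hyy hab with h | h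
      · rw [e, h, mul_one]
      · rw [e, h, hfy]
    exact ⟨fun c => Quotient.lift f hq c, funext fun g => hfx g⟩

end Voltage

/-! ### Unramified coverings -/

section Covering

open Subgroup

variable {X : Type u} [Group X]

/-- Right translation of functions on a group. -/
def rightTranslation (X M : Type*) [Group X] [Group M] : X →* MulAut (X → M) where
  toFun h :=
    { toFun := fun f g => f (g * h)
      invFun := fun f g => f (g * h⁻¹)
      left_inv := fun f => by ext g; simp
      right_inv := fun f => by ext g; simp
      map_mul' := fun _ _ => rfl }
  map_one' := by ext f g; simp
  map_mul' h k := by ext f g; simp [mul_assoc]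

theorem rightTranslation_apply {M : Type*} [Group M] (h : X) (f : X → M) (g : X) :
    rightTranslation X M h f g = f (g * h) := rfl

theorem semidirectProduct_pow_left {M : Type*} [CommGroup M]
    (z : (X → M) ⋊[rightTranslation X M] X) (n : ℕ) (g : X) :
    (z ^ n).left g = ∏ j ∈ Finset.range n, z.left (g * z.right ^ j) := by
  have hr : ∀ n : ℕ, (z ^ n).right = z.right ^ n := fun n => by
    simpa using map_pow (SemidirectProduct.rightHom (φ := rightTranslation X M)) z n
  induction n with
  | zero => simp
  | succ n ih =>
    rw [pow_succ, SemidirectProduct.mul_left, Pi.mul_apply, rightTranslation_apply, ih,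
      Finset.prod_range_succ, hr]

/-- A bi-rotary map of negative Euler characteristic has a nontrivial unramified covering by
a bi-rotary map, with covering group a `p`-group. In `𝔽_p ≀ X`, take `x' = (φ, x)` and
`y' = (0, y)`, for a voltage assignment `φ`: its vanishing sums around vertices and faces say that
the orders of `x'` and of the face rotation do not grow, and the kernel of `⟨x', y'⟩ → X` is trivial
only if `φ` comes from a function on the edges. -/
theorem exists_unramified_covering [Finite X] {x y : X} (h : IsRotaryPair x y) (p : ℕ)
    [Fact p.Prime] {V E F : ℕ}
    (hV : V * orderOf x = Nat.card X) (hE : E * 2 = Nat.card X)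
    (hF : F * (2 * orderOf (faceRotation x y)) = Nat.card X) (hlt : V + F < E) :
    ∃ (X' : Type u) (_ : Group X') (_ : Finite X') (x' y' : X') (_ : IsRotaryPair x' y')
      (π : X' →* X), Function.Surjective π ∧ π x' = x ∧ π y' = y ∧ IsPGroup p π.ker ∧
      1 < Nat.card π.ker ∧ orderOf x' = orderOf x ∧
      orderOf (faceRotation x' y') = orderOf (faceRotation x y) := by
  obtain ⟨φ, hφ1, hφ2, hφ3⟩ := exists_voltage (ZMod p) h.orderOf_eq hV hE hF hlt
  let M := Multiplicative (ZMod p)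
  let W := (X → M) ⋊[rightTranslation X M] X
  let r : W →* X := SemidirectProduct.rightHom
  let a : W := ⟨fun g => Multiplicative.ofAdd (φ g), x⟩
  let b : W := ⟨1, y⟩
  have hfinW : Finite W := Finite.of_equiv _ SemidirectProduct.equivProd.symm
  have hbb : b * b = 1 := by
    apply SemidirectProduct.ext
    · funext g
      change (1 : M) * 1 = 1
      rw [mul_one]
    · exact h.mul_self
  have hb : orderOf b = 2 := by
    refine orderOf_eq_prime (by rw [pow_two, hbb]) fun hb1 => h.ne_one ?_
    exact congrArg SemidirectProduct.right hb1
  have ha : orderOf a = orderOf x := by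
    refine Nat.dvd_antisymm (orderOf_dvd_of_pow_eq_one ?_) (orderOf_map_dvd r a)
    apply SemidirectProduct.ext
    · funext g
      rw [semidirectProduct_pow_left]
      change ∏ j ∈ Finset.range (orderOf x), Multiplicative.ofAdd (φ (g * x ^ j)) = 1
      rw [← ofAdd_sum, hφ1, ofAdd_zero]
    · change r (a ^ orderOf x) = 1
      rw [map_pow]; exact pow_orderOf_eq_one x
  have hw : orderOf (faceRotation a b) = orderOf (faceRotation x y) := by
    have hr : r (faceRotation a b) = faceRotation x y := by
      simp only [faceRotation, map_mul, map_inv]; rfl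
    have hl : ∀ g, (faceRotation a b).left g =
        Multiplicative.ofAdd (φ (g * y) - φ (g * faceRotation x y)) := by
      intro g
      change (1 : M) * (Multiplicative.ofAdd (φ (g * y)) * 1 *
        (Multiplicative.ofAdd (φ (g * y * (x * y) * x⁻¹)))⁻¹) = _
      rw [one_mul, mul_one, ofAdd_sub, div_eq_mul_inv]
      simp only [faceRotation, mul_assoc]
    refine Nat.dvd_antisymm (orderOf_dvd_of_pow_eq_one ?_) (hr ▸ orderOf_map_dvd r _)
    apply SemidirectProduct.ext
    · funext g
      have hr' : (faceRotation a b).right = faceRotation x y := hr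
      rw [semidirectProduct_pow_left]
      simp only [hl, hr']
      rw [← ofAdd_sum, Finset.sum_sub_distrib, hφ2]
      have := sum_range_orderOf_mul_pow φ g (mem_zpowers (faceRotation x y))
      rw [SemidirectProduct.one_left, Pi.one_apply, ← ofAdd_zero, sub_eq_zero.2]
      rw [← this]
      refine Finset.sum_congr rfl fun j _ => ?_
      rw [mul_assoc, mul_assoc, ← pow_succ, ← pow_succ']
    · change r (faceRotation a b ^ _) = 1
      rw [map_pow, hr]; exact pow_orderOf_eq_one _
  let S : Subgroup W := closure {a, b}
  have haS : a ∈ S := subset_closure (by simp)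
  have hbS : b ∈ S := subset_closure (by simp)
  let x' : S := ⟨a, haS⟩
  let y' : S := ⟨b, hbS⟩
  have hgen : closure {x', y'} = ⊤ := by
    have := closure_closure_coe_preimage (k := {a, b})
    convert this using 2
    ext ⟨z, hz⟩
    simp [x', y']
  have h' : IsRotaryPair x' y' := ⟨by rw [Subgroup.orderOf_mk, hb], hgen⟩
  let π : S →* X := r.comp S.subtype
  have hπ : Function.Surjective π := by
    rw [← MonoidHom.range_eq_top, eq_top_iff, ← h.closure_eq, closure_le]
    rintro z (rfl | rfl)
    · exact ⟨x', rfl⟩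
    · exact ⟨y', rfl⟩
  refine ⟨S, inferInstance, inferInstance, x', y', h', π, hπ, rfl, rfl, ?_, ?_, ?_, ?_⟩
  · rintro ⟨⟨z, hz⟩, hzk⟩
    refine ⟨1, ?_⟩
    have hz1 : z.right = 1 := hzk
    apply Subtype.ext
    apply Subtype.ext
    apply SemidirectProduct.ext
    · funext g
      change (z ^ p ^ 1).left g = 1
      rw [semidirectProduct_pow_left]
      simp only [hz1, one_pow, mul_one, Finset.prod_const, Finset.card_range, pow_one]
      rw [← ofAdd_toAdd (z.left g), ← ofAdd_nsmul]
      simp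
    · change (z ^ p ^ 1).right = 1
      have : r (z ^ p ^ 1) = 1 := by rw [map_pow, show r z = 1 from hz1, one_pow]
      exact this
  · by_contra hcard
    apply hφ3
    have hk1 : Nat.card π.ker = 1 := le_antisymm (not_lt.1 hcard) Nat.card_pos
    have hinj : Function.Injective π := (MonoidHom.ker_eq_bot_iff π).1 (card_eq_one.1 hk1)
    -- a section of `π` evaluated at `1` is a function with coboundary `φ`
    let e := MulEquiv.ofBijective π ⟨hinj, hπ⟩
    have hex : e x' = x := rfl
    have hey : e y' = y := rfl
    have her : ∀ g, (e.symm g : W).right = g := fun g => e.apply_symm_apply g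
    refine ⟨fun g => Multiplicative.toAdd ((e.symm g : W).left 1), fun g => ?_, fun g => ?_⟩
    · have : e.symm (g * y) = e.symm g * y' := by
        rw [map_mul, ← hey, e.symm_apply_apply]
      simp only [this]
      change Multiplicative.toAdd ((e.symm g : W).left 1 * (1 : M)) = _
      rw [mul_one]
    · have : e.symm (g * x) = e.symm g * x' := by
        rw [map_mul, ← hex, e.symm_apply_apply]
      simp only [this]
      change Multiplicative.toAdd ((e.symm g : W).left 1 *
        Multiplicative.ofAdd (φ (1 * (e.symm g : W).right))) - _ = _
      rw [her, one_mul, toAdd_mul, toAdd_ofAdd, add_sub_cancel_left]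
  · rw [Subgroup.orderOf_mk, ha]
  · rw [← hw]
    exact (Subgroup.orderOf_coe (faceRotation x' y')).symm

end Covering

/-! ### Towers of coverings -/

section Towers

open Subgroup

variable {G : Type u} [Group G] {p n : ℕ} {ρ τ : G}

/-- The pair `(ρ, τ)` of `G` is the image of a rotary pair `(x, y)` under an epimorphism whose
kernel is a `p`-group, where `Map(X, x, y)` has Euler characteristic `-p ^ n`. -/
def HasPCover (p n : ℕ) (ρ τ : G) : Prop :=
  ∃ (X : Type u) (_ : Group X) (_ : Finite X) (x y : X) (h : IsRotaryPair x y) (π : X →* G),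
    Function.Surjective π ∧ π x = ρ ∧ π y = τ ∧ IsPGroup p π.ker ∧
    (biRotaryMap x y h).eulerChar = -(p : ℤ) ^ n

theorem MonoidHom.card_ker_mul_card {X Y : Type*} [Group X] [Group Y] (π : X →* Y)
    (hπ : Function.Surjective π) : Nat.card X = Nat.card π.ker * Nat.card Y := by
  rw [← π.ker.card_mul_index, index_ker, MonoidHom.range_eq_top.2 hπ, card_top]

theorem IsPGroup.ker_comp {X Y Z : Type*} [Group X] [Group Y] [Group Z] {f : X →* Y} {g : Y →* Z}
    (hf : IsPGroup p f.ker) (hg : IsPGroup p g.ker) : IsPGroup p (g.comp f).ker := by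
  rintro ⟨z, hz⟩
  obtain ⟨i, hi⟩ := hg ⟨f z, hz⟩
  have hi : f z ^ p ^ i = 1 := congrArg Subtype.val hi
  obtain ⟨j, hj⟩ := hf ⟨z ^ p ^ i, by rw [MonoidHom.mem_ker, map_pow, hi]⟩
  have hj : (z ^ p ^ i) ^ p ^ j = 1 := congrArg Subtype.val hj
  exact ⟨i + j, Subtype.ext (by rw [pow_add, pow_mul]; exact hj)⟩

/-- Unramified coverings multiply the Euler characteristic by the order of the covering group. -/
theorem HasPCover.exists_lt [hp : Fact p.Prime] (h : HasPCover p n ρ τ) :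
    ∃ m, n < m ∧ HasPCover p m ρ τ := by
  obtain ⟨X, _, _, x, y, h, π, hπ, rfl, rfl, hker, hχ⟩ := h
  obtain ⟨V, E, F, hV, hE, hF, he⟩ := exists_eulerChar_eq h
  have hpos : (0 : ℤ) < (p : ℤ) ^ n := pow_pos (by exact_mod_cast hp.out.pos) n
  obtain ⟨X', _, _, x', y', h', π', hπ', rfl, rfl, hker', hk, hx, hw⟩ :=
    exists_unramified_covering h p hV hE hF (by omega)
  obtain ⟨j, hj⟩ := IsPGroup.iff_card.1 hker'
  have hj0 : j ≠ 0 := by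
    rintro rfl
    rw [hj, pow_zero] at hk
    exact lt_irrefl _ hk
  refine ⟨n + j, by omega, X', inferInstance, inferInstance, x', y', h', π.comp π',
    hπ.comp hπ', rfl, rfl, hker'.ker_comp hker, ?_⟩
  obtain ⟨V', E', F', hV', hE', hF', he'⟩ := exists_eulerChar_eq h'
  rw [he', pow_add, ← neg_mul, ← hχ, he]
  have hc := π'.card_ker_mul_card hπ'
  rw [hj] at hc
  have key : ∀ {A A' d : ℕ}, 0 < d → A * d = Nat.card X → A' * d = Nat.card X' →
      A' = p ^ j * A := by
    intro A A' d hd h1 h2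
    apply Nat.eq_of_mul_eq_mul_right hd
    rw [h2, hc, ← h1, mul_assoc]
  rw [hx] at hV'
  rw [hw] at hF'
  rw [key (orderOf_pos _) hV hV', key two_pos hE hE',
    key (mul_pos two_pos (orderOf_pos _)) hF hF']
  push_cast
  ring

theorem HasPCover.exists_ge [Fact p.Prime] (h : HasPCover p n ρ τ) (N : ℕ) :
    ∃ m, N < m ∧ HasPCover p m ρ τ := by
  induction N with
  | zero =>
    obtain ⟨m, hm, h'⟩ := h.exists_lt
    exact ⟨m, by omega, h'⟩
  | succ N ih =>
    obtain ⟨m, hm, h'⟩ := ih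
    obtain ⟨m', hm', h''⟩ := h'.exists_lt
    exact ⟨m', by omega, h''⟩

/-- The subgroup of `Q × G` generated by `(s, ρ)` and `(t, τ)` defines a map whose valency and half
face length are the least common multiples `k` and `q` below; `harith` says that its Euler
characteristic is minus a power of `p`. -/
theorem hasPCover_of_prod [Finite G] {Q : Type u} [Group Q] [Finite Q] [Fact p.Prime]
    (hQ : IsPGroup p Q) (h : IsRotaryPair ρ τ) {s t : Q} (ht : t * t = 1) {k q e : ℕ}
    (hk : (orderOf s).lcm (orderOf ρ) = k)
    (hq : (orderOf (faceRotation s t)).lcm (orderOf (faceRotation ρ τ)) = q)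
    (harith : Nat.card G * (k * q) = Nat.card G * (2 * q + k) + 2 * p ^ e * (k * q)) :
    ∃ n, HasPCover p n ρ τ := by
  let S : Subgroup (Q × G) := closure {(s, ρ), (t, τ)}
  let x : S := ⟨(s, ρ), subset_closure (by simp)⟩
  let y : S := ⟨(t, τ), subset_closure (by simp)⟩
  have hgen : closure {x, y} = ⊤ := by
    have := closure_closure_coe_preimage (k := {((s, ρ) : Q × G), (t, τ)})
    convert this using 2
    ext ⟨z, hz⟩
    simp [x, y]
  have hy : orderOf y = 2 := by
    rw [Subgroup.orderOf_mk, Prod.orderOf_mk, h.orderOf_eq]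
    exact Nat.lcm_eq_right (orderOf_dvd_of_pow_eq_one (by rw [pow_two, ht]))
  have h' : IsRotaryPair x y := ⟨hy, hgen⟩
  let π : S →* G := (MonoidHom.snd Q G).comp S.subtype
  have hπ : Function.Surjective π := by
    rw [← MonoidHom.range_eq_top, eq_top_iff, ← h.closure_eq, closure_le]
    rintro z (rfl | rfl)
    · exact ⟨x, rfl⟩
    · exact ⟨y, rfl⟩
  have hker : IsPGroup p π.ker := by
    rintro ⟨⟨⟨z, g⟩, hz⟩, hg⟩
    obtain ⟨i, hi⟩ := hQ z
    have hg : g = 1 := hg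
    refine ⟨i, Subtype.ext (Subtype.ext (Prod.ext hi ?_))⟩
    change g ^ p ^ i = 1
    rw [hg, one_pow]
  obtain ⟨j, hj⟩ := IsPGroup.iff_card.1 hker
  have hc := π.card_ker_mul_card hπ
  rw [hj] at hc
  have hx : orderOf x = k := by rw [Subgroup.orderOf_mk, Prod.orderOf_mk, hk]
  have hw : orderOf (faceRotation x y) = q := by
    rw [← Subgroup.orderOf_coe]
    change orderOf ((faceRotation s t, faceRotation ρ τ) : Q × G) = q
    rw [Prod.orderOf_mk, hq]
  obtain ⟨V, E, F, hV, hE, hF, he⟩ := exists_eulerChar_eq h'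
  rw [hx] at hV
  rw [hw] at hF
  have hk0 : 0 < k := hx ▸ orderOf_pos x
  have hq0 : 0 < q := hw ▸ orderOf_pos _
  refine ⟨e + j, S, _, inferInstance, x, y, h', π, hπ, rfl, rfl, hker, ?_⟩
  rw [he]
  have hkq : ((2 * (k * q) : ℕ) : ℤ) ≠ 0 := by positivity
  apply mul_left_cancel₀ hkq
  zify at hV hE hF hc harith
  push_cast
  rw [hc] at hV hE hF
  linear_combination 2 * (q : ℤ) * hV - k * q * hE + k * hF - (p : ℤ) ^ j * harith

theorem pCore_eq_ker_of_surjective {X : Type u} [Group X] [Finite G] (π : X →* G)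
    (hπ : Function.Surjective π) (hker : IsPGroup p π.ker) (hG : pCore p G = ⊥) :
    pCore p X = π.ker := by
  refine le_antisymm (sSup_le ?_) (le_pCore inferInstance hker)
  rintro N ⟨hN, hNp⟩
  have h1 := le_pCore (hN.map π hπ) (hNp.map π)
  rw [hG, le_bot_iff] at h1
  exact (map_eq_bot_iff N).1 h1

/-- The exponents `n` for which the row occurs at the prime `p`. -/
def rowExponents (p : ℕ) (row : SolvableRow) : Set ℕ :=
  {n : ℕ | ∃ (X : Type) (_ : Group X) (_ : Finite X) (x y : X) (h : IsRotaryPair x y),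
    IsSolvableCase p n x y h ∧ QuotientInRow p x y row}

/-- A single covering of the pair `(ρ, τ)` with Euler characteristic minus a power of `p` produces
infinitely many exponents `n`. -/
theorem infinite_rowExponents {G : Type} [Group G] [Finite G] {p n : ℕ} [hp : Fact p.Prime]
    {ρ τ : G} (hcov : HasPCover p n ρ τ) (hab : ¬ ∀ s t : G, s * t = t * s)
    (hsol : Group.IsSolvable G) (hG : pCore p G = ⊥) {row : SolvableRow}
    (hrow : ∀ (G' : Type) [Group G'] [Finite G'] (e : G ≃* G'), FitsRow p (e ρ) (e τ) row) :
    (rowExponents p row).Infinite := by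
  rw [Set.infinite_iff_exists_gt]
  intro N
  obtain ⟨m, hNm, X, _, _, x, y, h, π, hπ, rfl, rfl, hker, hχ⟩ := hcov.exists_ge N
  have hc : π.ker = pCore p X := (pCore_eq_ker_of_surjective π hπ hker hG).symm
  let e : G ≃* X ⧸ pCore p X := (QuotientGroup.quotientKerEquivOfSurjective π hπ).symm.trans
    (QuotientGroup.quotientMulEquivOfEq hc)
  have he : ∀ z, e (π z) = z := fun z => by
    have h1 : (QuotientGroup.quotientKerEquivOfSurjective π hπ).symm (π z) = z :=
      (MulEquiv.symm_apply_eq _).2 rfl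
    simp only [e, MulEquiv.trans_apply, h1, QuotientGroup.quotientMulEquivOfEq_mk]
  have hab' : ¬ ∀ s t : X ⧸ pCore p X, s * t = t * s := fun hcomm =>
    hab fun s t => e.injective (by rw [map_mul, map_mul, hcomm])
  have hsol' : Group.IsSolvable (X ⧸ pCore p X) :=
    Group.isSolvable_of_surjective (f := e.toMonoidHom) e.surjective
  have h' := h.map (QuotientGroup.mk' (pCore p X)) (QuotientGroup.mk'_surjective _) hab'
  obtain ⟨a, b, H, hH, hr⟩ := hrow _ e
  rw [he, he] at hr
  exact ⟨m, ⟨X, inferInstance, inferInstance, x, y, h,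
    ⟨hp.out, by omega, hχ, hab', hsol'⟩, h', a, b, H, _, _, hH, biRotaryMap_hasType h', hr⟩, hNm⟩

theorem RotaryFrame.map {G' : Type*} [Group G'] {a c b l t : G} (h : RotaryFrame a c b l t)
    (e : G ≃* G') : RotaryFrame (e a) (e c) (e b) (e l) (e t) := by
  have hz : ∀ {u v : G}, u ∈ zpowers v → e u ∈ zpowers (e v) := by
    rintro u v ⟨i, rfl⟩
    exact ⟨i, (map_zpow e v i).symm⟩
  have ho : ∀ u : G, orderOf (e u) = orderOf u := e.orderOf_eq
  constructor
  · have h1 := congrArg (Subgroup.map e.toMonoidHom) h.closure_eq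
    rw [MonoidHom.map_closure, Set.image_pair,
      Subgroup.map_top_of_surjective _ e.surjective] at h1
    simpa using h1
  · rw [ho, h.orderOf_t]
  · rw [← map_inv, ← map_mul, ← map_mul, h.t_conj_a, map_inv]
  · rw [← map_inv, ← map_mul, ← map_mul, h.t_conj_c, map_inv]
  · exact h.comm_ac.map e
  · exact h.comm_bl.map e
  · exact h.comm_bt.map e
  · exact h.comm_lt.map e
  · exact h.comm_bc.map e
  · rw [← map_inv, ← map_mul, ← map_mul]; exact hz h.b_conj_a
  · rw [← map_inv, ← map_mul, ← map_mul]; exact hz h.l_conj_a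
  · rw [← map_inv, ← map_mul, ← map_mul]; exact hz h.l_conj_c
  · simpa only [ho] using h.orderOf_c
  · simpa only [ho] using h.coprime_a_six
  · simpa only [ho] using h.coprime_b_six
  · simpa only [ho] using h.coprime_ab
  · simpa only [ho] using h.prime_dvd_l
  · simpa only [ho] using h.coprime_cl

theorem RotaryFrame.isRotaryPair {a c b l t : G} (h : RotaryFrame a c b l t) :
    IsRotaryPair (a * c * b * l) t := ⟨h.orderOf_t, h.closure_eq⟩

end Towers

/-! ### Dihedral groups and direct products -/

section SmallGroups

open Subgroup DihedralGroup
open scoped commutatorElement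

theorem Group.isSolvable_of_commute_commutatorElement {G : Type*} [Group G]
    (h : ∀ a b c d : G, Commute ⁅a, b⁆ ⁅c, d⁆) : Group.IsSolvable G := by
  refine ⟨2, ?_⟩
  rw [derivedSeries_succ, derivedSeries_one, commutator_eq_bot_iff_le_centralizer,
    commutator_eq_closure, centralizer_closure]
  rw [closure_le]
  rintro _ ⟨a, b, rfl⟩
  rw [SetLike.mem_coe, mem_centralizer_iff]
  rintro _ ⟨c, d, rfl⟩
  exact h c d a b

instance DihedralGroup.isSolvable (n : ℕ) : Group.IsSolvable (DihedralGroup n) := by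
  have key : ∀ a b : DihedralGroup n, ∃ i, ⁅a, b⁆ = r i := by
    rintro (i | i) (j | j) <;> exact ⟨_, rfl⟩
  refine Group.isSolvable_of_commute_commutatorElement fun a b c d => ?_
  obtain ⟨i, hi⟩ := key a b
  obtain ⟨j, hj⟩ := key c d
  rw [hi, hj, commute_iff_eq, r_mul_r, r_mul_r, add_comm]

theorem DihedralGroup.eq_top_of_mem {n : ℕ} {H : Subgroup (DihedralGroup n)} {i : ZMod n}
    (hr : r 1 ∈ H) (hs : sr i ∈ H) : H = ⊤ := by
  have h1 : ∀ j, r j ∈ H := fun j => by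
    have h2 := H.zpow_mem hr j.cast
    rwa [r_one_zpow, ZMod.intCast_zmod_cast] at h2
  rw [eq_top_iff]
  rintro (j | j) -
  · exact h1 j
  · have h2 := H.mul_mem hs (h1 (j - i))
    rwa [sr_mul_r, add_sub_cancel] at h2

theorem Subgroup.eq_top_of_comap_inl_inr {G K : Type*} [Group G] [Group K] {H : Subgroup (G × K)}
    (h1 : H.comap (MonoidHom.inl G K) = ⊤) (h2 : H.comap (MonoidHom.inr G K) = ⊤) : H = ⊤ := by
  rw [eq_top_iff]
  rintro ⟨g, k⟩ -
  have e : ((g, k) : G × K) = MonoidHom.inl G K g * MonoidHom.inr G K k := by simp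
  rw [e]
  exact H.mul_mem (mem_comap.1 (h1 ▸ mem_top g)) (mem_comap.1 (h2 ▸ mem_top k))

theorem ZMod.eq_top_of_ofAdd_one_mem {n : ℕ} {H : Subgroup (Multiplicative (ZMod n))}
    (h : Multiplicative.ofAdd 1 ∈ H) : H = ⊤ := by
  rw [eq_top_iff]
  intro z _
  have h2 := H.zpow_mem h (Multiplicative.toAdd z).cast
  rw [← ofAdd_zsmul, zsmul_one, ZMod.intCast_zmod_cast] at h2
  exact h2

theorem pCore_eq_bot_iff {p : ℕ} {G : Type u} [Group G] :
    pCore p G = ⊥ ↔ ∀ N : Subgroup G, N.Normal → IsPGroup p N → N = ⊥ := by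
  simp only [pCore, sSup_eq_bot, Set.mem_ofPred_eq, and_imp]

theorem pCore_eq_bot_of_coprime {p : ℕ} {G : Type u} [Group G] [Finite G] [Fact p.Prime]
    (h : ¬ p ∣ Nat.card G) : pCore p G = ⊥ := by
  obtain ⟨j, hj⟩ := IsPGroup.iff_card.1 (isPGroup_pCore (X := G) p)
  rw [← card_eq_one, hj]
  rcases j with _ | j
  · rfl
  · exact absurd ((dvd_pow_self p j.succ_ne_zero).trans (hj ▸ card_subgroup_dvd_card _)) h

theorem pCore_prod_eq_bot {p : ℕ} {G K : Type u} [Group G] [Group K] (hG : pCore p G = ⊥)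
    (hK : pCore p K = ⊥) : pCore p (G × K) = ⊥ := by
  rw [pCore_eq_bot_iff] at *
  intro N hN hp
  have h1 := hG _ (hN.map (MonoidHom.fst G K) Prod.fst_surjective) (hp.map _)
  have h2 := hK _ (hN.map (MonoidHom.snd G K) Prod.snd_surjective) (hp.map _)
  rw [eq_bot_iff]
  intro z hz
  exact Prod.ext (mem_bot.1 (h1 ▸ mem_map_of_mem (MonoidHom.fst G K) hz))
    (mem_bot.1 (h2 ▸ mem_map_of_mem (MonoidHom.snd G K) hz))

theorem pCore_two_dihedralGroup {n : ℕ} (hn : Odd n) (h1 : n ≠ 1) :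
    pCore 2 (DihedralGroup n) = ⊥ := by
  rw [pCore_eq_bot_iff]
  intro N hN hp
  have hr : ∀ i : ZMod n, r i ∈ N → i = 0 := by
    intro i hi
    obtain ⟨k, hk⟩ := hp ⟨r i, hi⟩
    have hk : r i ^ 2 ^ k = 1 := congrArg Subtype.val hk
    rw [r_pow, one_def, r.injEq] at hk
    have hu : IsUnit ((2 ^ k : ℕ) : ZMod n) :=
      (ZMod.isUnit_iff_coprime _ _).2 (Nat.Coprime.pow_left k hn.coprime_two_left)
    exact hu.mul_left_eq_zero.1 hk
  rw [eq_bot_iff]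
  rintro (i | i) hi
  · rw [hr i hi, r_zero]; exact one_mem _
  · -- the commutator of a reflection with a rotation is a nontrivial rotation
    exfalso
    have h2 := N.mul_mem (hN.conj_mem _ hi (r 1)) (N.inv_mem hi)
    simp only [r_mul_sr, sr_mul_sr, inv_r, sr_mul_r, inv_sr] at h2
    have h3 := hr _ h2
    have h4 : ((2 : ℕ) : ZMod n) = 0 := by push_cast; linear_combination h3
    rw [ZMod.natCast_eq_zero_iff, Nat.dvd_prime Nat.prime_two] at h4
    rcases h4 with h4 | h4
    · exact h1 h4
    · rw [h4] at hn; exact absurd hn (by decide)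

end SmallGroups

/-! ### The alternating group of degree four -/

section A4

open scoped commutatorElement

/-- A `3`-cycle of the alternating group of degree `4`. -/
def altThreeCycle : alternatingGroup (Fin 4) :=
  ⟨c[0, 1, 2], Equiv.Perm.mem_alternatingGroup.2 (by decide)⟩

/-- A double transposition. -/
def altDoubleTransposition : alternatingGroup (Fin 4) :=
  ⟨c[0, 1] * c[2, 3], Equiv.Perm.mem_alternatingGroup.2 (by decide)⟩

theorem alt_exists : ∀ g : alternatingGroup (Fin 4), ∃ (i j : Fin 2) (k : Fin 3),
    g = altDoubleTransposition ^ (i : ℕ) *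
      (altThreeCycle * altDoubleTransposition * altThreeCycle⁻¹) ^ (j : ℕ) *
      altThreeCycle ^ (k : ℕ) := by decide

set_option maxRecDepth 40000 in
theorem alt_commutatorElement_mul_self :
    ∀ a b : alternatingGroup (Fin 4), ⁅a, b⁆ * ⁅a, b⁆ = 1 := by decide

set_option maxRecDepth 40000 in
theorem alt_commute_of_mul_self :
    ∀ a b : alternatingGroup (Fin 4), a * a = 1 → b * b = 1 → a * b = b * a := by decide

theorem alternatingGroup_four_isSolvable : Group.IsSolvable (alternatingGroup (Fin 4)) :=
  Group.isSolvable_of_commute_commutatorElement fun a b c d =>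
    alt_commute_of_mul_self _ _ (alt_commutatorElement_mul_self a b)
      (alt_commutatorElement_mul_self c d)

theorem alternatingGroup_four_eq_top {H : Subgroup (alternatingGroup (Fin 4))}
    (hc : altThreeCycle ∈ H) (hd : altDoubleTransposition ∈ H) : H = ⊤ := by
  rw [eq_top_iff]
  intro g _
  obtain ⟨i, j, k, rfl⟩ := alt_exists g
  exact H.mul_mem (H.mul_mem (H.pow_mem hd _)
    (H.pow_mem (H.mul_mem (H.mul_mem hc hd) (H.inv_mem hc)) _)) (H.pow_mem hc _)

end A4

/-! ### A map for each row -/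

section Examples

open Subgroup DihedralGroup Multiplicative

theorem orderOf_ofAdd_one (n : ℕ) : orderOf (ofAdd (1 : ZMod n)) = n := by
  rw [orderOf_ofAdd_eq_addOrderOf, ZMod.addOrderOf_one]

theorem DihedralGroup.not_comm {m : ℕ} (h : (2 : ZMod m) ≠ 0) :
    ¬ ∀ s t : DihedralGroup m, s * t = t * s := by
  intro hc
  have h1 := hc (r 1) (sr 0)
  simp only [r_mul_sr, sr_mul_r, sr.injEq] at h1
  exact h (by linear_combination -h1)

theorem not_comm_prod {G : Type*} [Group G] (K : Type*) [Group K]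
    (h : ¬ ∀ s t : G, s * t = t * s) : ¬ ∀ s t : G × K, s * t = t * s :=
  fun hc => h fun s t => congrArg Prod.fst (hc (s, 1) (t, 1))

theorem orderOf_eq_lcm {G K : Type*} [Monoid G] [Monoid K] {g : G} {k : K} {m n q : ℕ}
    (hg : orderOf g = m) (hk : orderOf k = n) (hq : m.lcm n = q) :
    orderOf ((g, k) : G × K) = q := by rw [Prod.orderOf_mk, hg, hk, hq]

theorem card_dihedralGroup_prod (m : ℕ) (K : Type*) :
    Nat.card (DihedralGroup m × K) = 2 * m * Nat.card K := by
  rw [Nat.card_prod, DihedralGroup.nat_card]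

theorem card_multiplicative_zmod (m : ℕ) : Nat.card (Multiplicative (ZMod m)) = m := by
  rw [Nat.card_congr toAdd, Nat.card_zmod]

theorem isPGroup_dihedralGroup_four : IsPGroup 2 (DihedralGroup 4) :=
  IsPGroup.of_card (n := 3) (by rw [DihedralGroup.nat_card]; rfl)

theorem isPGroup_zmod_two : IsPGroup 2 (Multiplicative (ZMod 2)) :=
  IsPGroup.of_card (n := 1) (by rw [card_multiplicative_zmod]; rfl)

theorem orderOf_r_of_coprime {n : ℕ} [NeZero n] {i : ZMod n} (h : Nat.gcd n i.val = 1) :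
    orderOf (r i) = n := by rw [orderOf_r, h, Nat.div_one]

theorem not_mem_zpowers_of_mul_self {G : Type*} [Group G] {l t : G} (hl : l * l = 1)
    (h1 : t ≠ 1) (h2 : t ≠ l) : t ∉ zpowers l :=
  fun h => (eq_one_or_eq_of_mem_zpowers hl h).elim h1 h2

theorem prime_dvd_of_orderOf_eq_two {G : Type*} [Group G] {l : G} (hl : orderOf l = 2) (q : ℕ)
    (hq : q.Prime) (h : q ∣ orderOf l) : q = 2 ∨ q = 3 := by
  rw [hl, Nat.prime_dvd_prime_iff_eq hq Nat.prime_two] at h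
  exact Or.inl h

theorem conj_mem_zpowers_of_eq_inv {G : Type*} [Group G] {l a : G} (h : l * a * l⁻¹ = a⁻¹) :
    l * a * l⁻¹ ∈ zpowers a := by
  rw [h]; exact inv_mem (mem_zpowers a)

theorem conj_mem_zpowers_of_eq {G : Type*} [Group G] {l a : G} (h : l * a * l⁻¹ = a) :
    l * a * l⁻¹ ∈ zpowers a := by
  rw [h]; exact mem_zpowers a

/-- The pair covers itself, if its own map has Euler characteristic minus a power of `p`. -/
theorem hasPCover_self {G : Type u} [Group G] [Finite G] {p : ℕ} [Fact p.Prime] {ρ τ : G}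
    (h : IsRotaryPair ρ τ) {k q e : ℕ} (hk : orderOf ρ = k)
    (hq : orderOf (faceRotation ρ τ) = q)
    (harith : Nat.card G * (k * q) = Nat.card G * (2 * q + k) + 2 * p ^ e * (k * q)) :
    ∃ n, HasPCover p n ρ τ :=
  hasPCover_of_prod (Q := PUnit) (s := 1) (t := 1) (IsPGroup.of_card (n := 0) (by simp)) h rfl
    (by rw [orderOf_one, Nat.lcm_one_left, hk])
    (by rw [Subsingleton.elim (faceRotation 1 1) (1 : PUnit), orderOf_one, Nat.lcm_one_left, hq])
    harith

/-- The dihedral group of order `10` times `Z₃`: a map of Euler characteristic `-7`. -/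
theorem infinite_rowExponents_cyclic : (rowExponents 7 .cyclic).Infinite := by
  have : Fact (Nat.Prime 7) := ⟨by norm_num⟩
  let G := DihedralGroup 5 × Multiplicative (ZMod 3)
  let a : G := (r 1, 1)
  let l : G := (sr 0, ofAdd 1)
  let t : G := (sr 0, 1)
  have ha : orderOf a = 5 := orderOf_eq_lcm orderOf_r_one orderOf_one rfl
  have hl : orderOf l = 6 := orderOf_eq_lcm (orderOf_sr 0) (orderOf_ofAdd_one 3) rfl
  have htl : t = l ^ 3 := by decide
  have hx : a * 1 * 1 * l = (sr (-1), ofAdd 1) := by decide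
  have hframe : RotaryFrame a 1 1 l t := {
    closure_eq := by
      set H := closure {a * 1 * 1 * l, t}
      have h1 : a * 1 * 1 * l ∈ H := subset_closure (by simp)
      have h2 : t ∈ H := subset_closure (by simp)
      have h3 : (r 1, 1) ∈ H :=
        (show (a * 1 * 1 * l) ^ 3 * t = (r 1, 1) by decide) ▸ H.mul_mem (H.pow_mem h1 3) h2
      have h4 : (1, ofAdd 1) ∈ H :=
        (show (a * 1 * 1 * l) ^ 4 = (1, ofAdd 1) by decide) ▸ H.pow_mem h1 4
      exact eq_top_of_comap_inl_inr (DihedralGroup.eq_top_of_mem (i := 0) h3 h2)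
        (ZMod.eq_top_of_ofAdd_one_mem h4)
    orderOf_t := orderOf_eq_lcm (orderOf_sr 0) orderOf_one rfl
    t_conj_a := by decide
    t_conj_c := by simp
    comm_ac := Commute.one_right _
    comm_bl := Commute.one_left _
    comm_bt := Commute.one_left _
    comm_lt := (commute_iff_eq _ _).2 (by decide)
    comm_bc := Commute.one_left _
    b_conj_a := by simp
    l_conj_a := conj_mem_zpowers_of_eq_inv (by decide)
    l_conj_c := by simp
    orderOf_c := ⟨0, by simp⟩
    coprime_a_six := by rw [ha]; rfl
    coprime_b_six := by simp
    coprime_ab := by simp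
    prime_dvd_l := fun q hq hql => by
      rw [hl, show 6 = 2 * 3 from rfl, hq.dvd_mul, Nat.prime_dvd_prime_iff_eq hq Nat.prime_two,
        Nat.prime_dvd_prime_iff_eq hq Nat.prime_three] at hql
      exact hql
    coprime_cl := by simp }
  have hcard : Nat.card G = 30 := by rw [card_dihedralGroup_prod, card_multiplicative_zmod]
  obtain ⟨n, hn⟩ := hasPCover_self (p := 7) (k := 6) (q := 5) (e := 1) hframe.isRotaryPair
    (hx ▸ orderOf_eq_lcm (orderOf_sr _) (orderOf_ofAdd_one 3) rfl)
    ((show faceRotation (a * 1 * 1 * l) t = (r 3, 1) by decide) ▸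
      orderOf_eq_lcm (orderOf_r_of_coprime rfl) orderOf_one rfl) (by rw [hcard]; norm_num)
  refine infinite_rowExponents hn (not_comm_prod _ (DihedralGroup.not_comm (by decide)))
    inferInstance (pCore_eq_bot_of_coprime (by rw [hcard]; norm_num)) fun G' _ _ e => ?_
  have := (map_one e ▸ hframe.map e).fitsRow_cyclic 7 (by
    rw [htl, map_pow]; exact pow_mem (mem_zpowers _) _)
  simpa using this

/-- The dihedral group of order `10`, generated by a rotation and a reflection. -/
theorem infinite_rowExponents_cyclicTimesTwo : (rowExponents 2 .cyclicTimesTwo).Infinite := by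
  let a : DihedralGroup 5 := r 1
  let t : DihedralGroup 5 := sr 0
  have ha : orderOf a = 5 := orderOf_r_one
  have hframe : RotaryFrame a 1 1 1 t := {
    closure_eq := by
      set H := closure {a * 1 * 1 * 1, t}
      have h1 : a * 1 * 1 * 1 ∈ H := subset_closure (by simp)
      have h2 : t ∈ H := subset_closure (by simp)
      exact DihedralGroup.eq_top_of_mem (i := 0) ((show a * 1 * 1 * 1 = r 1 by decide) ▸ h1) h2
    orderOf_t := orderOf_sr 0
    t_conj_a := by decide
    t_conj_c := by simp
    comm_ac := Commute.one_right _
    comm_bl := Commute.one_left _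
    comm_bt := Commute.one_left _
    comm_lt := Commute.one_left _
    comm_bc := Commute.one_left _
    b_conj_a := by simp
    l_conj_a := by simp
    l_conj_c := by simp
    orderOf_c := ⟨0, by simp⟩
    coprime_a_six := by rw [ha]; rfl
    coprime_b_six := by simp
    coprime_ab := by simp
    prime_dvd_l := fun q hq hql => by simp [hq.ne_one] at hql
    coprime_cl := by simp }
  obtain ⟨n, hn⟩ := hasPCover_self (p := 2) (k := 5) (q := 5) (e := 1) hframe.isRotaryPair
    ((show a * 1 * 1 * 1 = r 1 by decide) ▸ orderOf_r_one)
    ((show faceRotation (a * 1 * 1 * 1) t = r 3 by decide) ▸ orderOf_r_of_coprime rfl)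
    (by rw [DihedralGroup.nat_card]; norm_num)
  refine infinite_rowExponents hn (DihedralGroup.not_comm (by decide)) inferInstance
    (pCore_two_dihedralGroup (by decide) (by decide)) fun G' _ _ e => ?_
  have := (map_one e ▸ hframe.map e).fitsRow_cyclicTimesTwo (by
    rw [zpowers_one_eq_bot, mem_bot, EmbeddingLike.map_eq_one_iff]
    decide)
  simpa using this

/-- The symmetric group of degree `3`, generated by a rotation and a reflection; the group of the
first map is the product with `Z₂`. -/
theorem infinite_rowExponents_dihedralRotation :
    (rowExponents 2 .dihedralRotation).Infinite := by
  let c : DihedralGroup 3 := r 1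
  let t : DihedralGroup 3 := sr 0
  have hc : orderOf c = 3 := orderOf_r_one
  have hframe : RotaryFrame 1 c 1 1 t := {
    closure_eq := by
      set H := closure {1 * c * 1 * 1, t}
      have h1 : 1 * c * 1 * 1 ∈ H := subset_closure (by simp)
      have h2 : t ∈ H := subset_closure (by simp)
      exact DihedralGroup.eq_top_of_mem (i := 0) ((show 1 * c * 1 * 1 = r 1 by decide) ▸ h1) h2
    orderOf_t := orderOf_sr 0
    t_conj_a := by simp
    t_conj_c := by decide
    comm_ac := Commute.one_left _
    comm_bl := Commute.one_left _
    comm_bt := Commute.one_left _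
    comm_lt := Commute.one_left _
    comm_bc := Commute.one_left _
    b_conj_a := by simp
    l_conj_a := by simp
    l_conj_c := by simp
    orderOf_c := ⟨1, hc⟩
    coprime_a_six := by simp
    coprime_b_six := by simp
    coprime_ab := by simp
    prime_dvd_l := fun q hq hql => by simp [hq.ne_one] at hql
    coprime_cl := by simp }
  obtain ⟨n, hn⟩ := hasPCover_of_prod (p := 2) (s := ofAdd (1 : ZMod 2)) (t := 1) (k := 6) (q := 3)
    (e := 0) isPGroup_zmod_two hframe.isRotaryPair rfl
    (by rw [show 1 * c * 1 * 1 = r 1 by decide, orderOf_r_one, orderOf_ofAdd_one]; rfl)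
    (by rw [show faceRotation (1 * c * 1 * 1) t = r 1 by decide, orderOf_r_one,
          show faceRotation (ofAdd (1 : ZMod 2)) 1 = 1 by decide, orderOf_one]; rfl)
    (by rw [DihedralGroup.nat_card]; norm_num)
  refine infinite_rowExponents hn (DihedralGroup.not_comm (by decide)) inferInstance
    (pCore_two_dihedralGroup (by decide) (by decide)) fun G' _ _ e => ?_
  have := (map_one e ▸ hframe.map e).fitsRow_dihedralRotation
    ((map_ne_one_iff e e.injective).2 (by decide))
  simpa using this

/-- The symmetric group of degree `3` times `Z₅`: a map of Euler characteristic `-7`. -/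
theorem infinite_rowExponents_dihedralReflection :
    (rowExponents 7 .dihedralReflection).Infinite := by
  have : Fact (Nat.Prime 7) := ⟨by norm_num⟩
  let G := DihedralGroup 3 × Multiplicative (ZMod 5)
  let b : G := (1, ofAdd 1)
  let c : G := (r 1, 1)
  let t : G := (sr 0, 1)
  have hb : orderOf b = 5 := orderOf_eq_lcm orderOf_one (orderOf_ofAdd_one 5) rfl
  have hc : orderOf c = 3 := orderOf_eq_lcm orderOf_r_one orderOf_one rfl
  have ht : orderOf t = 2 := orderOf_eq_lcm (orderOf_sr 0) orderOf_one rfl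
  have hx : 1 * c * b * t = (sr (-1), ofAdd 1) := by decide
  have hframe : RotaryFrame 1 c b t t := {
    closure_eq := by
      set H := closure {1 * c * b * t, t}
      have h1 : 1 * c * b * t ∈ H := subset_closure (by simp)
      have h2 : t ∈ H := subset_closure (by simp)
      have h3 : (r 1, 1) ∈ H :=
        (show (1 * c * b * t) ^ 5 * t = (r 1, 1) by decide) ▸ H.mul_mem (H.pow_mem h1 5) h2
      have h4 : (1, ofAdd 1) ∈ H :=
        (show (1 * c * b * t) ^ 6 = (1, ofAdd 1) by decide) ▸ H.pow_mem h1 6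
      exact eq_top_of_comap_inl_inr (DihedralGroup.eq_top_of_mem (i := 0) h3 h2)
        (ZMod.eq_top_of_ofAdd_one_mem h4)
    orderOf_t := ht
    t_conj_a := by simp
    t_conj_c := by decide
    comm_ac := Commute.one_left _
    comm_bl := (commute_iff_eq _ _).2 (by decide)
    comm_bt := (commute_iff_eq _ _).2 (by decide)
    comm_lt := Commute.refl t
    comm_bc := (commute_iff_eq _ _).2 (by decide)
    b_conj_a := by simp
    l_conj_a := by simp
    l_conj_c := conj_mem_zpowers_of_eq_inv (by decide)
    orderOf_c := ⟨1, hc⟩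
    coprime_a_six := by simp
    coprime_b_six := by rw [hb]; rfl
    coprime_ab := by simp
    prime_dvd_l := prime_dvd_of_orderOf_eq_two ht
    coprime_cl := by rw [hc, ht]; rfl }
  have hcard : Nat.card G = 30 := by rw [card_dihedralGroup_prod, card_multiplicative_zmod]
  obtain ⟨n, hn⟩ := hasPCover_self (p := 7) (k := 10) (q := 3) (e := 1) hframe.isRotaryPair
    (hx ▸ orderOf_eq_lcm (orderOf_sr _) (orderOf_ofAdd_one 5) rfl)
    ((show faceRotation (1 * c * b * t) t = (r 1, 1) by decide) ▸
      orderOf_eq_lcm orderOf_r_one orderOf_one rfl) (by rw [hcard]; norm_num)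
  refine infinite_rowExponents hn (not_comm_prod _ (DihedralGroup.not_comm (by decide)))
    inferInstance (pCore_eq_bot_of_coprime (by rw [hcard]; norm_num)) fun G' _ _ e => ?_
  have := (map_one e ▸ hframe.map e).fitsRow_dihedralReflection
    ((map_ne_one_iff e e.injective).2 (by decide)) (p := 7) (by decide)
  simpa using this

/-- A product of dihedral groups of orders `26` and `6`; the group of the first map is a subgroup
of its product with the dihedral group of order `8`. -/
theorem infinite_rowExponents_cyclicTimesDihedralRotation :
    (rowExponents 2 .cyclicTimesDihedralRotation).Infinite := by
  let G := DihedralGroup 13 × DihedralGroup 3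
  let a : G := (r 1, 1)
  let c : G := (1, r 1)
  let l : G := (sr 0, 1)
  let t : G := (sr 0, sr 0)
  have ha : orderOf a = 13 := orderOf_eq_lcm orderOf_r_one orderOf_one rfl
  have hc : orderOf c = 3 := orderOf_eq_lcm orderOf_one orderOf_r_one rfl
  have hl : orderOf l = 2 := orderOf_eq_lcm (orderOf_sr 0) orderOf_one rfl
  have hx : a * c * 1 * l = (sr (-1), r 1) := by decide
  have hframe : RotaryFrame a c 1 l t := {
    closure_eq := by
      set H := closure {a * c * 1 * l, t}
      have h1 : a * c * 1 * l ∈ H := subset_closure (by simp)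
      have h2 : t ∈ H := subset_closure (by simp)
      have h3 : (1, r 1) ∈ H :=
        (show (a * c * 1 * l) ^ 4 = (1, r 1) by decide) ▸ H.pow_mem h1 4
      have h4 : (sr (-1), 1) ∈ H :=
        (show (a * c * 1 * l) ^ 3 = (sr (-1), 1) by decide) ▸ H.pow_mem h1 3
      -- the commutator of `(sr (-1), 1)` and `(sr 0, sr 0)` is `(r 2, 1)`, of odd order
      have h5 : (r 1, 1) ∈ H :=
        (show (((sr (-1), 1) : G) * t * (sr (-1), 1) * t) ^ 7 = (r 1, 1) by decide) ▸
          H.pow_mem (H.mul_mem (H.mul_mem (H.mul_mem h4 h2) h4) h2) 7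
      have h6 : (1, sr 0) ∈ H :=
        (show (r 1, 1)⁻¹ * (sr (-1), 1) * t = ((1, sr 0) : G) by decide) ▸
          H.mul_mem (H.mul_mem (H.inv_mem h5) h4) h2
      exact eq_top_of_comap_inl_inr (DihedralGroup.eq_top_of_mem h5 h4)
        (DihedralGroup.eq_top_of_mem h3 h6)
    orderOf_t := orderOf_eq_lcm (orderOf_sr 0) (orderOf_sr 0) rfl
    t_conj_a := by decide
    t_conj_c := by decide
    comm_ac := (commute_iff_eq _ _).2 (by decide)
    comm_bl := Commute.one_left _
    comm_bt := Commute.one_left _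
    comm_lt := (commute_iff_eq _ _).2 (by decide)
    comm_bc := Commute.one_left _
    b_conj_a := by simp
    l_conj_a := conj_mem_zpowers_of_eq_inv (by decide)
    l_conj_c := conj_mem_zpowers_of_eq (by decide)
    orderOf_c := ⟨1, hc⟩
    coprime_a_six := by rw [ha]; rfl
    coprime_b_six := by simp
    coprime_ab := by simp
    prime_dvd_l := prime_dvd_of_orderOf_eq_two hl
    coprime_cl := by rw [hc, hl]; rfl }
  have hcard : Nat.card G = 156 := by rw [card_dihedralGroup_prod, DihedralGroup.nat_card]
  obtain ⟨n, hn⟩ := hasPCover_of_prod (p := 2) (s := (r 1 : DihedralGroup 4)) (t := sr 0)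
    (k := 12) (q := 78) (e := 6) isPGroup_dihedralGroup_four hframe.isRotaryPair
    (sr_mul_self 0)
    (by rw [hx, Prod.orderOf_mk, orderOf_sr, orderOf_r_one, orderOf_r_one]; rfl)
    (by rw [show faceRotation (a * c * 1 * l) t = (r 11, r 1) by decide, Prod.orderOf_mk,
          orderOf_r, orderOf_r,
          show faceRotation (r 1 : DihedralGroup 4) (sr 0) = r 2 by decide, orderOf_r]; rfl)
    (by rw [hcard]; norm_num)
  refine infinite_rowExponents hn (not_comm_prod _ (DihedralGroup.not_comm (by decide)))
    inferInstance (pCore_prod_eq_bot (pCore_two_dihedralGroup (by decide) (by decide))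
      (pCore_two_dihedralGroup (by decide) (by decide))) fun G' _ _ e => ?_
  have := (map_one e ▸ hframe.map e).fitsRow_cyclicTimesDihedralRotation
    ((map_ne_one_iff e e.injective).2 (by decide)) one_pos ((e.orderOf_eq l).trans hl)
    (not_mem_zpowers_of_mul_self
      (by rw [← map_mul, show l * l = 1 by decide, map_one])
      ((map_ne_one_iff e e.injective).2 (by decide)) (e.injective.ne (by decide)))
    (((commute_iff_eq l c).2 (by decide)).map e)
  simpa using this

/-- A product of dihedral groups of orders `114` and `10`; the group of the first map is a subgroup
of its product with the dihedral group of order `8`. -/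
theorem infinite_rowExponents_cyclicTimesDihedralReflection :
    (rowExponents 2 .cyclicTimesDihedralReflection).Infinite := by
  let G := DihedralGroup 57 × DihedralGroup 5
  let a : G := (r 39, r 1)
  let c : G := (r 19, 1)
  let l : G := (sr 0, 1)
  let t : G := (sr 0, sr 0)
  have ha : orderOf a = 95 := by rw [Prod.orderOf_mk, orderOf_r, orderOf_r_one]; rfl
  have hc : orderOf c = 3 := by rw [Prod.orderOf_mk, orderOf_r, orderOf_one]; rfl
  have hl : orderOf l = 2 := orderOf_eq_lcm (orderOf_sr 0) orderOf_one rfl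
  have hx : a * c * 1 * l = (sr (-1), r 1) := by decide
  have hframe : RotaryFrame a c 1 l t := {
    closure_eq := by
      set H := closure {a * c * 1 * l, t}
      have h1 : a * c * 1 * l ∈ H := subset_closure (by simp)
      have h2 : t ∈ H := subset_closure (by simp)
      have h3 : (1, r 1) ∈ H :=
        (show (a * c * 1 * l) ^ 6 = (1, r 1) by decide) ▸ H.pow_mem h1 6
      have h4 : (sr (-1), 1) ∈ H :=
        (show (a * c * 1 * l) ^ 5 = (sr (-1), 1) by decide) ▸ H.pow_mem h1 5
      -- the commutator of `(sr (-1), 1)` and `(sr 0, sr 0)` is `(r 2, 1)`, of odd order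
      have h5 : (r 1, 1) ∈ H :=
        (show (((sr (-1), 1) : G) * t * (sr (-1), 1) * t) ^ 29 = (r 1, 1) by decide) ▸
          H.pow_mem (H.mul_mem (H.mul_mem (H.mul_mem h4 h2) h4) h2) 29
      have h6 : (1, sr 0) ∈ H :=
        (show (r 1, 1)⁻¹ * (sr (-1), 1) * t = ((1, sr 0) : G) by decide) ▸
          H.mul_mem (H.mul_mem (H.inv_mem h5) h4) h2
      exact eq_top_of_comap_inl_inr (DihedralGroup.eq_top_of_mem h5 h4)
        (DihedralGroup.eq_top_of_mem h3 h6)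
    orderOf_t := orderOf_eq_lcm (orderOf_sr 0) (orderOf_sr 0) rfl
    t_conj_a := by decide
    t_conj_c := by decide
    comm_ac := (commute_iff_eq _ _).2 (by decide)
    comm_bl := Commute.one_left _
    comm_bt := Commute.one_left _
    comm_lt := (commute_iff_eq _ _).2 (by decide)
    comm_bc := Commute.one_left _
    b_conj_a := by simp
    l_conj_a := by
      -- `56` is `-1` modulo `19` and `1` modulo `5`
      rw [show l * a * l⁻¹ = a ^ 56 by decide]
      exact pow_mem (mem_zpowers a) 56
    l_conj_c := conj_mem_zpowers_of_eq_inv (by decide)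
    orderOf_c := ⟨1, hc⟩
    coprime_a_six := by rw [ha]; rfl
    coprime_b_six := by simp
    coprime_ab := by simp
    prime_dvd_l := prime_dvd_of_orderOf_eq_two hl
    coprime_cl := by rw [hc, hl]; rfl }
  have hcard : Nat.card G = 1140 := by rw [card_dihedralGroup_prod, DihedralGroup.nat_card]
  obtain ⟨n, hn⟩ := hasPCover_of_prod (p := 2) (s := (r 1 : DihedralGroup 4)) (t := sr 0)
    (k := 20) (q := 570) (e := 9) isPGroup_dihedralGroup_four hframe.isRotaryPair
    (sr_mul_self 0)
    (by rw [hx, Prod.orderOf_mk, orderOf_sr, orderOf_r_one, orderOf_r_one]; rfl)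
    (by rw [show faceRotation (a * c * 1 * l) t = (r 55, r 3) by decide, Prod.orderOf_mk,
          orderOf_r, orderOf_r,
          show faceRotation (r 1 : DihedralGroup 4) (sr 0) = r 2 by decide, orderOf_r]; rfl)
    (by rw [hcard]; norm_num)
  refine infinite_rowExponents hn (not_comm_prod _ (DihedralGroup.not_comm (by decide)))
    inferInstance (pCore_prod_eq_bot (pCore_two_dihedralGroup (by decide) (by decide))
      (pCore_two_dihedralGroup (by decide) (by decide))) fun G' _ _ e => ?_
  have := (map_one e ▸ hframe.map e).fitsRow_cyclicTimesDihedralReflection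
    ((map_ne_one_iff e e.injective).2 (by decide)) one_pos ((e.orderOf_eq l).trans hl)
    (not_mem_zpowers_of_mul_self
      (by rw [← map_mul, show l * l = 1 by decide, map_one])
      ((map_ne_one_iff e e.injective).2 (by decide)) (e.injective.ne (by decide)))
    (by rw [← map_inv, ← map_mul, ← map_mul, show l * c * l⁻¹ = c⁻¹ by decide, map_inv])
  simpa using this

/-- The alternating group of degree `4` times `Z₅`: a map of Euler characteristic `-11`. -/
theorem infinite_rowExponents_kleinByCyclic : (rowExponents 11 .kleinByCyclic).Infinite := by
  have : Fact (Nat.Prime 11) := ⟨by norm_num⟩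
  let G := alternatingGroup (Fin 4) × Multiplicative (ZMod 5)
  let x : G := (altThreeCycle, ofAdd 1)
  let t : G := (altDoubleTransposition, 1)
  have hc : orderOf altThreeCycle = 3 := orderOf_eq_prime (by decide) (by decide)
  have hd : orderOf altDoubleTransposition = 2 := orderOf_eq_prime (by decide) (by decide)
  have hx : orderOf x = 15 := orderOf_eq_lcm hc (orderOf_ofAdd_one 5) rfl
  have ht : orderOf t = 2 := orderOf_eq_lcm hd orderOf_one rfl
  have hgen : closure {x, t} = ⊤ := by
    set H := closure {x, t}
    have h1 : x ∈ H := subset_closure (by simp)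
    have h2 : t ∈ H := subset_closure (by simp)
    have h4 : (1, ofAdd 1) ∈ H := (show x ^ 6 = (1, ofAdd 1) by decide) ▸ H.pow_mem h1 6
    have h3 : (altThreeCycle, 1) ∈ H :=
      (show x * (1, ofAdd 1)⁻¹ = (altThreeCycle, 1) by decide) ▸ H.mul_mem h1 (H.inv_mem h4)
    exact eq_top_of_comap_inl_inr (alternatingGroup_four_eq_top h3 h2)
      (ZMod.eq_top_of_ofAdd_one_mem h4)
  have hcard : Nat.card G = 60 := by
    rw [Nat.card_prod, card_multiplicative_zmod, nat_card_alternatingGroup, Nat.card_fin]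
    rfl
  obtain ⟨n, hn⟩ := hasPCover_self (p := 11) (k := 15) (q := 2) (e := 1) ⟨ht, hgen⟩ hx
    (orderOf_eq_prime (by decide) (by decide)) (by rw [hcard]; norm_num)
  have := alternatingGroup_four_isSolvable
  refine infinite_rowExponents hn
    (not_comm_prod _ fun h => absurd (h altThreeCycle altDoubleTransposition) (by decide))
    inferInstance (pCore_eq_bot_of_coprime (by rw [hcard]; norm_num)) fun G' _ _ e => ?_
  refine fitsRow_kleinByCyclic ?_ ((e.orderOf_eq t).trans ht) ?_ ?_ ?_ ?_ (by decide)
  · have h1 := congrArg (Subgroup.map e.toMonoidHom) hgen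
    rw [MonoidHom.map_closure, Set.image_pair,
      Subgroup.map_top_of_surjective _ e.surjective] at h1
    exact h1
  · rw [e.orderOf_eq, hx]; decide
  · rw [← map_inv, ← map_mul, ← map_mul]; exact e.injective.ne (by decide)
  · rw [← map_inv, ← map_mul, ← map_mul]
    exact ((commute_iff_eq t (x * t * x⁻¹)).2 (by decide)).map e
  · simp only [← map_inv, ← map_mul]
    exact congrArg e (by decide)

end Examples

theorem theorem1 :
    (∀ (p n : ℕ) (X : Type u) [Group X] [Finite X] (x y : X) (h : IsRotaryPair x y),
      IsSolvableCase p n x y h → ∃ row : SolvableRow, QuotientInRow p x y row) ∧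
    (∀ row : SolvableRow, ∃ p : ℕ, p.Prime ∧
      {n : ℕ | ∃ (X : Type) (_ : Group X) (_ : Finite X) (x y : X) (h : IsRotaryPair x y),
        IsSolvableCase p n x y h ∧ QuotientInRow p x y row}.Infinite) := by
  refine ⟨fun p n X _ _ x y h hs => exists_quotientInRow h hs, fun row => ?_⟩
  cases row
  · exact ⟨7, by norm_num, infinite_rowExponents_cyclic⟩
  · exact ⟨2, Nat.prime_two, infinite_rowExponents_cyclicTimesTwo⟩
  · exact ⟨2, Nat.prime_two, infinite_rowExponents_dihedralRotation⟩
  · exact ⟨7, by norm_num, infinite_rowExponents_dihedralReflection⟩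
  · exact ⟨2, Nat.prime_two, infinite_rowExponents_cyclicTimesDihedralRotation⟩
  · exact ⟨2, Nat.prime_two, infinite_rowExponents_cyclicTimesDihedralReflection⟩
  · exact ⟨11, by norm_num, infinite_rowExponents_kleinByCyclic⟩
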